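/- **Setting (even pairs).** Let $L_{\max}\ge 1$ and $d\ge 2L_{\max}$. For a binary sequence $X=(w_1,\dots,w_L)\in\{a,b\}^L$, $1\le L\le L_{\max}$, let $x_\ell=e_{2\ell-1}\in\mathbb R^d$ if $w_\ell=a$ and $x_\ell=e_{2\ell}$ if $w_\ell=b$, and let the label be $y_X=1$ if the total number of occurrences of $ab$ and $ba$ as consecutive tokens of $X$ is even, $y_X=-1$ otherwise. For $u\in\mathbb R^d$, $W\in\mathbb R^{d\times d}$ and $\lambda>0$ put $v_X(W)=\sum_{\ell=1}^L\varphi_\ell x_\ell$, where $\varphi=\mathrm{softmax}\big((x_\ell^\top W x_L/\lambda)_{\ell\le L}\big)$, and $$\mathcal L(u,W)=\sum_{L=1}^{L_{\max}}2^{-L}\sum_{X\in\{a,b\}^L}\log\big(1+\exp(-y_X\,u^\top v_X(W))\big).$$ Run gradient descent from $u_0=0$, $W_0=0$: $u_{t+1}=u_t-\eta\nabla_u\mathcal L(u_t,W_t)$, and $W_{t+1}=W_t-\eta\lambda\nabla_W\mathcal L(u_t,W_t)$ for $t\le t_0$, $W_{t+1}=W_t-\eta\nabla_W\mathcal L(u_t,W_t)$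 for $t>t_0$. Here $\|\cdot\|$ is the Euclidean norm of vectors and the Frobenius norm of matrices. Let $T=\lambda^{2/3}/(2^{2/3}\eta L_{\max})$. **Theorem.** There are absolute constants $C_\lambda,c_\eta,c_0,K,c,C>0$ such that the following holds for all $L_{\max}\ge1$, $d\ge 2L_{\max}$, $\lambda\ge C_\lambda L_{\max}^2$, $0<\eta\le c_\eta\min\{1/L_{\max},\lambda^{-2/3}\}$ and all integers $2\le t_0\le c_0/(\eta L_{\max})$. The max-margin separator of the attention outputs at time $t_0$, $$u_{EP}^*=\arg\min\big\{\|u\| : \langle u,\,y_X v_X(W_{t_0})\rangle\ge1\ \text{ for all } X\in\{a,b\}^L,\ 1\le L\le L_{\max}\big\},$$ exists, and there is an integer $t_2>t_0$ with $e/\eta\le t_2\le K/\eta$ and $t_2\le T$ such that for every integer $t$ with $t_2\le t\le T$: 1. $\|u_t\|\ge c\log(\eta t)$ and $\|u_t\|\ge \dfrac{c}{1+\log(1/\eta)}\,\log t$; 2. $\displaystyle\Big\langle\frac{u_t}{\|u_t\|},\frac{u_{EP}^*}{\|u_{EP}^*\|}\Big\rangle\ \ge\ 1-\frac12\Big(\frac1{6\|u_{EP}^*\|}-\frac1{\|u_t\|}\Big)^2$;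 3. $\|W_t-W_{t_0}\|\le C$. -/

import Mathlib

open scoped BigOperators

/-! One-layer softmax-attention transformer trained by two-phase gradient descent on the
even pairs task.  A sequence of length `k + 1` over the alphabet `{a, b}` is a function
`X : Fin (k + 1) → Bool`, where `false` is the token `a` and `true` is the token `b`.
Positions are counted from `0`, so the last position is `Fin.last k`. -/

namespace EvenPairs

noncomputable section

/-- The linear layer `u ∈ ℝ^d`, with the Euclidean norm. -/
abbrev Vec (d : ℕ) := EuclideanSpace ℝ (Fin d)

/-- The attention layer `W ∈ ℝ^{d × d}`.  The Euclidean norm of the `d * d` entries is the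
Frobenius norm. -/
abbrev Mat (d : ℕ) := EuclideanSpace ℝ (Fin d × Fin d)

/-- The bilinear form `xᵀ W y`. -/
def form {d : ℕ} (W : Mat d) (x y : Vec d) : ℝ :=
  ∑ i, ∑ j, x i * W (i, j) * y j

/-- The embedding of a token at position `k` (counted from `0`): with 1-based indices, the
token `a` at position `ℓ = k + 1` is `e_{2ℓ-1}` and the token `b` is `e_{2ℓ}`. -/
def embed (d k : ℕ) (w : Bool) : Vec d :=
  WithLp.toLp 2 fun i => if (i : ℕ) = 2 * k + (if w then 1 else 0) then 1 else 0

/-- The softmax function. -/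
def softmax {n : ℕ} (v : Fin n → ℝ) (i : Fin n) : ℝ :=
  Real.exp (v i) / ∑ j, Real.exp (v j)

/-- The attention weights `φ_ℓ = [softmax (Xᵀ W x_L / lam)]_ℓ`. -/
def attnWeight {d k : ℕ} (lam : ℝ) (W : Mat d) (X : Fin (k + 1) → Bool) : Fin (k + 1) → ℝ :=
  softmax fun l => form W (embed d l (X l)) (embed d k (X (Fin.last k))) / lam

/-- The output `∑ ℓ, φ_ℓ x_ℓ` of the attention layer. -/
def attnOut {d k : ℕ} (lam : ℝ) (W : Mat d) (X : Fin (k + 1) → Bool) : Vec d :=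
  ∑ l, attnWeight lam W X l • embed d l (X l)

/-- The transformer `T_θ(X) = uᵀ ∑ ℓ, φ_ℓ x_ℓ`. -/
def transformer {d k : ℕ} (lam : ℝ) (u : Vec d) (W : Mat d) (X : Fin (k + 1) → Bool) : ℝ :=
  inner ℝ u (attnOut lam W X)

/-- The number of occurrences of `ab` and of `ba` as two consecutive tokens of `X`. -/
def pairCount {k : ℕ} (X : Fin (k + 1) → Bool) : ℕ :=
  (Finset.univ.filter fun p : Fin (k + 1) × Fin (k + 1) =>
    (p.1 : ℕ) + 1 = p.2 ∧
      ((X p.1 = false ∧ X p.2 = true) ∨ (X p.1 = true ∧ X p.2 = false))).card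

/-- The label of the even pairs task: `1` if the number of pairs is even, `-1` otherwise. -/
def label {k : ℕ} (X : Fin (k + 1) → Bool) : ℝ :=
  if Even (pairCount X) then 1 else -1

/-- The logistic loss over all sequences of length `1, …, Lmax`; each length is averaged. -/
def loss {d : ℕ} (Lmax : ℕ) (lam : ℝ) (u : Vec d) (W : Mat d) : ℝ :=
  ∑ k ∈ Finset.range Lmax,
    1 / (Fintype.card (Fin (k + 1) → Bool) : ℝ) *
      ∑ X : Fin (k + 1) → Bool,
        Real.log (1 + Real.exp (-(label X * transformer lam u W X)))

/-- Two-phase gradient descent `(u_t, W_t)` from zero initialization: the step size of `u` is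
always `η`; the step size of `W` is `η * lam` at the steps `t ≤ t₀` and `η` afterwards. -/
def gd (d Lmax : ℕ) (lam η : ℝ) (t₀ : ℕ) : ℕ → Vec d × Mat d
  | 0 => (0, 0)
  | t + 1 =>
    let θ := gd d Lmax lam η t₀ t
    (θ.1 - η • gradient (fun u => loss Lmax lam u θ.2) θ.1,
      θ.2 - (η * if t ≤ t₀ then lam else 1) • gradient (fun W => loss Lmax lam θ.1 W) θ.2)

/-- `u` classifies every attention output under `W` with margin at least `1`. -/
def HasUnitMargin {d : ℕ} (Lmax : ℕ) (lam : ℝ) (W : Mat d) (u : Vec d) : Prop :=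
  ∀ k < Lmax, ∀ X : Fin (k + 1) → Bool, 1 ≤ inner ℝ u (label X • attnOut lam W X)

/-- `u` is the max-margin separator of the attention outputs under `W`: a vector of minimal
norm among those with margin at least `1` (it is unique, by strict convexity of the norm). -/
def IsMaxMargin {d : ℕ} (Lmax : ℕ) (lam : ℝ) (W : Mat d) (u : Vec d) : Prop :=
  HasUnitMargin Lmax lam W u ∧ ∀ v, HasUnitMargin Lmax lam W v → ‖u‖ ≤ ‖v‖

/-- The horizon `T = lam^{2/3} / (2^{2/3} η Lmax)` of the second phase. -/
def horizon (Lmax : ℕ) (lam η : ℝ) : ℝ :=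
  lam ^ (2 / 3 : ℝ) / ((2 : ℝ) ^ (2 / 3 : ℝ) * η * Lmax)

end

end EvenPairs

namespace EvenPairs

open Finset

noncomputable section

/-! The loss is invariant under exchanging the two letters, so `u_t` keeps equal coordinates at the
two tokens of each position, and the linear layer reduces to a sequence `a` with one number per
position. The label is `1` exactly when the first and the last token agree (`label_eq`). Under
exactly uniform attention a sequence of length `k + 1 ≥ 2` has the score `avgMargin a k` whatever
its letters, and both labels are equally frequent. Such sequences therefore only pull `avgMargin a
k` towards `0`, while the sequences of length one push `a 0` up. The direction with coordinates `1,
-1, 0, 0, ...` is invisible to every sequence of length at least two; along it `a` grows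
logarithmically under the force `sg (a 0) / 2`, and transversally it is damped. At high temperature
the attention stays within `O(1 / lam)` of uniform during the whole horizon, so the true dynamics is
a small perturbation of this `drift`.

The constants must not depend on the number `n` of positions. The Lyapunov function `lyap` bounds
the total dissipation by an absolute constant (`lyap_step`, `PerturbedFlow.inv`). Dissipation
controls the coordinates below a fixed `J` only (`perpSq_le_of_dissip`). The coordinates beyond `J`
are small at all times, because their growth is fed by one partial average for each possible
starting point, and these averages share a finite dissipation budget; summing with weights `1 / j`
makes the tail `O(1 / log J)` (`PerturbedFlow.tailSq_mul_harmonic_le`). After an absolute rescaled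
time some moment has small dissipation, hence small `lyap`, and monotonicity of `lyap` preserves
this (`exists_flow_constants`).

For the max-margin separator, the first phase makes attention prefer the first position to the
second exactly when first and last token agree (`attn_gap`), so a separator exists. Flipping the
first token reverses the label but hardly changes the almost uniform attention. A separator must
therefore have norm at least of order `lam`, with averages that are small relative to its norm, and
so it is nearly parallel to the same direction (`separator_direction`). The iterate and the
separator being close to one line, `alignment` compares their angle with the claimed bound. -/

/-! ### Estimates for the logistic function. -/

/-- The logistic weight `1 / (1 + eˣ)`, minus the derivative of `log (1 + e⁻ˣ)`. -/
def sg (x : ℝ) : ℝ := 1 / (1 + Real.exp x)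

/-- The centred logistic function `1 / 2 - sg x = tanh (x / 2) / 2`. -/
def psi (x : ℝ) : ℝ := 1 / 2 - sg x

lemma sg_pos (x : ℝ) : 0 < sg x := by unfold sg; positivity

lemma sg_le_one (x : ℝ) : sg x ≤ 1 := by
  unfold sg
  rw [div_le_one (by positivity)]
  linarith [Real.exp_pos x]

lemma sg_zero : sg 0 = 1 / 2 := by norm_num [sg]

lemma sg_neg (x : ℝ) : sg (-x) = 1 - sg x := by
  have := Real.exp_pos x
  unfold sg
  rw [Real.exp_neg]
  field_simp
  ring

lemma sg_antitone {x y : ℝ} (h : x ≤ y) : sg y ≤ sg x := by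
  unfold sg
  exact one_div_le_one_div_of_le (by positivity) (by linarith [Real.exp_le_exp.2 h])

lemma sg_le_exp_neg (x : ℝ) : sg x ≤ Real.exp (-x) := by
  unfold sg
  rw [Real.exp_neg, ← one_div]
  exact one_div_le_one_div_of_le (Real.exp_pos x) (by linarith)

lemma sg_sub_le {x y : ℝ} (h : x ≤ y) : sg x - sg y ≤ y - x := by
  have hx := Real.exp_pos x
  have hy := Real.exp_pos y
  have h1 : sg x - sg y = (Real.exp y - Real.exp x) / ((1 + Real.exp x) * (1 + Real.exp y)) := by
    unfold sg; field_simp; ring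
  have h2 : (1 + (x - y)) * Real.exp y ≤ Real.exp x := by
    have := Real.add_one_le_exp (x - y)
    have h3 : Real.exp x = Real.exp (x - y) * Real.exp y := by rw [← Real.exp_add]; ring_nf
    rw [h3]
    exact mul_le_mul_of_nonneg_right (by linarith) hy.le
  rw [h1, div_le_iff₀ (by positivity)]
  nlinarith [mul_nonneg (sub_nonneg.2 h) hx.le, mul_nonneg (sub_nonneg.2 h) hy.le,
    mul_nonneg (sub_nonneg.2 h) (mul_pos hx hy).le]

lemma abs_sg_sub_le (x y : ℝ) : |sg x - sg y| ≤ |x - y| := by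
  rcases le_total x y with h | h
  · rw [abs_of_nonneg (by linarith [sg_antitone h]), abs_sub_comm, abs_of_nonneg (by linarith)]
    exact sg_sub_le h
  · rw [abs_sub_comm, abs_of_nonneg (by linarith [sg_antitone h]), abs_of_nonneg (by linarith)]
    exact sg_sub_le h

lemma abs_psi_le (x : ℝ) : |psi x| ≤ |x| := by
  have := abs_sg_sub_le 0 x
  rw [sg_zero, zero_sub, abs_neg] at this
  exact this

lemma psi_neg (x : ℝ) : psi (-x) = -psi x := by unfold psi; rw [sg_neg]; ring

lemma psi_nonneg {x : ℝ} (h : 0 ≤ x) : 0 ≤ psi x := by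
  have := sg_antitone h
  rw [sg_zero] at this
  unfold psi; linarith

lemma psi_lower {x : ℝ} (h : 0 ≤ x) : x / (2 * (2 + x)) ≤ psi x := by
  have h1 := Real.add_one_le_exp x
  have h2 := Real.exp_pos x
  have : psi x = 1 / 2 - 1 / (1 + Real.exp x) := rfl
  rw [this, show x / (2 * (2 + x)) = 1 / 2 - 1 / (2 + x) by field_simp; ring]
  have := one_div_le_one_div_of_le (by linarith : 0 < 2 + x) (by linarith : 2 + x ≤ 1 + Real.exp x)
  linarith

lemma mul_psi_nonneg (x : ℝ) : 0 ≤ x * psi x := by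
  rcases le_total 0 x with h | h
  · exact mul_nonneg h (psi_nonneg h)
  · have := psi_nonneg (neg_nonneg.2 h)
    rw [psi_neg] at this
    nlinarith

/-- On bounded intervals `psi` is comparable to the identity; this converts the dissipation into a
sum of squared margins. -/
lemma mul_psi_lower {x b : ℝ} (h : |x| ≤ b) : x ^ 2 / (2 * (2 + b)) ≤ x * psi x := by
  have key : ∀ y : ℝ, 0 ≤ y → y ≤ b → y ^ 2 / (2 * (2 + b)) ≤ y * psi y := by
    intro y hy hyb
    have h1 := mul_le_mul_of_nonneg_left (psi_lower hy) hy
    refine le_trans ?_ h1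
    rw [← mul_div_assoc, ← sq]
    exact div_le_div_of_nonneg_left (sq_nonneg y) (by linarith) (by linarith)
  rcases le_total 0 x with hx | hx
  · exact key x hx ((abs_of_nonneg hx) ▸ h)
  · have := key (-x) (by linarith) ((abs_of_nonpos hx) ▸ h)
    rw [psi_neg] at this
    simpa using this

/-- Used with `m` a full margin and `y` the share of its leading coordinates, so that `m - y` is the
share of the tail. If `psi m` and `m - y` have the same sign there is nothing to pay; otherwise
`|psi m| ≤ |m|` and `m * (y - m) ≤ y ^ 2 / 4`. -/
lemma neg_psi_mul_sub_le (m y : ℝ) : -(psi m * (m - y)) ≤ y ^ 2 / 4 := by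
  have h0 := mul_psi_nonneg m
  rcases le_or_gt 0 (m * (m - y)) with h | h
  · have : 0 ≤ psi m * (m - y) := by
      rcases lt_trichotomy m 0 with hm | hm | hm
      · have h1 : m - y ≤ 0 := by nlinarith
        have h2 : psi m ≤ 0 := by nlinarith
        nlinarith
      · subst hm; simp [psi, sg_zero]
      · have h1 : 0 ≤ m - y := by nlinarith
        have h2 := psi_nonneg hm.le
        positivity
    nlinarith [sq_nonneg y]
  · have h1 : -(psi m * (m - y)) ≤ |m| * |m - y| := by
      refine (neg_le_abs _).trans ?_
      rw [abs_mul]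
      exact mul_le_mul_of_nonneg_right (abs_psi_le m) (abs_nonneg _)
    rw [← abs_mul, abs_of_neg h] at h1
    nlinarith [sq_nonneg (m - y / 2)]

/-! ### One step of gradient descent near uniform attention. -/

/-- The margin of a sequence of length `k + 1` under uniform attention. -/
def avgMargin (a : ℕ → ℝ) (k : ℕ) : ℝ := (∑ i ∈ range (k + 1), a i) / (k + 1)

/-- Minus the gradient of the loss under uniform attention, in the coordinates `a`. -/
def drift (n : ℕ) (a : ℕ → ℝ) (l : ℕ) : ℝ :=
  (if l = 0 then sg (a 0) / 2 else 0) -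
    ∑ k ∈ Ico 1 n, if l ≤ k then psi (avgMargin a k) / (2 * (k + 1)) else 0

/-- A test vector `c` meets the sequences of length `k + 1` only through its partial sum. The
one-step estimates below are three choices of `c`. -/
lemma sum_mul_drift {n : ℕ} (hn : 1 ≤ n) (a c : ℕ → ℝ) :
    ∑ l ∈ range n, c l * drift n a l = c 0 * sg (a 0) / 2 -
      ∑ k ∈ Ico 1 n, psi (avgMargin a k) / (2 * (k + 1)) * ∑ l ∈ range (k + 1), c l := by
  unfold drift
  simp_rw [mul_sub, Finset.sum_sub_distrib]
  congr 1
  · rw [Finset.sum_eq_single 0]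
    · simp; ring
    · intro b _ hb; simp [hb]
    · intro h; simp at h; omega
  · simp_rw [Finset.mul_sum]
    rw [Finset.sum_comm]
    refine Finset.sum_congr rfl fun k hk => ?_
    have hk' := (Finset.mem_Ico.1 hk).2
    simp_rw [mul_ite, mul_zero]
    rw [← Finset.sum_filter]
    have : (range n).filter (fun l => l ≤ k) = range (k + 1) := by
      ext l; simp; omega
    rw [this]
    exact Finset.sum_congr rfl fun l _ => by ring

/-- The squared distance of `a` from the line through the separating direction. -/
def perpSq (n : ℕ) (a : ℕ → ℝ) : ℝ := (a 0 + a 1) ^ 2 + 2 * ∑ l ∈ Ico 2 n, a l ^ 2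

/-- The dissipation of `perpSq`. -/
def dissip (n : ℕ) (a : ℕ → ℝ) : ℝ := ∑ k ∈ Ico 1 n, avgMargin a k * psi (avgMargin a k)

/-- The squared norm of the coordinates from `J` on. -/
def tailSq (n J : ℕ) (a : ℕ → ℝ) : ℝ := 2 * ∑ l ∈ Ico J n, a l ^ 2

lemma dissip_nonneg (n : ℕ) (a : ℕ → ℝ) : 0 ≤ dissip n a :=
  Finset.sum_nonneg fun _ _ => mul_psi_nonneg _

lemma perpSq_nonneg (n : ℕ) (a : ℕ → ℝ) : 0 ≤ perpSq n a := by unfold perpSq; positivity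

lemma range_eq_two_add {n : ℕ} (hn : 2 ≤ n) (f : ℕ → ℝ) :
    ∑ l ∈ range n, f l = f 0 + f 1 + ∑ l ∈ Ico 2 n, f l := by
  rw [← Finset.sum_range_add_sum_Ico f hn]
  simp [Finset.sum_range_succ]

/-- Error of replacing `h` by `drift` in a linear functional. -/
lemma abs_sum_mul_sub_le {n : ℕ} {c h g : ℕ → ℝ} {ε B : ℝ} (hε : 0 ≤ ε) (hB : 0 ≤ B)
    (he : ∑ l ∈ range n, (h l - g l) ^ 2 ≤ ε ^ 2) (hc : ∑ l ∈ range n, c l ^ 2 ≤ B ^ 2) :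
    |∑ l ∈ range n, c l * h l - ∑ l ∈ range n, c l * g l| ≤ B * ε := by
  rw [← Finset.sum_sub_distrib]
  simp_rw [← mul_sub]
  apply abs_le_of_sq_le_sq _ (by positivity)
  refine (Finset.sum_mul_sq_le_sq_mul_sq _ _ _).trans ?_
  rw [mul_pow]
  exact mul_le_mul hc he (Finset.sum_nonneg fun _ _ => sq_nonneg _) (sq_nonneg _)

/-- The test vector is half the gradient of `perpSq`. Its partial sums of length at least two are
twice those of `a`, so pairing it with `drift` produces exactly `dissip`. -/
lemma perpSq_step {n : ℕ} (hn : 2 ≤ n) {a h : ℕ → ℝ} {η ε G : ℝ} (hη : 0 ≤ η) (hε : 0 ≤ ε)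
    (he : ∑ l ∈ range n, (h l - drift n a l) ^ 2 ≤ ε ^ 2)
    (hG : ∑ l ∈ range n, h l ^ 2 ≤ G) (hq : perpSq n a ≤ 64) :
    perpSq n (fun l => a l + η * h l) ≤ perpSq n a
      + η * ((a 0 + a 1) * sg (a 0) - 2 * dissip n a) + 24 * η * ε + 2 * η ^ 2 * G := by
  set c : ℕ → ℝ := fun l => if l < 2 then a 0 + a 1 else 2 * a l with hc
  have hcS : ∀ f : ℕ → ℝ, ∑ l ∈ range n, c l * f l
      = (a 0 + a 1) * (f 0 + f 1) + 2 * ∑ l ∈ Ico 2 n, a l * f l := by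
    intro f
    rw [range_eq_two_add hn, Finset.mul_sum]
    have : ∑ l ∈ Ico 2 n, c l * f l = ∑ l ∈ Ico 2 n, 2 * (a l * f l) := by
      refine Finset.sum_congr rfl fun l hl => ?_
      have := (Finset.mem_Ico.1 hl).1
      simp only [hc, if_neg (not_lt.2 this)]; ring
    rw [this]; simp [hc]; ring
  -- The sum is `2 * perpSq n a ≤ 128`; the norm bound `12` becomes the coefficient `24` of the
  -- error.
  have hc2 : ∑ l ∈ range n, c l ^ 2 ≤ 12 ^ 2 := by
    have h1 : ∑ l ∈ range n, c l ^ 2 = 2 * perpSq n a := by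
      rw [range_eq_two_add hn]
      have : ∑ l ∈ Ico 2 n, c l ^ 2 = ∑ l ∈ Ico 2 n, 4 * a l ^ 2 := by
        refine Finset.sum_congr rfl fun l hl => ?_
        have := (Finset.mem_Ico.1 hl).1
        simp only [hc, if_neg (not_lt.2 this)]; ring
      rw [this, ← Finset.mul_sum]; simp [hc, perpSq]; ring
    rw [h1]; linarith
  have hdr : ∑ l ∈ range n, c l * drift n a l = (a 0 + a 1) * sg (a 0) / 2 - dissip n a := by
    rw [sum_mul_drift (by omega)]
    congr 1
    refine Finset.sum_congr rfl fun k hk => ?_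
    have hk1 := (Finset.mem_Ico.1 hk).1
    have : ∑ l ∈ range (k + 1), c l = 2 * ∑ l ∈ range (k + 1), a l := by
      rw [range_eq_two_add (by omega), range_eq_two_add (by omega)]
      have : ∑ l ∈ Ico 2 (k + 1), c l = ∑ l ∈ Ico 2 (k + 1), 2 * a l := by
        refine Finset.sum_congr rfl fun l hl => ?_
        have := (Finset.mem_Ico.1 hl).1
        simp only [hc, if_neg (not_lt.2 this)]
      rw [this, ← Finset.mul_sum]; simp [hc]; ring
    rw [this]
    have hk0 : (0 : ℝ) < k + 1 := by positivity
    have h2 : ∑ l ∈ range (k + 1), a l = avgMargin a k * (k + 1) := by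
      unfold avgMargin; field_simp
    rw [h2]; field_simp
  have herr := (abs_le.1 (abs_sum_mul_sub_le hε (by norm_num) he hc2)).2
  rw [hdr, hcS h] at herr
  have hexp : perpSq n (fun l => a l + η * h l) = perpSq n a
      + 2 * η * ((a 0 + a 1) * (h 0 + h 1) + 2 * ∑ l ∈ Ico 2 n, a l * h l)
      + η ^ 2 * ((h 0 + h 1) ^ 2 + 2 * ∑ l ∈ Ico 2 n, h l ^ 2) := by
    unfold perpSq
    have : ∑ l ∈ Ico 2 n, (a l + η * h l) ^ 2 = ∑ l ∈ Ico 2 n, a l ^ 2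
        + 2 * η * ∑ l ∈ Ico 2 n, a l * h l + η ^ 2 * ∑ l ∈ Ico 2 n, h l ^ 2 := by
      rw [Finset.mul_sum, Finset.mul_sum, ← Finset.sum_add_distrib, ← Finset.sum_add_distrib]
      exact Finset.sum_congr rfl fun l _ => by ring
    rw [this]; ring
  rw [range_eq_two_add hn] at hG
  have h3 : (h 0 + h 1) ^ 2 + 2 * ∑ l ∈ Ico 2 n, h l ^ 2 ≤ 2 * G := by
    nlinarith [sq_nonneg (h 0 - h 1)]
  rw [hexp]
  have h4 := mul_le_mul_of_nonneg_left h3 (sq_nonneg η)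
  have h5 := mul_le_mul_of_nonneg_left herr hη
  linarith

lemma sum_Ico_one_div_sq_le {J : ℕ} (hJ : 1 ≤ J) (n : ℕ) :
    ∑ k ∈ Ico J n, 1 / ((k : ℝ) + 1) ^ 2 ≤ 1 / (J : ℝ) := by
  rcases le_or_gt n J with h | h
  · rw [Finset.Ico_eq_empty (by omega)]; simp
  have hJ' : (0 : ℝ) < J := by exact_mod_cast hJ
  suffices h : ∑ k ∈ Ico J n, 1 / ((k : ℝ) + 1) ^ 2 ≤ 1 / (J : ℝ) - 1 / (n : ℝ) by
    have : (0 : ℝ) ≤ 1 / (n : ℝ) := by positivity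
    linarith
  induction n, h.le using Nat.le_induction with
  | base => simp
  | succ m hm ih =>
    rw [Finset.sum_Ico_succ_top hm]
    rcases eq_or_lt_of_le hm with e | e
    · subst e
      simp only [Ico_self, sum_empty, zero_add]
      push_cast
      rw [div_sub_div _ _ (by positivity) (by positivity), div_le_div_iff₀ (by positivity) (by positivity)]
      nlinarith
    · have := ih e
      have hm' : (0 : ℝ) < m := by
        have : 0 < m := by omega
        exact_mod_cast this
      have : 1 / ((m : ℝ) + 1) ^ 2 ≤ 1 / m - 1 / (m + 1) := by
        rw [div_sub_div _ _ (by positivity) (by positivity), div_le_div_iff₀ (by positivity) (by positivity)]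
        nlinarith
      push_cast
      linarith

lemma sq_coord_le_perpSq {n l : ℕ} (a : ℕ → ℝ) (h2 : 2 ≤ l) (hl : l < n) :
    2 * a l ^ 2 ≤ perpSq n a := by
  have := Finset.single_le_sum (f := fun l => a l ^ 2) (fun _ _ => sq_nonneg _)
    (Finset.mem_Ico.2 ⟨h2, hl⟩)
  unfold perpSq
  nlinarith [sq_nonneg (a 0 + a 1)]

lemma tailSq_le_perpSq {n J : ℕ} (a : ℕ → ℝ) (h2 : 2 ≤ J) : tailSq n J a ≤ perpSq n a := by
  have : ∑ l ∈ Ico J n, a l ^ 2 ≤ ∑ l ∈ Ico 2 n, a l ^ 2 :=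
    Finset.sum_le_sum_of_subset_of_nonneg (Finset.Ico_subset_Ico_left h2)
      fun _ _ _ => sq_nonneg _
  unfold tailSq perpSq
  nlinarith [sq_nonneg (a 0 + a 1)]

/-- Only the head can make the tail grow. Sequences that end before `J` do not see the tail, and the
logistic force sits at coordinate `0`. A longer one contributes at most `y ^ 2 / 4` by
`neg_psi_mul_sub_le`, with `y = J * avgMargin a (J - 1) / (k + 1)`, and `∑ 1 / (k + 1) ^ 2 ≤ 1 / J`
removes one factor `J`. -/
lemma tailSq_step {n J : ℕ} (hJ : 2 ≤ J) (hJn : J ≤ n) {a h : ℕ → ℝ} {η ε G : ℝ}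
    (hη : 0 ≤ η) (hε : 0 ≤ ε)
    (he : ∑ l ∈ range n, (h l - drift n a l) ^ 2 ≤ ε ^ 2)
    (hG : ∑ l ∈ range n, h l ^ 2 ≤ G) (hq : perpSq n a ≤ 64) :
    tailSq n J (fun l => a l + η * h l) ≤ tailSq n J a
      + η * (J * avgMargin a (J - 1) ^ 2 / 2) + 24 * η * ε + 2 * η ^ 2 * G := by
  set c : ℕ → ℝ := fun l => if J ≤ l then 2 * a l else 0 with hc
  have hsplit : ∀ f : ℕ → ℝ, (∀ l < J, f l = 0) →
      ∑ l ∈ range n, f l = ∑ l ∈ Ico J n, f l := by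
    intro f hf
    rw [← Finset.sum_range_add_sum_Ico f hJn, Finset.sum_eq_zero, zero_add]
    exact fun l hl => hf l (Finset.mem_range.1 hl)
  have hcS : ∀ f : ℕ → ℝ, ∑ l ∈ range n, c l * f l = 2 * ∑ l ∈ Ico J n, a l * f l := by
    intro f
    rw [hsplit _ (fun l hl => by simp [hc, not_le.2 hl]), Finset.mul_sum]
    refine Finset.sum_congr rfl fun l hl => ?_
    simp only [hc, if_pos (Finset.mem_Ico.1 hl).1]; ring
  have hc2 : ∑ l ∈ range n, c l ^ 2 ≤ 12 ^ 2 := by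
    have h1 : ∑ l ∈ range n, c l ^ 2 = 2 * tailSq n J a := by
      rw [hsplit _ (fun l hl => by simp [hc, not_le.2 hl])]
      unfold tailSq
      rw [Finset.mul_sum, Finset.mul_sum]
      refine Finset.sum_congr rfl fun l hl => ?_
      simp only [hc, if_pos (Finset.mem_Ico.1 hl).1]; ring
    rw [h1]; linarith [tailSq_le_perpSq (n := n) a hJ]
  have hJ0 : (0 : ℝ) < J := by
    have : 0 < J := by omega
    exact_mod_cast this
  have hS : ∑ i ∈ range J, a i = J * avgMargin a (J - 1) := by
    unfold avgMargin
    rw [Nat.sub_add_cancel (by omega), Nat.cast_sub (by omega)]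
    push_cast
    rw [sub_add_cancel]
    field_simp
  have hdr : ∑ l ∈ range n, c l * drift n a l ≤ J * avgMargin a (J - 1) ^ 2 / 4 := by
    rw [sum_mul_drift (by omega)]
    have hc0 : c 0 = 0 := by simp [hc]; omega
    rw [hc0]
    have hterm : ∀ k ∈ Ico 1 n, -(psi (avgMargin a k) / (2 * (k + 1)) * ∑ l ∈ range (k + 1), c l)
        ≤ if J ≤ k then (J * avgMargin a (J - 1)) ^ 2 / 4 * (1 / ((k : ℝ) + 1) ^ 2) else 0 := by
      intro k hk
      have hk0 : (0 : ℝ) < k + 1 := by positivity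
      split_ifs with hJk
      · have h1 : ∑ l ∈ range (k + 1), c l
            = 2 * ((k + 1) * (avgMargin a k - (J * avgMargin a (J - 1)) / (k + 1))) := by
          have e1 : ∑ l ∈ range (k + 1), c l = 2 * ∑ l ∈ Ico J (k + 1), a l := by
            rw [← Finset.sum_range_add_sum_Ico c (by omega : J ≤ k + 1), Finset.sum_eq_zero,
              zero_add, Finset.mul_sum]
            · refine Finset.sum_congr rfl fun l hl => ?_
              simp only [hc, if_pos (Finset.mem_Ico.1 hl).1]
            · intro l hl
              simp [hc, Finset.mem_range.1 hl]
          have e2 := Finset.sum_range_add_sum_Ico a (by omega : J ≤ k + 1)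
          have e3 : ∑ l ∈ range (k + 1), a l = avgMargin a k * (k + 1) := by
            unfold avgMargin; field_simp
          rw [e1]
          rw [e3, hS] at e2
          field_simp
          linarith
        rw [h1]
        have h2 := neg_psi_mul_sub_le (avgMargin a k) ((J * avgMargin a (J - 1)) / (k + 1))
        have e : -(psi (avgMargin a k) / (2 * ((k : ℝ) + 1)) *
            (2 * ((k + 1) * (avgMargin a k - J * avgMargin a (J - 1) / (k + 1))))) =
            -(psi (avgMargin a k) * (avgMargin a k - J * avgMargin a (J - 1) / (k + 1))) := by
          field_simp
        rw [e]
        refine h2.trans (le_of_eq ?_)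
        field_simp
      · rw [Finset.sum_eq_zero]
        · simp
        · intro l hl
          have := Finset.mem_range.1 hl
          simp only [hc]
          rw [if_neg (by omega)]
    have h2 := Finset.sum_le_sum hterm
    rw [Finset.sum_neg_distrib, ← Finset.sum_filter] at h2
    have hf : (Ico 1 n).filter (fun k => J ≤ k) = Ico J n := by
      ext k; simp; omega
    rw [hf, ← Finset.mul_sum] at h2
    have h3 := mul_le_mul_of_nonneg_left (sum_Ico_one_div_sq_le (by omega : 1 ≤ J) n)
      (by positivity : 0 ≤ (J * avgMargin a (J - 1)) ^ 2 / 4)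
    have h4 : (J * avgMargin a (J - 1)) ^ 2 / 4 * (1 / (J : ℝ)) = J * avgMargin a (J - 1) ^ 2 / 4 := by
      field_simp
    linarith
  have herr := (abs_le.1 (abs_sum_mul_sub_le hε (by norm_num) he hc2)).2
  rw [hcS h] at herr
  have hexp : tailSq n J (fun l => a l + η * h l) = tailSq n J a
      + 2 * η * (2 * ∑ l ∈ Ico J n, a l * h l) + 2 * η ^ 2 * ∑ l ∈ Ico J n, h l ^ 2 := by
    unfold tailSq
    have : ∑ l ∈ Ico J n, (a l + η * h l) ^ 2 = ∑ l ∈ Ico J n, a l ^ 2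
        + 2 * η * ∑ l ∈ Ico J n, a l * h l + η ^ 2 * ∑ l ∈ Ico J n, h l ^ 2 := by
      rw [Finset.mul_sum, Finset.mul_sum, ← Finset.sum_add_distrib, ← Finset.sum_add_distrib]
      exact Finset.sum_congr rfl fun l _ => by ring
    rw [this]; ring
  have h3 : ∑ l ∈ Ico J n, h l ^ 2 ≤ G := by
    refine le_trans ?_ hG
    refine Finset.sum_le_sum_of_subset_of_nonneg ?_ fun _ _ _ => sq_nonneg _
    intro l hl
    exact Finset.mem_range.2 (Finset.mem_Ico.1 hl).2
  rw [hexp]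
  have h4 := mul_le_mul_of_nonneg_left h3 (by positivity : 0 ≤ 2 * η ^ 2)
  have h5 := mul_le_mul_of_nonneg_left (herr.trans (le_refl _)) hη
  have h6 := mul_le_mul_of_nonneg_left hdr hη
  nlinarith

/-- The partial sums of `1, -1, 0, ...` vanish for every length at least two, so only the sequences
of length one act in this direction. -/
lemma main_step {n : ℕ} (hn : 2 ≤ n) {a h : ℕ → ℝ} {ε : ℝ} (hε : 0 ≤ ε)
    (he : ∑ l ∈ range n, (h l - drift n a l) ^ 2 ≤ ε ^ 2) :
    |h 0 - h 1 - sg (a 0) / 2| ≤ 2 * ε := by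
  set c : ℕ → ℝ := fun l => if l = 0 then 1 else if l = 1 then -1 else 0 with hc
  have hz : ∀ m, ∀ l ∈ Ico 2 m, c l = 0 := by
    intro m l hl
    have := (Finset.mem_Ico.1 hl).1
    simp only [hc]
    rw [if_neg (by omega), if_neg (by omega)]
  have hcS : ∀ f : ℕ → ℝ, ∑ l ∈ range n, c l * f l = f 0 - f 1 := by
    intro f
    rw [range_eq_two_add hn, Finset.sum_eq_zero (s := Ico 2 n)]
    · simp [hc]; ring
    · intro l hl; rw [hz n l hl, zero_mul]
  have hc2 : ∑ l ∈ range n, c l ^ 2 ≤ 2 ^ 2 := by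
    rw [range_eq_two_add hn, Finset.sum_eq_zero (s := Ico 2 n)]
    · norm_num [hc]
    · intro l hl; rw [hz n l hl]; norm_num
  have hdr : ∑ l ∈ range n, c l * drift n a l = sg (a 0) / 2 := by
    rw [sum_mul_drift (by omega), Finset.sum_eq_zero]
    · simp [hc]
    · intro k hk
      have hk1 := (Finset.mem_Ico.1 hk).1
      rw [range_eq_two_add (by omega), Finset.sum_eq_zero (s := Ico 2 (k + 1)) (hz (k + 1))]
      simp [hc]
  have := abs_sum_mul_sub_le hε (by norm_num) he hc2
  rwa [hdr, hcS h] at this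
-- Lyapunov function and bootstrap for the perturbed flow.
/-- Gradient descent in the coordinates `a` whose steps `h` are small perturbations of `drift`
as long as the coordinates stay below `X`. -/
structure PerturbedFlow (n : ℕ) (a h : ℕ → ℕ → ℝ) (η ε G X : ℝ) (N : ℕ) : Prop where
  two_le : 2 ≤ n
  eta_pos : 0 < η
  eta_le : η ≤ 1
  eps_nonneg : 0 ≤ ε
  G_nonneg : 0 ≤ G
  init : a 0 = 0
  step : ∀ t, a (t + 1) = fun l => a t l + η * h t l
  bound : ∀ t < N, (∀ s ≤ t, ∀ l < n, |a s l| ≤ X) →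
    ∑ l ∈ range n, (h t l - drift n (a t) l) ^ 2 ≤ ε ^ 2 ∧ ∑ l ∈ range n, h t l ^ 2 ≤ G
  budget : N * (200 * (η * ε + η ^ 2 * G)) ≤ 1
  log_le : Real.log (1 + 30 * (η * N)) + 10 ≤ X

/-- The component of `a` along the separating direction. -/
def along (a : ℕ → ℝ) : ℝ := a 0 - a 1

/-- The Lyapunov function. -/
def lyap (n : ℕ) (a : ℕ → ℝ) : ℝ := perpSq n a + 48 * Real.exp (-(along a) / 2)

lemma exp_neg_half_le {x : ℝ} (h : |x| ≤ 1) : Real.exp (-x / 2) ≤ 1 - x / 2 + x ^ 2 := by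
  have h1 : |-x / 2| ≤ 1 := by
    rw [abs_div, abs_neg]; norm_num; linarith
  have h2 := (abs_le.1 (Real.abs_exp_sub_one_sub_id_le h1)).2
  nlinarith [sq_nonneg x]

lemma abs_avgMargin_le {n k : ℕ} {a : ℕ → ℝ} (hk1 : 1 ≤ k) (hk : k < n) (hq : perpSq n a ≤ 64) :
    |avgMargin a k| ≤ 8 := by
  have hk0 : (0 : ℝ) < k + 1 := by positivity
  have hD : |a 0 + a 1| ≤ 8 := by
    apply abs_le_of_sq_le_sq _ (by norm_num)
    have : 0 ≤ ∑ l ∈ Ico 2 n, a l ^ 2 := Finset.sum_nonneg fun _ _ => sq_nonneg _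
    unfold perpSq at hq; linarith
  unfold avgMargin
  rw [abs_div, abs_of_pos hk0, div_le_iff₀ hk0, range_eq_two_add (by omega)]
  refine (abs_add_le _ _).trans ?_
  have h1 : |∑ l ∈ Ico 2 (k + 1), a l| ≤ ((k : ℝ) - 1) * 8 := by
    refine (Finset.abs_sum_le_sum_abs _ _).trans ?_
    have : ∀ l ∈ Ico 2 (k + 1), |a l| ≤ 8 := by
      intro l hl
      obtain ⟨h2, h3⟩ := Finset.mem_Ico.1 hl
      apply abs_le_of_sq_le_sq _ (by norm_num)
      nlinarith [sq_coord_le_perpSq a h2 (by omega : l < n)]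
    refine (Finset.sum_le_sum this).trans ?_
    rw [Finset.sum_const, Nat.card_Ico, nsmul_eq_mul, show k + 1 - 2 = k - 1 by omega,
      Nat.cast_sub hk1]
    simp
  nlinarith

lemma sum_sq_avgMargin_le {n : ℕ} {a : ℕ → ℝ} (hq : perpSq n a ≤ 64) :
    ∑ k ∈ Ico 1 n, avgMargin a k ^ 2 ≤ 20 * dissip n a := by
  unfold dissip
  rw [Finset.mul_sum]
  refine Finset.sum_le_sum fun k hk => ?_
  obtain ⟨h1, h2⟩ := Finset.mem_Ico.1 hk
  have := mul_psi_lower (abs_avgMargin_le h1 h2 hq)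
  norm_num at this
  linarith

/-- The dissipation absorbs the growth of `perpSq` along the direction of the short sequences. -/
lemma drive_le {n : ℕ} (hn : 2 ≤ n) {a : ℕ → ℝ} (hq : perpSq n a ≤ 64) :
    (a 0 + a 1) * sg (a 0) ≤ dissip n a + 12 * (sg (a 0) * Real.exp (-(along a) / 2)) := by
  have hs := sg_pos (a 0)
  have he := Real.exp_pos (-(along a) / 2)
  rcases le_or_gt (a 0 + a 1) 0 with hD | hD
  · have := dissip_nonneg n a
    have h2 : (a 0 + a 1) * sg (a 0) ≤ 0 := mul_nonpos_of_nonpos_of_nonneg hD hs.le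
    have := mul_pos hs he
    linarith
  · have h1 : sg (a 0) ≤ Real.exp (-(along a) / 2) := by
      refine (sg_le_exp_neg _).trans (Real.exp_le_exp.2 ?_)
      unfold along; linarith
    have hm : avgMargin a 1 = (a 0 + a 1) / 2 := by
      unfold avgMargin; norm_num [Finset.sum_range_succ]
    have hb : |avgMargin a 1| ≤ 4 := by
      rw [hm, abs_of_pos (by linarith)]
      have : a 0 + a 1 ≤ 8 := by
        apply le_of_sq_le_sq _ (by norm_num)
        have : 0 ≤ ∑ l ∈ Ico 2 n, a l ^ 2 := Finset.sum_nonneg fun _ _ => sq_nonneg _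
        unfold perpSq at hq; linarith
      linarith
    have h2 := mul_psi_lower hb
    have h3 : avgMargin a 1 * psi (avgMargin a 1) ≤ dissip n a :=
      Finset.single_le_sum (f := fun k => avgMargin a k * psi (avgMargin a k))
        (fun _ _ => mul_psi_nonneg _) (Finset.mem_Ico.2 ⟨le_refl 1, by omega⟩)
    rw [hm] at h2
    rw [hm] at h3
    have h4 := mul_le_mul_of_nonneg_left h1 hs.le
    -- With `D = a 0 + a 1` and `s = sg (a 0)`, the length-two term gives `D ^ 2 / 48 ≤ dissip n a`,
    -- and `D * s ≤ D ^ 2 / 48 + 12 * s ^ 2`; one factor `s` is then replaced by the exponential.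
    nlinarith [sq_nonneg (a 0 + a 1 - 24 * sg (a 0))]

/-- The term `48 * exp (-(along a) / 2)` decreases at rate `12 * sg (a 0) * exp (-(along a) / 2)`,
which is exactly the remainder in `drive_le`. Of the two copies of `dissip` in `perpSq_step`, one
absorbs the drive and the other is left over. -/
lemma lyap_step {n : ℕ} (hn : 2 ≤ n) {a h : ℕ → ℝ} {η ε G : ℝ} (hη : 0 ≤ η) (hε : 0 ≤ ε)
    (he : ∑ l ∈ range n, (h l - drift n a l) ^ 2 ≤ ε ^ 2)
    (hG : ∑ l ∈ range n, h l ^ 2 ≤ G) (hq : perpSq n a ≤ 64) (hP : -1 ≤ along a)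
    (hηG : 2 * (η ^ 2 * G) ≤ 1) :
    lyap n (fun l => a l + η * h l) + η * dissip n a
      ≤ lyap n a + 200 * (η * ε + η ^ 2 * G) := by
  have h1 := perpSq_step hn hη hε he hG hq
  have h2 := abs_le.1 (main_step hn hε he)
  have h3 := mul_le_mul_of_nonneg_left (drive_le hn hq) hη
  have hx2 : (η * (h 0 - h 1)) ^ 2 ≤ 2 * (η ^ 2 * G) := by
    have : (h 0 - h 1) ^ 2 ≤ 2 * G := by
      rw [range_eq_two_add hn] at hG
      have : 0 ≤ ∑ l ∈ Ico 2 n, h l ^ 2 := Finset.sum_nonneg fun _ _ => sq_nonneg _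
      rw [range_eq_two_add hn, ] at he
      have h5 : h 0 ^ 2 + h 1 ^ 2 ≤ G := by linarith
      nlinarith [sq_nonneg (h 0 + h 1)]
    nlinarith [mul_le_mul_of_nonneg_left this (sq_nonneg η)]
  have hx : |η * (h 0 - h 1)| ≤ 1 := abs_le_of_sq_le_sq (by linarith) (by norm_num)
  have h4 : along (fun l => a l + η * h l) = along a + η * (h 0 - h 1) := by unfold along; ring
  have hE : Real.exp (-(along a) / 2) ≤ 2 := by
    have e1 : Real.exp (-(along a) / 2) ≤ Real.exp (1 / 2) := Real.exp_le_exp.2 (by linarith)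
    have e2 := Real.exp_one_lt_d9
    have e3 : Real.exp (1 / 2) ^ 2 = Real.exp 1 := by rw [← Real.exp_nat_mul]; norm_num
    nlinarith [Real.exp_pos (1 / 2)]
  have hEp := Real.exp_pos (-(along a) / 2)
  have h5 : Real.exp (-(along (fun l => a l + η * h l)) / 2)
      ≤ Real.exp (-(along a) / 2) - η * (sg (a 0) * Real.exp (-(along a) / 2)) / 4
        + 2 * (η * ε + 2 * (η ^ 2 * G)) := by
    rw [h4, show -(along a + η * (h 0 - h 1)) / 2 = -(along a) / 2 + -(η * (h 0 - h 1)) / 2 by ring,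
      Real.exp_add]
    have e1 := exp_neg_half_le hx
    have e2 := mul_le_mul_of_nonneg_left e1 hEp.le
    have e3 := mul_le_mul_of_nonneg_left h2.1 hη
    have e4 : 1 - η * (h 0 - h 1) / 2 + (η * (h 0 - h 1)) ^ 2
        ≤ 1 - η * sg (a 0) / 4 + (η * ε + 2 * (η ^ 2 * G)) := by linarith
    have e5 := mul_le_mul_of_nonneg_left e4 hEp.le
    have hG0 : 0 ≤ G := le_trans (Finset.sum_nonneg fun _ _ => sq_nonneg _) hG
    have e6 : 0 ≤ η * ε + 2 * (η ^ 2 * G) := by positivity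
    have e7 := mul_le_mul_of_nonneg_right hE e6
    linarith
  unfold lyap
  have hG0 : 0 ≤ G := le_trans (Finset.sum_nonneg fun _ _ => sq_nonneg _) hG
  have : 0 ≤ η * ε := by positivity
  have : 0 ≤ η ^ 2 * G := by positivity
  linarith

/-- What the bootstrap propagates. -/
structure FlowInv (n : ℕ) (a : ℕ → ℕ → ℝ) (η ε G : ℝ) (t : ℕ) : Prop where
  lyap_le : lyap n (a t) + η * ∑ s ∈ range t, dissip n (a s)
    ≤ 48 + t * (200 * (η * ε + η ^ 2 * G))
  along_ge : -(2 * ε * η * t) ≤ along (a t)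
  along_le : Real.exp ((along (a t) - 2 * ε * η * t) / 2) ≤ 1 + 30 * (η * t)
  le_along : η * t / 440 ≤ Real.exp ((along (a t) + 2 * ε * η * t) / 2)

lemma exp_four_bounds : Real.exp 4 ≤ 55 := by
  have e2 := Real.exp_one_lt_d9
  have e3 : Real.exp 4 = Real.exp 1 ^ 4 := by rw [← Real.exp_nat_mul]; norm_num
  rw [e3]
  calc Real.exp 1 ^ 4 ≤ 2.7182818286 ^ 4 := pow_le_pow_left₀ (Real.exp_pos 1).le e2.le 4
    _ ≤ 55 := by norm_num

namespace PerturbedFlow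

variable {n N : ℕ} {a h : ℕ → ℕ → ℝ} {η ε G X : ℝ}

lemma time_budget (F : PerturbedFlow n a h η ε G X N) {t : ℕ} (ht : t ≤ N) :
    t * (200 * (η * ε + η ^ 2 * G)) ≤ 1 := by
  have h1 : (t : ℝ) ≤ N := by exact_mod_cast ht
  have := F.eta_pos
  have := F.eps_nonneg
  have := F.G_nonneg
  exact (mul_le_mul_of_nonneg_right h1 (by positivity)).trans F.budget

lemma eps_budget (F : PerturbedFlow n a h η ε G X N) {t : ℕ} (ht : t ≤ N) :
    2 * ε * η * t ≤ 1 / 100 := by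
  have h1 := F.time_budget ht
  have := F.eta_pos
  have h2 := F.G_nonneg
  have : 0 ≤ t * (η ^ 2 * G) := by positivity
  linarith

lemma perpSq_le (F : PerturbedFlow n a h η ε G X N) {t : ℕ} (ht : t ≤ N)
    (I : FlowInv n a η ε G t) : perpSq n (a t) ≤ 64 := by
  have h1 := I.lyap_le
  have h2 := F.time_budget ht
  have h3 : 0 ≤ ∑ s ∈ range t, dissip n (a s) := Finset.sum_nonneg fun _ _ => dissip_nonneg _ _
  have h4 := mul_nonneg F.eta_pos.le h3
  have h5 := Real.exp_pos (-(along (a t)) / 2)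
  unfold lyap at h1
  linarith

lemma sum_dissip_le (F : PerturbedFlow n a h η ε G X N) {t : ℕ} (ht : t ≤ N)
    (I : FlowInv n a η ε G t) : η * ∑ s ∈ range t, dissip n (a s) ≤ 49 := by
  have h1 := I.lyap_le
  have h2 := F.time_budget ht
  have h4 := perpSq_nonneg n (a t)
  have h5 := Real.exp_pos (-(along (a t)) / 2)
  unfold lyap at h1
  linarith

lemma abs_diag_le (F : PerturbedFlow n a h η ε G X N) {t : ℕ} (ht : t ≤ N)
    (I : FlowInv n a η ε G t) : |a t 0 + a t 1| ≤ 8 := by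
  have hq := F.perpSq_le ht I
  apply abs_le_of_sq_le_sq _ (by norm_num)
  have : 0 ≤ ∑ l ∈ Ico 2 n, a t l ^ 2 := Finset.sum_nonneg fun _ _ => sq_nonneg _
  unfold perpSq at hq; linarith

/-- This closes the bootstrap: the logarithmic bound on `along` and the bound on `perpSq` recover
the a priori bound `X` with room to spare. -/
lemma coord_le (F : PerturbedFlow n a h η ε G X N) {t : ℕ} (ht : t ≤ N)
    (I : FlowInv n a η ε G t) {l : ℕ} (hl : l < n) : |a t l| ≤ X - 4 := by
  have hq := F.perpSq_le ht I
  have hη := F.eta_pos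
  have h1 : along (a t) ≤ 2 * Real.log (1 + 30 * (η * N)) + 1 := by
    have e1 := (Real.le_log_iff_exp_le (by positivity)).2 I.along_le
    have e2 := F.eps_budget ht
    have : (t : ℝ) ≤ N := by exact_mod_cast ht
    have e3 : Real.log (1 + 30 * (η * t)) ≤ Real.log (1 + 30 * (η * N)) :=
      Real.log_le_log (by positivity) (by gcongr)
    linarith
  have h2 : -1 ≤ along (a t) := by linarith [I.along_ge, F.eps_budget ht]
  have hX := F.log_le
  have hD := abs_le.1 (F.abs_diag_le ht I)
  have hlog : 0 ≤ Real.log (1 + 30 * (η * N)) := Real.log_nonneg (by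
    have : 0 ≤ 30 * (η * N) := by positivity
    linarith)
  unfold along at h1 h2
  rcases Nat.lt_or_ge l 2 with h | h
  · interval_cases l
    · rw [abs_le]; constructor <;> linarith
    · rw [abs_le]; constructor <;> linarith
  · have := sq_coord_le_perpSq (a t) h hl
    apply abs_le_of_sq_le_sq _ (by linarith)
    nlinarith

/-- For the last two invariants: `along` moves by about `η * sg (a 0) / 2`, and `a 0` is `along / 2`
up to `4`. Hence `exp (along / 2)` grows linearly in `η * t`, between two constant rates. The shifts
by `2 * ε * η * t` absorb the perturbation. -/
lemma inv_step (F : PerturbedFlow n a h η ε G X N) {t : ℕ} (ht : t < N)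
    (I : ∀ s ≤ t, FlowInv n a η ε G s) : FlowInv n a η ε G (t + 1) := by
  obtain ⟨he, hG⟩ := F.bound t ht fun s hs l hl => by
    linarith [F.coord_le (by omega) (I s hs) hl]
  have It := I t le_rfl
  have hη := F.eta_pos
  have hη1 := F.eta_le
  have hε := F.eps_nonneg
  have hq := F.perpSq_le ht.le It
  have hP : -1 ≤ along (a t) := by linarith [It.along_ge, F.eps_budget ht.le]
  have hD := abs_le.1 (F.abs_diag_le ht.le It)
  have hηG : 2 * (η ^ 2 * G) ≤ 1 := by
    have h1 := F.time_budget (show 1 ≤ N by omega)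
    have h2 := F.G_nonneg
    have : 0 ≤ η ^ 2 * G := by positivity
    have : 0 ≤ η * ε := by positivity
    push_cast at h1
    linarith
  have hL := lyap_step F.two_le hη.le hε he hG hq hP hηG
  rw [← F.step t] at hL
  have hM := abs_le.1 (main_step F.two_le hε he)
  have hA : along (a (t + 1)) = along (a t) + η * (h t 0 - h t 1) := by
    rw [F.step]; unfold along; ring
  have hs := sg_pos (a t 0)
  have hM1 := mul_le_mul_of_nonneg_left hM.1 hη.le
  have hM2 := mul_le_mul_of_nonneg_left hM.2 hη.le
  have hsη := mul_pos hη hs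
  have ha0 : a t 0 = (along (a t) + (a t 0 + a t 1)) / 2 := by unfold along; ring
  refine ⟨?_, ?_, ?_, ?_⟩
  · rw [Finset.sum_range_succ]
    have := It.lyap_le
    push_cast
    linarith
  · rw [hA]
    have := It.along_ge
    push_cast
    linarith
  · rw [hA]
    set Y := along (a t) - 2 * ε * η * t with hY
    have h1 : (along (a t) + η * (h t 0 - h t 1) - 2 * ε * η * ((t + 1 : ℕ) : ℝ)) / 2
        ≤ Y / 2 + η * sg (a t 0) / 4 := by
      push_cast
      linarith
    refine (Real.exp_le_exp.2 h1).trans ?_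
    rw [Real.exp_add]
    have h2 : Real.exp (η * sg (a t 0) / 4) ≤ 1 + η * sg (a t 0) / 2 := by
      have hz : η * sg (a t 0) ≤ 1 := by nlinarith [sg_le_one (a t 0)]
      have hz1 : |η * sg (a t 0) / 4| ≤ 1 := by
        rw [abs_of_pos (by positivity)]; linarith
      have := (abs_le.1 (Real.abs_exp_sub_one_sub_id_le hz1)).2
      nlinarith
    -- The bound `|a 0 + a 1| ≤ 8` costs the factor `exp 4 ≤ 55`.
    have h3 : sg (a t 0) ≤ Real.exp 4 * Real.exp (-(Y / 2)) := by
      rw [← Real.exp_add]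
      refine (sg_le_exp_neg _).trans (Real.exp_le_exp.2 ?_)
      have : 0 ≤ 2 * ε * η * t := by positivity
      linarith
    have h4 : Real.exp (Y / 2) * sg (a t 0) ≤ 55 := by
      have := mul_le_mul_of_nonneg_left h3 (Real.exp_pos (Y / 2)).le
      have e : Real.exp (Y / 2) * (Real.exp 4 * Real.exp (-(Y / 2))) = Real.exp 4 := by
        rw [mul_left_comm, ← Real.exp_add]; simp
      rw [e] at this
      exact this.trans exp_four_bounds
    have h5 := mul_le_mul_of_nonneg_left h2 (Real.exp_pos (Y / 2)).le
    have h6 := mul_le_mul_of_nonneg_left h4 hη.le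
    have := It.along_le
    push_cast
    nlinarith
  · rw [hA]
    set Y := along (a t) + 2 * ε * η * t with hY
    have hY0 : 0 ≤ Y := by linarith [It.along_ge]
    have h1 : Y / 2 + η * sg (a t 0) / 4
        ≤ (along (a t) + η * (h t 0 - h t 1) + 2 * ε * η * ((t + 1 : ℕ) : ℝ)) / 2 := by
      push_cast
      linarith
    refine le_trans ?_ (Real.exp_le_exp.2 h1)
    rw [Real.exp_add]
    have h2 := Real.add_one_le_exp (η * sg (a t 0) / 4)
    have hE : 1 ≤ Real.exp (Y / 2) := Real.one_le_exp (by linarith)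
    have h3 : Real.exp (a t 0) ≤ 55 * Real.exp (Y / 2) := by
      have : Real.exp (a t 0) ≤ Real.exp (4 + Y / 2) := by
        refine Real.exp_le_exp.2 ?_
        have : 0 ≤ 2 * ε * η * t := by positivity
        linarith
      rw [Real.exp_add] at this
      exact this.trans (mul_le_mul_of_nonneg_right exp_four_bounds (Real.exp_pos _).le)
    have h4 : 1 / 110 ≤ Real.exp (Y / 2) * sg (a t 0) := by
      unfold sg
      rw [mul_one_div, div_le_div_iff₀ (by norm_num) (by positivity)]
      linarith
    have h5 := mul_le_mul_of_nonneg_left h2 (Real.exp_pos (Y / 2)).le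
    have h6 := mul_le_mul_of_nonneg_left h4 hη.le
    have := It.le_along
    push_cast
    linarith

lemma inv (F : PerturbedFlow n a h η ε G X N) {t : ℕ} (ht : t ≤ N) : FlowInv n a η ε G t := by
  induction t using Nat.strong_induction_on with
  | _ t ih =>
    rcases t with _ | t
    · have h0 : along (a 0) = 0 := by simp [F.init, along]
      rw [F.init] at h0
      refine ⟨?_, ?_, ?_, ?_⟩ <;> simp [h0, lyap, perpSq, F.init]
    · exact F.inv_step (by omega) fun s hs => ih s (by omega) (by omega)

lemma bounds (F : PerturbedFlow n a h η ε G X N) {t : ℕ} (ht : t < N) :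
    ∑ l ∈ range n, (h t l - drift n (a t) l) ^ 2 ≤ ε ^ 2 ∧ ∑ l ∈ range n, h t l ^ 2 ≤ G :=
  F.bound t ht fun s hs l hl => by
    linarith [F.coord_le (by omega) (F.inv (by omega : s ≤ N)) hl]

lemma lyap_succ_le (F : PerturbedFlow n a h η ε G X N) {t : ℕ} (ht : t < N) :
    lyap n (a (t + 1)) ≤ lyap n (a t) + 200 * (η * ε + η ^ 2 * G) := by
  have I := F.inv ht.le
  have hη := F.eta_pos
  have hε := F.eps_nonneg
  have hηG : 2 * (η ^ 2 * G) ≤ 1 := by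
    have h1 := F.time_budget (show 1 ≤ N by omega)
    have h2 := F.G_nonneg
    have : 0 ≤ η ^ 2 * G := by positivity
    have : 0 ≤ η * ε := by positivity
    push_cast at h1
    linarith
  have hL := lyap_step F.two_le hη.le hε (F.bounds ht).1 (F.bounds ht).2 (F.perpSq_le ht.le I)
    (by linarith [I.along_ge, F.eps_budget ht.le]) hηG
  rw [← F.step t] at hL
  have := mul_nonneg hη.le (dissip_nonneg n (a t))
  linarith

lemma lyap_mono (F : PerturbedFlow n a h η ε G X N) {s t : ℕ} (hst : s ≤ t) (ht : t ≤ N) :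
    lyap n (a t) ≤ lyap n (a s) + (t - s : ℕ) * (200 * (η * ε + η ^ 2 * G)) := by
  induction t, hst using Nat.le_induction with
  | base => simp
  | succ t hst ih =>
    have h1 := ih (by omega)
    have h2 := F.lyap_succ_le (t := t) (by omega)
    rw [Nat.succ_sub hst]
    push_cast
    linarith

lemma exp_along_ge (F : PerturbedFlow n a h η ε G X N) {t : ℕ} (ht : t ≤ N) :
    η * t / 1000 ≤ Real.exp (along (a t) / 2) := by
  have I := F.inv ht
  have h1 := I.le_along
  have h2 := F.eps_budget ht
  have hη := F.eta_pos
  rw [show (along (a t) + 2 * ε * η * t) / 2 = along (a t) / 2 + 2 * ε * η * t / 2 by ring,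
    Real.exp_add] at h1
  have h3 : Real.exp (2 * ε * η * t / 2) ≤ 2 := by
    have e1 : Real.exp (2 * ε * η * t / 2) ≤ Real.exp (1 / 2) := Real.exp_le_exp.2 (by linarith)
    have e2 := Real.exp_one_lt_d9
    have e3 : Real.exp (1 / 2) ^ 2 = Real.exp 1 := by rw [← Real.exp_nat_mul]; norm_num
    nlinarith [Real.exp_pos (1 / 2)]
  have h4 := mul_le_mul_of_nonneg_left h3 (Real.exp_pos (along (a t) / 2)).le
  have : 0 ≤ η * t := by positivity
  linarith

lemma tailSq_le (F : PerturbedFlow n a h η ε G X N) {J : ℕ} (hJ : 2 ≤ J) (hJn : J ≤ n) {t : ℕ}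
    (ht : t ≤ N) :
    tailSq n J (a t) ≤ η * (J * ∑ s ∈ range t, avgMargin (a s) (J - 1) ^ 2) / 2
      + t * (200 * (η * ε + η ^ 2 * G)) := by
  induction t with
  | zero => simp [tailSq, F.init]
  | succ t ih =>
    have h1 := ih (by omega)
    have hb := F.bounds (t := t) (by omega)
    have h2 := tailSq_step hJ hJn F.eta_pos.le F.eps_nonneg hb.1 hb.2
      (F.perpSq_le (by omega) (F.inv (by omega : t ≤ N)))
    rw [← F.step t] at h2
    have hη := F.eta_pos
    have hε := F.eps_nonneg
    have hG := F.G_nonneg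
    have : 0 ≤ η * ε := by positivity
    have : 0 ≤ η ^ 2 * G := by positivity
    rw [Finset.sum_range_succ]
    push_cast
    nlinarith

lemma tailSq_anti {n J J' : ℕ} (h : J ≤ J') (a : ℕ → ℝ) : tailSq n J' a ≤ tailSq n J a := by
  unfold tailSq
  have : ∑ l ∈ Ico J' n, a l ^ 2 ≤ ∑ l ∈ Ico J n, a l ^ 2 :=
    Finset.sum_le_sum_of_subset_of_nonneg (Finset.Ico_subset_Ico_left h)
      fun _ _ _ => sq_nonneg _
  linarith

/-- The tail is small uniformly in time, by a logarithmic pigeonhole over its start. -/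
lemma tailSq_mul_harmonic_le (F : PerturbedFlow n a h η ε G X N) {J : ℕ}
    (hb : J * (N * (200 * (η * ε + η ^ 2 * G))) ≤ 1) {t : ℕ} (ht : t ≤ N) :
    tailSq n J (a t) * ∑ j ∈ Ico 2 J, 1 / (j : ℝ) ≤ 491 := by
  have hη := F.eta_pos
  have hε := F.eps_nonneg
  have hG := F.G_nonneg
  rcases le_or_gt n J with hJ | hJ
  · simp [tailSq, Finset.Ico_eq_empty (not_lt.2 hJ)]
  rw [Finset.mul_sum]
  set E := 200 * (η * ε + η ^ 2 * G) with hE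
  have hE0 : 0 ≤ E := by positivity
  have htN : (t : ℝ) ≤ N := by exact_mod_cast ht
  -- The tail from `J` is contained in the tail from every `j < J`, whose growth is at most `j`
  -- times a squared average. Dividing by `j` leaves unweighted squares of distinct averages, whose
  -- sum over `j` is controlled by one copy of the dissipation.
  have h1 : ∀ j ∈ Ico 2 J, tailSq n J (a t) * (1 / (j : ℝ)) ≤
      η * ∑ s ∈ range t, avgMargin (a s) (j - 1) ^ 2 / 2 + N * E := by
    intro j hj
    obtain ⟨h2, hjJ⟩ := Finset.mem_Ico.1 hj
    have hj0 : (1 : ℝ) ≤ j := by exact_mod_cast (by omega : 1 ≤ j)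
    have hj1 := (tailSq_anti hjJ.le (a t)).trans (F.tailSq_le h2 (by omega) ht)
    rw [mul_one_div, div_le_iff₀ (by linarith), ← Finset.sum_div]
    have : (t : ℝ) * E ≤ N * E * j := by
      have := mul_le_mul_of_nonneg_right htN hE0
      have h3 : 0 ≤ N * E := by positivity
      nlinarith
    linarith
  refine (Finset.sum_le_sum h1).trans ?_
  rw [Finset.sum_add_distrib, ← Finset.mul_sum, Finset.sum_comm]
  have h2 : ∀ s ∈ range t, ∑ j ∈ Ico 2 J, avgMargin (a s) (j - 1) ^ 2 / 2 ≤ 10 * dissip n (a s) := by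
    intro s hs
    have hs' : s ≤ N := by have := Finset.mem_range.1 hs; omega
    have h3 := sum_sq_avgMargin_le (F.perpSq_le hs' (F.inv hs'))
    have h4 : ∑ j ∈ Ico 2 J, avgMargin (a s) (j - 1) ^ 2 ≤ ∑ k ∈ Ico 1 n, avgMargin (a s) k ^ 2 := by
      rcases le_or_gt J 2 with h | h
      · rw [Finset.Ico_eq_empty (by omega)]
        exact Finset.sum_nonneg fun _ _ => sq_nonneg _
      have e : ∑ j ∈ Ico 2 J, avgMargin (a s) (j - 1) ^ 2
          = ∑ k ∈ Ico 1 (J - 1), avgMargin (a s) k ^ 2 := by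
        have := Finset.sum_Ico_add' (fun j => avgMargin (a s) (j - 1) ^ 2) 1 (J - 1) 1
        rw [Nat.sub_add_cancel (by omega)] at this
        rw [← this]
        rfl
      rw [e]
      exact Finset.sum_le_sum_of_subset_of_nonneg
        (Finset.Ico_subset_Ico_right (by omega)) fun _ _ _ => sq_nonneg _
    rw [← Finset.sum_div]
    linarith
  have h3 := mul_le_mul_of_nonneg_left (Finset.sum_le_sum h2) hη.le
  rw [← Finset.mul_sum] at h3
  -- The constant `491` is `10 * 49` from the dissipation plus `1` from the perturbations.
  have h4 := F.sum_dissip_le ht (F.inv ht)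
  have h5 : ∑ j ∈ Ico 2 J, (N : ℝ) * E ≤ 1 := by
    rw [Finset.sum_const, Nat.card_Ico, nsmul_eq_mul]
    refine le_trans (mul_le_mul_of_nonneg_right ?_ (by positivity)) hb
    exact_mod_cast Nat.sub_le J 2
  linarith

end PerturbedFlow
-- Convergence to the separating direction in absolute time.
lemma exists_harmonic_ge (B : ℝ) : ∃ J : ℕ, 2 ≤ J ∧ B ≤ ∑ j ∈ Ico 2 J, 1 / (j : ℝ) := by
  have h := (Filter.tendsto_atTop.1 Real.tendsto_sum_range_one_div_nat_succ_atTop (B + 1)).and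
    (Filter.eventually_ge_atTop 1)
  obtain ⟨m, hm, hm1⟩ := h.exists
  refine ⟨m + 1, by omega, ?_⟩
  have e : ∑ i ∈ range m, 1 / ((i : ℝ) + 1) = 1 + ∑ j ∈ Ico 2 (m + 1), 1 / (j : ℝ) := by
    rw [← Finset.sum_range_add_sum_Ico _ hm1]
    have := Finset.sum_Ico_add' (fun j : ℕ => 1 / (j : ℝ)) 1 m 1
    rw [← this]
    simp
  linarith

/-- Small dissipation makes all partial averages small. Coordinates below `J` are differences of
consecutive partial sums: undoing the averages costs `J ^ 2`, and adding up the coordinates costs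
another `J`. Coordinates from `J` on are left to `tailSq`. -/
lemma perpSq_le_of_dissip {n J : ℕ} {a : ℕ → ℝ} {v : ℝ} (hn : 2 ≤ n) (hJ : 2 ≤ J)
    (hq : perpSq n a ≤ 64) (hv : dissip n a ≤ v) :
    perpSq n a ≤ 240 * J ^ 3 * v + tailSq n J a := by
  have hv0 : 0 ≤ v := (dissip_nonneg n a).trans hv
  have hS : ∀ k ∈ Ico 1 n, (∑ i ∈ range (k + 1), a i) ^ 2 ≤ (k + 1) ^ 2 * (20 * v) := by
    intro k hk
    have h1 := Finset.single_le_sum (f := fun k => avgMargin a k ^ 2) (fun _ _ => sq_nonneg _) hk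
    have h2 := sum_sq_avgMargin_le hq
    have h3 : avgMargin a k ^ 2 ≤ 20 * v := by linarith
    have e : ∑ i ∈ range (k + 1), a i = (k + 1) * avgMargin a k := by
      unfold avgMargin; field_simp
    rw [e, mul_pow]
    exact mul_le_mul_of_nonneg_left h3 (sq_nonneg _)
  have hD : (a 0 + a 1) ^ 2 ≤ 80 * v := by
    have := hS 1 (Finset.mem_Ico.2 ⟨le_rfl, by omega⟩)
    norm_num [Finset.sum_range_succ] at this
    linarith
  have hJ1 : (2 : ℝ) ≤ J := by exact_mod_cast hJ
  have ha : ∀ l ∈ Ico 2 (min J n), a l ^ 2 ≤ 80 * J ^ 2 * v := by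
    intro l hl
    obtain ⟨h2, h3⟩ := Finset.mem_Ico.1 hl
    have hlJ : l + 1 ≤ J := by have := h3.trans_le (min_le_left _ _); omega
    have hln : l < n := h3.trans_le (min_le_right _ _)
    have h4 := hS l (Finset.mem_Ico.2 ⟨by omega, hln⟩)
    have h5 := hS (l - 1) (Finset.mem_Ico.2 ⟨by omega, by omega⟩)
    rw [Finset.sum_range_succ] at h4
    rw [Nat.sub_add_cancel (by omega : 1 ≤ l), Nat.cast_sub (by omega)] at h5
    push_cast at h5
    have h6 : ((l : ℝ) + 1) ^ 2 ≤ J ^ 2 := by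
      have : (l : ℝ) + 1 ≤ J := by exact_mod_cast hlJ
      exact pow_le_pow_left₀ (by positivity) this 2
    have h7 : ((l : ℝ) - 1 + 1) ^ 2 ≤ J ^ 2 := by
      refine le_trans ?_ h6
      have : (0 : ℝ) ≤ l := by positivity
      nlinarith
    have h8 := mul_le_mul_of_nonneg_right h6 (by positivity : 0 ≤ 20 * v)
    have h9 := mul_le_mul_of_nonneg_right h7 (by positivity : 0 ≤ 20 * v)
    set s := ∑ i ∈ range l, a i
    nlinarith [sq_nonneg (2 * s + a l)]
  have hsum : ∑ l ∈ Ico 2 n, a l ^ 2 ≤ J * (80 * J ^ 2 * v) + ∑ l ∈ Ico J n, a l ^ 2 := by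
    have h1 : ∑ l ∈ Ico 2 (min J n), a l ^ 2 ≤ J * (80 * J ^ 2 * v) := by
      refine (Finset.sum_le_sum ha).trans ?_
      rw [Finset.sum_const, Nat.card_Ico, nsmul_eq_mul]
      refine mul_le_mul_of_nonneg_right ?_ (by positivity)
      exact_mod_cast (Nat.sub_le _ _).trans (min_le_left _ _)
    rcases le_total J n with h | h
    · rw [min_eq_left h] at h1
      rw [← Finset.sum_Ico_consecutive _ hJ h]
      linarith
    · rw [min_eq_right h] at h1
      have : 0 ≤ ∑ l ∈ Ico J n, a l ^ 2 := Finset.sum_nonneg fun _ _ => sq_nonneg _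
      linarith
  unfold perpSq tailSq
  have : (8 : ℝ) ≤ J ^ 3 := by
    calc (8 : ℝ) = 2 ^ 3 := by norm_num
      _ ≤ J ^ 3 := pow_le_pow_left₀ (by norm_num) hJ1 3
  nlinarith [mul_le_mul_of_nonneg_right this hv0]

/-- After an absolute rescaled time `K` the flow is within distance `1 / 4` of the line through
the separating direction and moves along it at least logarithmically, if the total perturbation
is below an absolute constant `δ`. -/
theorem exists_flow_constants : ∃ K δ : ℝ, Real.exp 1 ≤ K ∧ 0 < δ ∧
    ∀ (n N : ℕ) (a h : ℕ → ℕ → ℝ) (η ε G X : ℝ), PerturbedFlow n a h η ε G X N →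
      N * (200 * (η * ε + η ^ 2 * G)) ≤ δ → ∀ t ≤ N, K ≤ η * t →
        perpSq n (a t) ≤ 1 / 16 ∧ Real.log (η * t) ≤ along (a t) := by
  -- The tail is then at most `491 / 49100 = 1 / 100`.
  obtain ⟨J, hJ2, hJ⟩ := exists_harmonic_ge 49100
  have hJ0 : (2 : ℝ) ≤ J := by exact_mod_cast hJ2
  -- Chosen so that `240 * J ^ 3 * v = 1 / 100`.
  set v : ℝ := 1 / (24000 * J ^ 3) with hv
  have hv0 : 0 < v := by positivity
  -- Rescaled time `10 ^ 7` makes the exponential part of `lyap` negligible, `50 / v` exhausts the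
  -- dissipation budget `49`, and the rest covers rounding and `exp 1 ≤ K`.
  refine ⟨10 ^ 7 + 50 / v + 3, 1 / (100 * J), ?_, by positivity, ?_⟩
  · have := Real.exp_one_lt_d9
    have : 0 < 50 / v := by positivity
    linarith
  intro n N a h η ε G X F hδ t ht hKt
  have hη := F.eta_pos
  have hη1 := F.eta_le
  have hE0 : 0 ≤ 200 * (η * ε + η ^ 2 * G) := by
    have := F.eps_nonneg
    have := F.G_nonneg
    positivity
  have hδ1 : J * (N * (200 * (η * ε + η ^ 2 * G))) ≤ 1 / 100 := by
    have := mul_le_mul_of_nonneg_left hδ (by positivity : (0 : ℝ) ≤ J)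
    refine this.trans (le_of_eq ?_)
    field_simp
  have hδ2 : N * (200 * (η * ε + η ^ 2 * G)) ≤ 1 / 100 := by
    have : 0 ≤ N * (200 * (η * ε + η ^ 2 * G)) := by positivity
    nlinarith
  have hexp : ∀ s ≤ N, (10 : ℝ) ^ 7 ≤ η * s → Real.exp (-(along (a s)) / 2) ≤ 1 / 10000 := by
    intro s hs hs7
    have h1 := F.exp_along_ge hs
    have h2 : (10000 : ℝ) ≤ Real.exp (along (a s) / 2) := by linarith
    rw [neg_div, Real.exp_neg, ← one_div]
    exact one_div_le_one_div_of_le (by norm_num) h2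
  constructor
  · obtain ⟨s, hs1, hst, hsv⟩ : ∃ s : ℕ, (10 : ℝ) ^ 7 ≤ η * s ∧ s ≤ t ∧ dissip n (a s) ≤ v := by
      by_contra! hcon
      set t₁ := ⌈(10 : ℝ) ^ 7 / η⌉₊ with ht1
      have h1 : (10 : ℝ) ^ 7 / η ≤ t₁ := Nat.le_ceil _
      have h2 : (t₁ : ℝ) < 10 ^ 7 / η + 1 := Nat.ceil_lt_add_one (by positivity)
      have h1' : (10 : ℝ) ^ 7 ≤ η * t₁ := by
        rw [div_le_iff₀ hη] at h1; linarith
      have h2' : η * t₁ < 10 ^ 7 + η := by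
        have := mul_lt_mul_of_pos_left h2 hη
        have e : η * (10 ^ 7 / η + 1) = 10 ^ 7 + η := by field_simp
        linarith
      have h50 : 0 < 50 / v := by positivity
      have htt : t₁ ≤ t := by
        have : (t₁ : ℝ) < t := by
          by_contra! hc
          have := mul_le_mul_of_nonneg_left hc hη.le
          linarith
        exact_mod_cast this.le
      have h3 : ∑ s ∈ Ico t₁ t, v ≤ ∑ s ∈ range t, dissip n (a s) := by
        refine (Finset.sum_le_sum (g := fun s => dissip n (a s)) fun s hs => ?_).trans ?_
        · obtain ⟨h4, h5⟩ := Finset.mem_Ico.1 hs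
          refine (hcon s (h1'.trans ?_) h5.le).le
          have : (t₁ : ℝ) ≤ s := by exact_mod_cast h4
          exact mul_le_mul_of_nonneg_left this hη.le
        · refine Finset.sum_le_sum_of_subset_of_nonneg ?_ fun _ _ _ => dissip_nonneg _ _
          intro s hs
          exact Finset.mem_range.2 (Finset.mem_Ico.1 hs).2
      rw [Finset.sum_const, Nat.card_Ico, nsmul_eq_mul, Nat.cast_sub htt] at h3
      have h4 := mul_le_mul_of_nonneg_left h3 hη.le
      have h5 := F.sum_dissip_le ht (F.inv ht)
      have h6 : 50 / v ≤ η * (t - t₁) := by linarith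
      rw [div_le_iff₀ hv0] at h6
      linarith
    have hsN := hst.trans ht
    have h1 := perpSq_le_of_dissip F.two_le hJ2 (F.perpSq_le hsN (F.inv hsN)) hsv
    have h2 := F.tailSq_mul_harmonic_le (hδ1.trans (by norm_num)) hsN
    have hT0 : 0 ≤ tailSq n J (a s) := by unfold tailSq; positivity
    have h3 := mul_le_mul_of_nonneg_left hJ hT0
    have h4 : 240 * (J : ℝ) ^ 3 * v = 1 / 100 := by
      rw [hv]; field_simp; norm_num
    have h5 := F.lyap_mono hst ht
    have h6 : ((t - s : ℕ) : ℝ) * (200 * (η * ε + η ^ 2 * G)) ≤ 1 / 100 := by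
      refine le_trans (mul_le_mul_of_nonneg_right ?_ hE0) hδ2
      exact_mod_cast (Nat.sub_le t s).trans ht
    have h7 := hexp s hsN hs1
    have h8 := Real.exp_pos (-(along (a t)) / 2)
    -- At time `s`, `lyap` is at most `1 / 100 + 1 / 100 + 48 / 10000`; until `t` it gains at most
    -- `1 / 100`, which stays below `1 / 16`.
    unfold lyap at h5
    linarith
  · have h50 : 0 < 50 / v := by positivity
    have h7 : (10 : ℝ) ^ 7 ≤ η * t := by linarith
    have h1 := F.exp_along_ge ht
    have h0 : 0 < η * t := lt_of_lt_of_le (by norm_num) h7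
    -- The square of `η * t / 1000` exceeds `η * t` because `η * t ≥ 10 ^ 7`.
    have h2 : η * t ≤ Real.exp (along (a t)) := by
      have e : Real.exp (along (a t)) = Real.exp (along (a t) / 2) ^ 2 := by
        rw [← Real.exp_nat_mul]; congr 1; push_cast; ring
      rw [e]
      have := pow_le_pow_left₀ (by positivity) h1 2
      nlinarith
    have := Real.log_le_log h0 h2
    rwa [Real.log_exp] at this
-- Embeddings, rank-one matrices and softmax.
lemma embed_eq_single {d l : ℕ} (h : 2 * l + 1 < d) (b : Bool) :
    embed d l b = EuclideanSpace.single (⟨2 * l + (if b then 1 else 0), by split_ifs <;> omega⟩ : Fin d) 1 := by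
  ext i
  simp [embed, Fin.ext_iff]

lemma inner_embed {d n : ℕ} (hd : 2 * n ≤ d) {l k : ℕ} (hl : l < n) (hk : k < n) (b c : Bool) :
    inner ℝ (embed d l b) (embed d k c) = if l = k ∧ b = c then (1 : ℝ) else 0 := by
  rw [embed_eq_single (by omega), embed_eq_single (by omega)]
  rw [EuclideanSpace.inner_single_left]
  rcases eq_or_ne l k with h | h
  · subst h
    cases b <;> cases c <;> simp
  · have : ¬ (2 * l + (if b then 1 else 0) = 2 * k + (if c then 1 else 0)) := by
      split_ifs <;> omega
    simp [h, this]

/-- The rank-one matrix `x yᵀ`. -/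
def outer {d : ℕ} (x y : Vec d) : Mat d := WithLp.toLp 2 fun p => x p.1 * y p.2

lemma form_eq_inner {d : ℕ} (W : Mat d) (x y : Vec d) : form W x y = inner ℝ (outer x y) W := by
  simp only [form, outer, PiLp.inner_apply, Fintype.sum_prod_type]
  refine Finset.sum_congr rfl fun i _ => Finset.sum_congr rfl fun j _ => ?_
  simp; ring

lemma inner_outer {d : ℕ} (x y z w : Vec d) :
    inner ℝ (outer x y) (outer z w) = inner ℝ x z * inner ℝ y w := by
  simp only [outer, PiLp.inner_apply, Fintype.sum_prod_type, Finset.sum_mul_sum]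
  refine Finset.sum_congr rfl fun i _ => Finset.sum_congr rfl fun j _ => ?_
  simp; ring

lemma norm_outer {d : ℕ} (x y : Vec d) : ‖outer x y‖ = ‖x‖ * ‖y‖ := by
  have h : ‖outer x y‖ ^ 2 = (‖x‖ * ‖y‖) ^ 2 := by
    rw [← real_inner_self_eq_norm_sq, inner_outer, real_inner_self_eq_norm_sq,
      real_inner_self_eq_norm_sq, mul_pow]
  exact (sq_eq_sq₀ (norm_nonneg _) (by positivity)).1 h

lemma norm_embed {d n : ℕ} (hd : 2 * n ≤ d) {l : ℕ} (hl : l < n) (b : Bool) :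
    ‖embed d l b‖ = 1 := by
  rw [embed_eq_single (by omega)]; simp

lemma abs_form_le {d n : ℕ} (hd : 2 * n ≤ d) (W : Mat d) {l k : ℕ} (hl : l < n) (hk : k < n)
    (b c : Bool) : |form W (embed d l b) (embed d k c)| ≤ ‖W‖ := by
  rw [form_eq_inner]
  refine (abs_real_inner_le_norm _ _).trans ?_
  rw [norm_outer, norm_embed hd hl, norm_embed hd hk]
  simp

lemma softmax_pos {m : ℕ} (v : Fin (m + 1) → ℝ) (i : Fin (m + 1)) : 0 < softmax v i := by
  unfold softmax
  have : 0 < ∑ j, Real.exp (v j) := Finset.sum_pos (fun _ _ => Real.exp_pos _) ⟨i, mem_univ i⟩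
  exact div_pos (Real.exp_pos _) this

lemma sum_softmax {m : ℕ} (v : Fin (m + 1) → ℝ) : ∑ i, softmax v i = 1 := by
  unfold softmax
  rw [← Finset.sum_div]
  exact div_self (Finset.sum_pos (fun _ _ => Real.exp_pos _) ⟨0, mem_univ _⟩).ne'

/-- The reciprocal of a softmax weight is `∑ exp (v j - v i)`, and each summand is `1 + O(ω)`. The
error is thus relative, which is where the factor `1 / (m + 1)` comes from. -/
lemma abs_softmax_sub_le {m : ℕ} {v : Fin (m + 1) → ℝ} {ω : ℝ} (hω : ω ≤ 1 / 4)
    (hv : ∀ i, |v i| ≤ ω) (i : Fin (m + 1)) :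
    |softmax v i - 1 / (m + 1)| ≤ 4 * ω / (m + 1) := by
  have hω0 : 0 ≤ ω := (abs_nonneg _).trans (hv i)
  have hm : (0 : ℝ) < m + 1 := by positivity
  set Z := ∑ j, Real.exp (v j) with hZ
  have hZ0 : 0 < Z := Finset.sum_pos (fun _ _ => Real.exp_pos _) ⟨i, mem_univ i⟩
  have h1 : (∑ j, Real.exp (v j - v i)) = Z / Real.exp (v i) := by
    rw [hZ, Finset.sum_div]
    exact Finset.sum_congr rfl fun j _ => Real.exp_sub _ _
  have hb : ∀ j, |v j - v i| ≤ 2 * ω := fun j => by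
    have h1 := abs_le.1 (hv j)
    have h2 := abs_le.1 (hv i)
    rw [abs_le]; constructor <;> linarith
  have hlow : (m + 1) * (1 - 2 * ω) ≤ Z / Real.exp (v i) := by
    rw [← h1]
    calc ((m : ℝ) + 1) * (1 - 2 * ω) = ∑ _j : Fin (m + 1), (1 - 2 * ω) := by simp; ring
      _ ≤ _ := Finset.sum_le_sum fun j _ => by
        have := Real.add_one_le_exp (v j - v i)
        linarith [(abs_le.1 (hb j)).1]
  have hup : Z / Real.exp (v i) ≤ (m + 1) * (1 + 4 * ω) := by
    rw [← h1]
    calc _ ≤ ∑ _j : Fin (m + 1), (1 + 4 * ω) := Finset.sum_le_sum fun j _ => by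
          have h2 : |v j - v i| ≤ 1 := (hb j).trans (by linarith)
          have h3 := (abs_le.1 (Real.abs_exp_sub_one_sub_id_le h2)).2
          have h4 : (v j - v i) ^ 2 ≤ (2 * ω) ^ 2 := sq_le_sq' (by linarith [(abs_le.1 (hb j)).1])
            (abs_le.1 (hb j)).2
          nlinarith [(abs_le.1 (hb j)).2]
      _ = _ := by simp; ring
  have hs : softmax v i = 1 / (Z / Real.exp (v i)) := by
    unfold softmax; rw [one_div_div]
  set R := Z / Real.exp (v i) with hR
  have hR0 : 0 < R := by positivity
  rw [hs, div_sub_div _ _ hR0.ne' hm.ne', abs_div, abs_of_pos (mul_pos hR0 hm),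
    div_le_div_iff₀ (by positivity) hm]
  have : |1 * ((m : ℝ) + 1) - R * 1| ≤ 4 * ω * R := by
    rw [abs_le]
    have h5 : (m : ℝ) + 1 ≤ 2 * R := by nlinarith
    constructor
    · nlinarith
    · nlinarith
  nlinarith

/-! ### Labels, averages over sequences and their symmetries. -/

/-- Each counted pair is a change of letter, so the parity of their number tells whether the last
letter equals the first. -/
lemma label_eq {k : ℕ} (X : Fin (k + 1) → Bool) :
    label X = if X 0 = X (Fin.last k) then 1 else -1 := by
  have hcount : pairCount X = ∑ i : Fin k, if X i.castSucc ≠ X i.succ then 1 else 0 := by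
    unfold pairCount
    rw [Finset.card_filter, Fintype.sum_prod_type, Fin.sum_univ_castSucc]
    have h1 : ∑ y : Fin (k + 1), (if ((Fin.last k : Fin (k + 1)) : ℕ) + 1 = y ∧
        (X (Fin.last k) = false ∧ X y = true ∨ X (Fin.last k) = true ∧ X y = false)
        then 1 else 0) = 0 := by
      refine Finset.sum_eq_zero fun y _ => ?_
      rw [if_neg]
      rintro ⟨h, -⟩
      have := y.2
      simp at h; omega
    simp only at h1 ⊢
    rw [h1, add_zero]
    refine Finset.sum_congr rfl fun i _ => ?_
    rw [Finset.sum_eq_single i.succ]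
    · cases X i.castSucc <;> cases X i.succ <;> simp
    · intro y _ hy
      rw [if_neg]
      rintro ⟨h, -⟩
      apply hy
      ext
      simp at h ⊢; omega
    · simp
  have hpar : ∀ (k : ℕ) (X : Fin (k + 1) → Bool),
      Even (∑ i : Fin k, if X i.castSucc ≠ X i.succ then 1 else 0) ↔ X 0 = X (Fin.last k) := by
    intro k
    induction k with
    | zero => intro X; simp
    | succ k ih =>
      intro X
      rw [Fin.sum_univ_castSucc]
      have := ih (fun i => X i.castSucc)
      simp only [Fin.succ_castSucc, Fin.succ_last, Fin.castSucc_zero] at this ⊢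
      rw [Nat.even_add, this]
      have key : ∀ p q r : Bool, ((p = q) ↔ Even (if q ≠ r then 1 else 0)) ↔ p = r := by
        intro p q r
        cases p <;> cases q <;> cases r <;> simp
      exact key _ _ _
  unfold label
  simp only [hcount, hpar]

lemma label_sq {k : ℕ} (X : Fin (k + 1) → Bool) : label X = 1 ∨ label X = -1 := by
  unfold label; split_ifs <;> simp

lemma abs_label {k : ℕ} (X : Fin (k + 1) → Bool) : |label X| = 1 := by
  rcases label_sq X with h | h <;> simp [h]

/-- The average over all sequences of a given length. -/
def avg {k : ℕ} (F : (Fin (k + 1) → Bool) → ℝ) : ℝ :=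
  1 / (Fintype.card (Fin (k + 1) → Bool) : ℝ) * ∑ X, F X

lemma avg_sub {k : ℕ} (F G : (Fin (k + 1) → Bool) → ℝ) :
    avg (fun X => F X - G X) = avg F - avg G := by
  unfold avg; rw [Finset.sum_sub_distrib]; ring

lemma avg_const_mul {k : ℕ} (F : (Fin (k + 1) → Bool) → ℝ) (c : ℝ) :
    avg (fun X => c * F X) = c * avg F := by
  unfold avg; rw [← Finset.mul_sum]; ring

lemma avg_mono {k : ℕ} {F G : (Fin (k + 1) → Bool) → ℝ} (h : ∀ X, F X ≤ G X) :
    avg F ≤ avg G := by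
  unfold avg
  exact mul_le_mul_of_nonneg_left (Finset.sum_le_sum fun X _ => h X) (by positivity)

lemma avg_const {k : ℕ} (c : ℝ) : avg (fun _ : Fin (k + 1) → Bool => c) = c := by
  unfold avg
  simp only [Finset.sum_const, card_univ, nsmul_eq_mul]
  field_simp

lemma abs_avg_le {k : ℕ} {F : (Fin (k + 1) → Bool) → ℝ} {c : ℝ} (h : ∀ X, |F X| ≤ c) :
    |avg F| ≤ c := by
  rw [abs_le]
  constructor
  · rw [← avg_const (k := k) (-c)]; exact avg_mono fun X => (abs_le.1 (h X)).1
  · rw [← avg_const (k := k) c]; exact avg_mono fun X => (abs_le.1 (h X)).2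

/-- Flip the token at one position. -/
def flip {k : ℕ} (i : Fin (k + 1)) (X : Fin (k + 1) → Bool) : Fin (k + 1) → Bool :=
  Function.update X i (!X i)

lemma flip_flip {k : ℕ} (i : Fin (k + 1)) (X : Fin (k + 1) → Bool) : flip i (flip i X) = X := by
  unfold flip; simp

lemma avg_flip {k : ℕ} (i : Fin (k + 1)) (F : (Fin (k + 1) → Bool) → ℝ) :
    avg (fun X => F (flip i X)) = avg F := by
  unfold avg
  congr 1
  exact Fintype.sum_bijective (flip i)
    (Function.Involutive.bijective (flip_flip i)) _ _ fun _ => rfl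

/-- For length at least two the first position is not the last. This involution exchanges the two
label classes and drives every cancellation below. -/
lemma label_flip_zero {k : ℕ} (hk : 1 ≤ k) (X : Fin (k + 1) → Bool) :
    label (flip 0 X) = -label X := by
  rw [label_eq, label_eq]
  have h : (Fin.last k) ≠ 0 := by
    intro h; have := congrArg Fin.val h; simp at this; omega
  unfold flip
  rw [Function.update_self, Function.update_of_ne h]
  cases X 0 <;> cases X (Fin.last k) <;> simp

lemma avg_label {k : ℕ} (hk : 1 ≤ k) (F : ℝ → ℝ) :
    avg (fun X : Fin (k + 1) → Bool => F (label X)) = (F 1 + F (-1)) / 2 := by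
  have h1 := avg_flip (0 : Fin (k + 1)) fun X => F (label X)
  simp only [label_flip_zero hk] at h1
  have h2 : avg (fun X : Fin (k + 1) → Bool => F (label X) - -F (-label X))
      = avg (fun X : Fin (k + 1) → Bool => F 1 + F (-1)) := by
    congr 1; funext X
    rcases label_sq X with h | h <;> rw [h] <;> ring_nf
  rw [avg_const, avg_sub] at h2
  have h3 := avg_const_mul (fun X : Fin (k + 1) → Bool => F (-label X)) (-1)
  simp only [neg_mul, one_mul] at h3
  linarith

/-- Exchange the two letters in a whole sequence. -/
def swap {k : ℕ} (X : Fin (k + 1) → Bool) : Fin (k + 1) → Bool := fun i => !X i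

lemma swap_swap {k : ℕ} (X : Fin (k + 1) → Bool) : swap (swap X) = X := by
  unfold swap; simp

lemma sum_swap {k : ℕ} {M : Type*} [AddCommMonoid M] (F : (Fin (k + 1) → Bool) → M) :
    ∑ X, F (swap X) = ∑ X, F X :=
  Fintype.sum_bijective swap (Function.Involutive.bijective swap_swap) _ _ fun _ => rfl

lemma label_swap {k : ℕ} (X : Fin (k + 1) → Bool) : label (swap X) = label X := by
  rw [label_eq, label_eq]
  unfold swap
  cases X 0 <;> cases X (Fin.last k) <;> simp

/-- Invariance of an attention matrix under exchanging the two letters. -/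
def SwapInv {d : ℕ} (n : ℕ) (W : Mat d) : Prop :=
  ∀ l < n, ∀ k < n, ∀ b c, form W (embed d l (!b)) (embed d k (!c)) = form W (embed d l b) (embed d k c)

lemma SwapInv.attnWeight_swap {d n : ℕ} {W : Mat d} (h : SwapInv n W) (lam : ℝ) {k : ℕ} (hk : k < n)
    (X : Fin (k + 1) → Bool) : attnWeight lam W (swap X) = attnWeight lam W X := by
  unfold attnWeight
  congr 1
  funext l
  rw [show swap X l = !X l from rfl, show swap X (Fin.last k) = !X (Fin.last k) from rfl,
    h l (by omega) k hk]

/-! ### Attention close to uniform and symmetric linear layers. -/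

section attn

variable {d k : ℕ} (lam : ℝ) (W : Mat d) (X : Fin (k + 1) → Bool)

lemma attnWeight_pos (l : Fin (k + 1)) : 0 < attnWeight lam W X l := softmax_pos _ _

lemma sum_attnWeight : ∑ l, attnWeight lam W X l = 1 := sum_softmax _

lemma attnWeight_le_one (l : Fin (k + 1)) : attnWeight lam W X l ≤ 1 := by
  rw [← sum_attnWeight lam W X]
  exact Finset.single_le_sum (f := attnWeight lam W X)
    (fun i _ => (attnWeight_pos lam W X i).le) (mem_univ l)

/-- The score of a sequence under the symmetric linear layer with coordinates `a`. -/
def score (a : ℕ → ℝ) : ℝ := ∑ l : Fin (k + 1), attnWeight lam W X l * a l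

/-- The attention weights, extended by zero. -/
def wt (l : ℕ) : ℝ := if h : l < k + 1 then attnWeight lam W X ⟨l, h⟩ else 0

lemma wt_coe (l : Fin (k + 1)) : wt lam W X l = attnWeight lam W X l := by
  unfold wt; rw [dif_pos l.2]

end attn

lemma abs_attnWeight_sub_le {d n k : ℕ} (hd : 2 * n ≤ d) (hk : k < n) {lam ω : ℝ} (hl : 0 < lam)
    {W : Mat d} (hW : ‖W‖ ≤ ω * lam) (hω : ω ≤ 1 / 4) (X : Fin (k + 1) → Bool) (l : Fin (k + 1)) :
    |attnWeight lam W X l - 1 / (k + 1)| ≤ 4 * ω / (k + 1) := by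
  refine abs_softmax_sub_le hω (fun i => ?_) l
  rw [abs_div, abs_of_pos hl, div_le_iff₀ hl]
  exact (abs_form_le hd W (by omega) hk _ _).trans hW

lemma abs_score_le {d k : ℕ} (lam : ℝ) (W : Mat d) (X : Fin (k + 1) → Bool) {a : ℕ → ℝ} {α : ℝ}
    (ha : ∀ l < k + 1, |a l| ≤ α) : |score lam W X a| ≤ α := by
  unfold score
  refine (Finset.abs_sum_le_sum_abs _ _).trans ?_
  calc _ ≤ ∑ l, attnWeight lam W X l * α := Finset.sum_le_sum fun l _ => by
        rw [abs_mul, abs_of_pos (attnWeight_pos lam W X l)]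
        exact mul_le_mul_of_nonneg_left (ha l l.2) (attnWeight_pos lam W X l).le
    _ = α := by rw [← Finset.sum_mul, sum_attnWeight, one_mul]

lemma abs_score_sub_le {d n k : ℕ} (hd : 2 * n ≤ d) (hk : k < n) {lam ω : ℝ} (hl : 0 < lam)
    {W : Mat d} (hW : ‖W‖ ≤ ω * lam) (hω : ω ≤ 1 / 4) (X : Fin (k + 1) → Bool) {a : ℕ → ℝ} {α : ℝ}
    (ha : ∀ l < k + 1, |a l| ≤ α) : |score lam W X a - avgMargin a k| ≤ 4 * ω * α := by
  have h1 : avgMargin a k = ∑ l : Fin (k + 1), 1 / ((k : ℝ) + 1) * a l := by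
    unfold avgMargin
    rw [← Finset.mul_sum, Finset.sum_range]; ring
  unfold score
  rw [h1, ← Finset.sum_sub_distrib]
  refine (Finset.abs_sum_le_sum_abs _ _).trans ?_
  calc _ ≤ ∑ l : Fin (k + 1), 4 * ω / (k + 1) * α := Finset.sum_le_sum fun l _ => by
        rw [← sub_mul, abs_mul]
        exact mul_le_mul (abs_attnWeight_sub_le hd hk hl hW hω X l) (ha l l.2) (abs_nonneg _)
          ((abs_nonneg _).trans (abs_attnWeight_sub_le hd hk hl hW hω X l))
    _ = 4 * ω * α := by
      rw [Finset.sum_const, card_univ, Fintype.card_fin, nsmul_eq_mul]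
      push_cast
      field_simp

/-- The linear layer whose two coordinates at position `l` are both `a l`. -/
def symVec (d n : ℕ) (a : ℕ → ℝ) : Vec d :=
  ∑ l ∈ range n, a l • (embed d l false + embed d l true)

lemma inner_symVec_embed {d n : ℕ} (hd : 2 * n ≤ d) (a : ℕ → ℝ) {k : ℕ} (hk : k < n) (b : Bool) :
    inner ℝ (symVec d n a) (embed d k b) = a k := by
  unfold symVec
  rw [sum_inner, Finset.sum_eq_single k]
  · rw [real_inner_smul_left, inner_add_left, inner_embed hd hk hk, inner_embed hd hk hk]
    cases b <;> simp
  · intro l hl hlk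
    rw [real_inner_smul_left, inner_add_left, inner_embed hd (mem_range.1 hl) hk,
      inner_embed hd (mem_range.1 hl) hk]
    simp [hlk]
  · intro h; exact absurd (mem_range.2 hk) h

lemma inner_symVec_symVec {d n : ℕ} (hd : 2 * n ≤ d) (a b : ℕ → ℝ) :
    inner ℝ (symVec d n a) (symVec d n b) = 2 * ∑ l ∈ range n, a l * b l := by
  conv_lhs => rw [symVec.eq_def d n b]
  rw [inner_sum, Finset.mul_sum]
  refine Finset.sum_congr rfl fun l hl => ?_
  rw [real_inner_smul_right, inner_add_right, inner_symVec_embed hd a (mem_range.1 hl),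
    inner_symVec_embed hd a (mem_range.1 hl)]
  ring

lemma norm_symVec_sq {d n : ℕ} (hd : 2 * n ≤ d) (a : ℕ → ℝ) :
    ‖symVec d n a‖ ^ 2 = 2 * ∑ l ∈ range n, a l ^ 2 := by
  rw [← real_inner_self_eq_norm_sq, inner_symVec_symVec hd]
  simp_rw [sq]

lemma inner_attnOut {d k : ℕ} (lam : ℝ) (u : Vec d) (W : Mat d) (X : Fin (k + 1) → Bool) :
    inner ℝ u (attnOut lam W X) = ∑ l, attnWeight lam W X l * inner ℝ u (embed d l (X l)) := by
  unfold attnOut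
  rw [inner_sum]
  exact Finset.sum_congr rfl fun l _ => real_inner_smul_right _ _ _

lemma transformer_symVec {d n : ℕ} (hd : 2 * n ≤ d) (lam : ℝ) (a : ℕ → ℝ) (W : Mat d) {k : ℕ}
    (hk : k < n) (X : Fin (k + 1) → Bool) :
    transformer lam (symVec d n a) W X = score lam W X a := by
  unfold transformer score
  rw [inner_attnOut]
  exact Finset.sum_congr rfl fun l _ => by rw [inner_symVec_embed hd a (by omega)]
-- Gradients of the loss and their invariance under exchange of letters.
section gradient

variable {E : Type*} [NormedAddCommGroup E] [InnerProductSpace ℝ E] [CompleteSpace E]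

lemma hasDerivAt_logistic (y x : ℝ) :
    HasDerivAt (fun z => Real.log (1 + Real.exp (-(y * z)))) (-(y * sg (y * x))) x := by
  have h1 : HasDerivAt (fun z : ℝ => -(y * z)) (-y) x := by
    simpa using ((hasDerivAt_id x).const_mul y).fun_neg
  have h2 := (h1.exp.const_add 1).log (by positivity)
  refine h2.congr_deriv ?_
  unfold sg
  rw [Real.exp_neg]
  have := Real.exp_pos (y * x)
  field_simp
  ring

lemma hasGradientAt_logisticLoss (n : ℕ) (T : ∀ k : ℕ, (Fin (k + 1) → Bool) → E → ℝ)
    (g : ∀ k : ℕ, (Fin (k + 1) → Bool) → E) (x : E)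
    (h : ∀ k < n, ∀ X, HasGradientAt (T k X) (g k X) x) :
    HasGradientAt (fun z => ∑ k ∈ range n, 1 / (Fintype.card (Fin (k + 1) → Bool) : ℝ) *
        ∑ X : Fin (k + 1) → Bool, Real.log (1 + Real.exp (-(label X * T k X z))))
      (-∑ k ∈ range n, (1 / (Fintype.card (Fin (k + 1) → Bool) : ℝ)) •
        ∑ X : Fin (k + 1) → Bool, (label X * sg (label X * T k X x)) • g k X) x := by
  rw [hasGradientAt_iff_hasFDerivAt]
  have h1 : ∀ k ∈ range n, HasFDerivAt
      (fun z => 1 / (Fintype.card (Fin (k + 1) → Bool) : ℝ) *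
        ∑ X : Fin (k + 1) → Bool, Real.log (1 + Real.exp (-(label X * T k X z))))
      ((1 / (Fintype.card (Fin (k + 1) → Bool) : ℝ)) • ∑ X : Fin (k + 1) → Bool,
        (-(label X * sg (label X * T k X x))) • InnerProductSpace.toDual ℝ E (g k X)) x := by
    intro k hk
    refine HasFDerivAt.const_mul (HasFDerivAt.fun_sum fun X _ => ?_) _
    have h2 := (hasGradientAt_iff_hasFDerivAt.1 (h k (mem_range.1 hk) X))
    exact HasDerivAt.comp_hasFDerivAt x (hasDerivAt_logistic (label X) (T k X x)) h2
  refine (HasFDerivAt.fun_sum h1).congr_fderiv ?_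
  simp only [map_neg, map_sum, map_smul, neg_smul, Finset.sum_neg_distrib, smul_neg]

end gradient

variable {d n : ℕ}

/-- The gradient of the loss in the linear layer. -/
def gradLinear (n : ℕ) (lam : ℝ) (u : Vec d) (W : Mat d) : Vec d :=
  -∑ k ∈ range n, (1 / (Fintype.card (Fin (k + 1) → Bool) : ℝ)) •
    ∑ X : Fin (k + 1) → Bool,
      (label X * sg (label X * transformer lam u W X)) • attnOut lam W X

lemma gradient_linear (n : ℕ) (lam : ℝ) (u : Vec d) (W : Mat d) :
    gradient (fun u => loss n lam u W) u = gradLinear n lam u W := by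
  refine HasGradientAt.gradient ?_
  refine hasGradientAt_logisticLoss n (fun _ X u => transformer lam u W X)
    (fun _ X => attnOut lam W X) u fun k _ X => ?_
  rw [hasGradientAt_iff_hasFDerivAt]
  have h := (InnerProductSpace.toDual ℝ (Vec d) (attnOut lam W X)).hasFDerivAt (x := u)
  have e : (fun u => transformer lam u W X)
      = InnerProductSpace.toDual ℝ (Vec d) (attnOut lam W X) := by
    funext z
    rw [InnerProductSpace.toDual_apply_apply, real_inner_comm]
    rfl
  rw [e]
  exact h

/-- The gradient of one output in the attention layer. -/
def gradScore {k : ℕ} (lam : ℝ) (u : Vec d) (W : Mat d) (X : Fin (k + 1) → Bool) : Mat d :=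
  (1 / lam) • ∑ l : Fin (k + 1),
    (attnWeight lam W X l * (inner ℝ u (embed d l (X l)) - transformer lam u W X)) •
      outer (embed d l (X l)) (embed d k (X (Fin.last k)))

/-- The gradient of the loss in the attention layer. -/
def gradAttn (n : ℕ) (lam : ℝ) (u : Vec d) (W : Mat d) : Mat d :=
  -∑ k ∈ range n, (1 / (Fintype.card (Fin (k + 1) → Bool) : ℝ)) •
    ∑ X : Fin (k + 1) → Bool,
      (label X * sg (label X * transformer lam u W X)) • gradScore lam u W X

lemma hasGradientAt_transformer {k : ℕ} (lam : ℝ) (u : Vec d) (W : Mat d)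
    (X : Fin (k + 1) → Bool) :
    HasGradientAt (fun W => transformer lam u W X) (gradScore lam u W X) W := by
  rw [hasGradientAt_iff_hasFDerivAt]
  set A : Fin (k + 1) → StrongDual ℝ (Mat d) := fun l => (1 / lam) •
    InnerProductSpace.toDual ℝ (Mat d) (outer (embed d l (X l)) (embed d k (X (Fin.last k))))
    with hA
  set c : Fin (k + 1) → ℝ := fun l => inner ℝ u (embed d l (X l)) with hc
  have hs : ∀ (l : Fin (k + 1)) (V : Mat d), form V (embed d l (X l)) (embed d k (X (Fin.last k))) / lam = A l V := by
    intro l V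
    rw [form_eq_inner, hA]
    simp only [smul_apply, InnerProductSpace.toDual_apply_apply, smul_eq_mul]
    ring
  have hT : ∀ V, transformer lam u V X
      = (∑ l, c l * Real.exp (A l V)) * (∑ l, Real.exp (A l V))⁻¹ := by
    intro V
    unfold transformer
    rw [inner_attnOut, Finset.sum_mul]
    refine Finset.sum_congr rfl fun l _ => ?_
    unfold attnWeight softmax
    simp only [hs, hc]
    ring
  have hZ : 0 < ∑ l, Real.exp (A l W) :=
    Finset.sum_pos (fun _ _ => Real.exp_pos _) ⟨0, mem_univ _⟩
  have hfun : (fun V => transformer lam u V X)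
      = fun V => (∑ l, c l * Real.exp (A l V)) * (∑ l, Real.exp (A l V))⁻¹ := funext hT
  rw [hfun]
  have hexp : ∀ l, HasFDerivAt (fun V => Real.exp (A l V)) (Real.exp (A l W) • A l) W :=
    fun l => ((A l).hasFDerivAt).exp
  have h1 : HasFDerivAt (fun V => ∑ l, c l * Real.exp (A l V))
      (∑ l, c l • (Real.exp (A l W) • A l)) W :=
    HasFDerivAt.fun_sum fun l _ => (hexp l).const_mul (c l)
  have h2 : HasFDerivAt (fun V => ∑ l, Real.exp (A l V)) (∑ l, Real.exp (A l W) • A l) W :=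
    HasFDerivAt.fun_sum fun l _ => hexp l
  have h3 := (hasDerivAt_inv hZ.ne').comp_hasFDerivAt W h2
  refine (h1.mul h3).congr_fderiv ?_
  symm
  ext H
  simp only [add_apply, smul_apply,
    _root_.sum_apply, Function.comp, smul_eq_mul, InnerProductSpace.toDual_apply_apply]
  set Z := ∑ l, Real.exp (A l W) with hZdef
  have hTW := hT W
  unfold gradScore
  rw [real_inner_smul_left, sum_inner, hTW]
  have hw : ∀ l, attnWeight lam W X l = Real.exp (A l W) / Z := by
    intro l
    unfold attnWeight softmax
    simp only [hs]; rw [hZdef]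
  have hH : ∀ l : Fin (k + 1), inner ℝ (outer (embed d l (X l)) (embed d k (X (Fin.last k)))) H * (1 / lam)
      = A l H := by
    intro l
    rw [← hs, form_eq_inner]; ring
  set N := ∑ l, c l * Real.exp (A l W) with hN
  have e1 : (1 / lam) * ∑ l : Fin (k + 1), inner ℝ ((attnWeight lam W X l *
      (inner ℝ u (embed d l (X l)) - N * Z⁻¹)) •
        outer (embed d l (X l)) (embed d k (X (Fin.last k)))) H
      = ∑ l, Z⁻¹ * (c l * (Real.exp (A l W) * A l H))
        - ∑ l, N * (Z⁻¹ ^ 2 * (Real.exp (A l W) * A l H)) := by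
    rw [Finset.mul_sum, ← Finset.sum_sub_distrib]
    refine Finset.sum_congr rfl fun l _ => ?_
    rw [real_inner_smul_left, hw l, ← hH l]
    simp only [hc]
    field_simp
  rw [e1]
  simp only [← Finset.mul_sum]
  field_simp
  ring

lemma gradient_attn (n : ℕ) (lam : ℝ) (u : Vec d) (W : Mat d) :
    gradient (fun W => loss n lam u W) W = gradAttn n lam u W :=
  HasGradientAt.gradient (hasGradientAt_logisticLoss n (fun _ X W => transformer lam u W X)
    (fun _ X => gradScore lam u W X) W fun _ _ X => hasGradientAt_transformer lam u W X)

/-- Minus the gradient of the loss in the linear layer, in symmetric coordinates. -/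
def stepDir (n : ℕ) (lam : ℝ) (W : Mat d) (a : ℕ → ℝ) (l : ℕ) : ℝ :=
  1 / 2 * ∑ k ∈ range n, avg fun X : Fin (k + 1) → Bool =>
    label X * sg (label X * score lam W X a) * wt lam W X l

lemma sum_attnWeight_mul {k : ℕ} (hk : k < n) (lam : ℝ) (W : Mat d) (X : Fin (k + 1) → Bool)
    (f : ℕ → ℝ) :
    ∑ l : Fin (k + 1), attnWeight lam W X l * f l = ∑ l ∈ range n, wt lam W X l * f l := by
  rw [← Finset.sum_range_add_sum_Ico _ (by omega : k + 1 ≤ n), Finset.sum_range,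
    Finset.sum_eq_zero (s := Ico (k + 1) n), add_zero]
  · exact Finset.sum_congr rfl fun l _ => by rw [wt_coe]
  · intro l hl
    unfold wt
    rw [dif_neg (by have := (Finset.mem_Ico.1 hl).1; omega), zero_mul]

lemma SwapInv.score_swap {W : Mat d} (h : SwapInv n W) (lam : ℝ) {k : ℕ} (hk : k < n)
    (X : Fin (k + 1) → Bool) (a : ℕ → ℝ) : score lam W (swap X) a = score lam W X a := by
  unfold score
  rw [h.attnWeight_swap lam hk]

/-- A sequence and its letter exchange have the same label, attention and score. Adding their
contributions places the same weight on both tokens of every position. -/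
lemma gradLinear_symVec (hd : 2 * n ≤ d) (lam : ℝ) {W : Mat d} (hW : SwapInv n W) (a : ℕ → ℝ) :
    gradLinear n lam (symVec d n a) W = -symVec d n (stepDir n lam W a) := by
  unfold gradLinear
  congr 1
  refine ext_inner_right ℝ fun z => ?_
  set ζ : ℕ → Bool → ℝ := fun l b => inner ℝ (embed d l b) z with hζ
  have hk : ∀ k ∈ range n, inner ℝ ((1 / (Fintype.card (Fin (k + 1) → Bool) : ℝ)) •
      ∑ X : Fin (k + 1) → Bool, (label X * sg (label X * transformer lam (symVec d n a) W X)) •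
        attnOut lam W X) z = ∑ l ∈ range n, 1 / 2 * (avg fun X : Fin (k + 1) → Bool =>
          label X * sg (label X * score lam W X a) * wt lam W X l) * (ζ l false + ζ l true) := by
    intro k hk
    have hk := mem_range.1 hk
    rw [real_inner_smul_left, sum_inner]
    set F : (Fin (k + 1) → Bool) → ℝ := fun X => label X * sg (label X * score lam W X a) *
      ∑ l : Fin (k + 1), attnWeight lam W X l * ζ l (X l) with hF
    have e1 : ∑ X : Fin (k + 1) → Bool, inner ℝ ((label X * sg (label X *
        transformer lam (symVec d n a) W X)) • attnOut lam W X) z = ∑ X, F X := by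
      refine Finset.sum_congr rfl fun X _ => ?_
      rw [real_inner_smul_left, transformer_symVec hd lam a W hk, hF, real_inner_comm,
        inner_attnOut]
      congr 1
      exact Finset.sum_congr rfl fun l _ => by rw [hζ, real_inner_comm]
    have e2 : ∀ X, F X + F (swap X) = label X * sg (label X * score lam W X a) *
        ∑ l ∈ range n, wt lam W X l * (ζ l false + ζ l true) := by
      intro X
      rw [← sum_attnWeight_mul hk lam W X fun l => ζ l false + ζ l true, hF]
      simp only [label_swap, hW.score_swap lam hk, hW.attnWeight_swap lam hk, swap]
      rw [← mul_add, ← Finset.sum_add_distrib]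
      congr 1
      refine Finset.sum_congr rfl fun l _ => ?_
      cases X l <;> simp <;> ring
    -- The halving by this symmetrization is the factor `1 / 2` in `stepDir`.
    have e3 : ∑ X, F X = 1 / 2 * ∑ X, (F X + F (swap X)) := by
      rw [Finset.sum_add_distrib, sum_swap F]; ring
    rw [e1, e3]
    simp_rw [e2, Finset.mul_sum]
    rw [Finset.sum_comm]
    refine Finset.sum_congr rfl fun l _ => ?_
    unfold avg
    rw [Finset.mul_sum, Finset.mul_sum, Finset.sum_mul]
    exact Finset.sum_congr rfl fun X _ => by ring
  rw [sum_inner, Finset.sum_congr rfl hk, Finset.sum_comm]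
  unfold symVec
  rw [sum_inner]
  refine Finset.sum_congr rfl fun l _ => ?_
  rw [real_inner_smul_left, inner_add_left, stepDir, Finset.mul_sum, Finset.sum_mul]

/-- The entries of minus the gradient in the attention layer, times the temperature. -/
def entryGrad {d : ℕ} (lam : ℝ) (W : Mat d) (a : ℕ → ℝ) (q p : ℕ) (b c : Bool) : ℝ :=
  avg fun X : Fin (q + 1) → Bool => label X * sg (label X * score lam W X a) *
    ((∑ l : Fin (q + 1), attnWeight lam W X l * (a l - score lam W X a) *
      (if (l : ℕ) = p ∧ X l = b then 1 else 0)) * if X (Fin.last q) = c then 1 else 0)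

/-- The embeddings are orthonormal, and only the sequences of length `q + 1` have their last token
at position `q`, so a single length contributes. -/
lemma form_gradAttn (hd : 2 * n ≤ d) (lam : ℝ) (W : Mat d) (a : ℕ → ℝ) {p q : ℕ}
    (hp : p < n) (hq : q < n) (b c : Bool) :
    form (gradAttn n lam (symVec d n a) W) (embed d p b) (embed d q c)
      = -(1 / lam * entryGrad lam W a q p b c) := by
  rw [form_eq_inner, gradAttn, inner_neg_right, inner_sum]
  congr 1
  rw [Finset.sum_eq_single q]
  · rw [real_inner_smul_right, inner_sum]
    unfold entryGrad avg
    rw [mul_left_comm]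
    congr 1
    rw [Finset.mul_sum]
    refine Finset.sum_congr rfl fun X _ => ?_
    rw [real_inner_smul_right, transformer_symVec hd lam a W hq, gradScore, real_inner_smul_right,
      inner_sum, mul_left_comm]
    congr 2
    rw [Finset.sum_mul]
    refine Finset.sum_congr rfl fun l _ => ?_
    rw [real_inner_smul_right, inner_outer, inner_embed hd hp (by omega), inner_embed hd hq hq,
      inner_symVec_embed hd a (by omega), transformer_symVec hd lam a W hq]
    simp only [true_and, eq_comm (a := p), eq_comm (a := b), eq_comm (a := c)]
    ring
  · intro k hk hkq
    have hk := mem_range.1 hk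
    rw [real_inner_smul_right, inner_sum, Finset.sum_eq_zero, mul_zero]
    intro X _
    rw [real_inner_smul_right, gradScore, real_inner_smul_right, inner_sum, Finset.sum_eq_zero,
      mul_zero, mul_zero]
    intro l _
    rw [real_inner_smul_right, inner_outer, inner_embed hd hq hk, if_neg (fun h => hkq h.1.symm)]
    ring
  · intro h; exact absurd (mem_range.2 hq) h

lemma form_sub_smul (W V : Mat d) (r : ℝ) (x y : Vec d) :
    form (W - r • V) x y = form W x y - r * form V x y := by
  simp only [form_eq_inner, inner_sub_right, real_inner_smul_right]

lemma SwapInv.entryGrad_swap {W : Mat d} (hW : SwapInv n W) (lam : ℝ) (a : ℕ → ℝ) {q : ℕ}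
    (hq : q < n) (p : ℕ) (b c : Bool) :
    entryGrad lam W a q p (!b) (!c) = entryGrad lam W a q p b c := by
  unfold entryGrad avg
  congr 1
  rw [← sum_swap]
  refine Finset.sum_congr rfl fun X _ => ?_
  have h1 : ∀ l, swap X l = (!b) ↔ X l = b := fun l => by unfold swap; simp
  have h2 : ∀ l, swap X l = (!c) ↔ X l = c := fun l => by unfold swap; simp
  simp only [label_swap, hW.score_swap lam hq, hW.attnWeight_swap lam hq, h1, h2]

lemma SwapInv.step (hd : 2 * n ≤ d) {W : Mat d} (hW : SwapInv n W) (lam r : ℝ) (a : ℕ → ℝ) :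
    SwapInv n (W - r • gradAttn n lam (symVec d n a) W) := by
  intro l hl k hk b c
  rw [form_sub_smul, form_sub_smul, form_gradAttn hd lam W a hl hk, form_gradAttn hd lam W a hl hk,
    hW l hl k hk, hW.entryGrad_swap lam a hk]

lemma norm_avg_sum_le {E : Type*} [NormedAddCommGroup E] [NormedSpace ℝ E]
    {f : ∀ k, (Fin (k + 1) → Bool) → E} {B : ℕ → ℝ} (h : ∀ k < n, ∀ X, ‖f k X‖ ≤ B k) :
    ‖∑ k ∈ range n, (1 / (Fintype.card (Fin (k + 1) → Bool) : ℝ)) •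
      ∑ X : Fin (k + 1) → Bool, f k X‖ ≤ ∑ k ∈ range n, B k := by
  refine (norm_sum_le _ _).trans (Finset.sum_le_sum fun k hk => ?_)
  rw [norm_smul, Real.norm_of_nonneg (by positivity)]
  calc _ ≤ 1 / (Fintype.card (Fin (k + 1) → Bool) : ℝ) * ∑ _X : Fin (k + 1) → Bool, B k := by
        refine mul_le_mul_of_nonneg_left ?_ (by positivity)
        exact (norm_sum_le _ _).trans (Finset.sum_le_sum fun X _ => h k (mem_range.1 hk) X)
    _ = B k := avg_const (B k)

lemma abs_label_mul_sg_le {k : ℕ} (X : Fin (k + 1) → Bool) (x : ℝ) : |label X * sg x| ≤ 1 := by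
  rw [abs_mul, abs_label, one_mul, abs_of_pos (sg_pos x)]
  exact sg_le_one x

lemma norm_gradAttn_le (hd : 2 * n ≤ d) {lam : ℝ} (hl : 0 < lam) (W : Mat d) {a : ℕ → ℝ} {α : ℝ}
    (ha : ∀ l < n, |a l| ≤ α) :
    ‖gradAttn n lam (symVec d n a) W‖ ≤ n * (2 * α) / lam := by
  unfold gradAttn
  rw [norm_neg]
  refine (norm_avg_sum_le (B := fun _ => 2 * α / lam) fun k hk X => ?_).trans ?_
  · rw [norm_smul]
    have h1 : ‖gradScore lam (symVec d n a) W X‖ ≤ 2 * α / lam := by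
      unfold gradScore
      rw [norm_smul, Real.norm_of_nonneg (by positivity), one_div, inv_mul_eq_div]
      refine div_le_div_of_nonneg_right ?_ hl.le
      refine (norm_sum_le _ _).trans ?_
      calc _ ≤ ∑ l, attnWeight lam W X l * (2 * α) := Finset.sum_le_sum fun l _ => by
            rw [norm_smul, norm_outer, norm_embed hd (by omega : (l : ℕ) < n), norm_embed hd hk,
              inner_symVec_embed hd a (by omega), transformer_symVec hd lam a W hk, mul_one,
              mul_one, norm_mul, Real.norm_of_nonneg (attnWeight_pos lam W X l).le]
            refine mul_le_mul_of_nonneg_left ?_ (attnWeight_pos lam W X l).le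
            have h1 := abs_score_le lam W X (fun i (hi : i < k + 1) => ha i (by omega))
            have h2 := ha l (by omega)
            exact (abs_sub _ _).trans (by linarith)
        _ = 2 * α := by rw [← Finset.sum_mul, sum_attnWeight, one_mul]
    calc _ ≤ 1 * (2 * α / lam) := mul_le_mul (abs_label_mul_sg_le X _) h1 (norm_nonneg _) zero_le_one
      _ = _ := one_mul _
  · rw [Finset.sum_const, card_range, nsmul_eq_mul]
    exact le_of_eq (by ring)

/-! ### Gradient descent in symmetric coordinates. -/

/-- The coordinates of the linear layer along gradient descent. -/
def coords (d n : ℕ) (lam η : ℝ) (t₀ : ℕ) : ℕ → ℕ → ℝ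
  | 0 => 0
  | t + 1 => fun l => coords d n lam η t₀ t l
      + η * stepDir n lam (gd d n lam η t₀ t).2 (coords d n lam η t₀ t) l

lemma symVec_add_smul (a h : ℕ → ℝ) (η : ℝ) :
    symVec d n (fun l => a l + η * h l) = symVec d n a + η • symVec d n h := by
  unfold symVec
  rw [Finset.smul_sum, ← Finset.sum_add_distrib]
  exact Finset.sum_congr rfl fun l _ => by rw [add_smul, mul_smul]

lemma gd_fst_and_swapInv (hd : 2 * n ≤ d) (lam η : ℝ) (t₀ t : ℕ) :
    (gd d n lam η t₀ t).1 = symVec d n (coords d n lam η t₀ t) ∧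
      SwapInv n (gd d n lam η t₀ t).2 := by
  induction t with
  | zero =>
    constructor
    · simp [gd, coords, symVec]
    · intro l _ k _ b c
      simp [gd, form]
  | succ t ih =>
    obtain ⟨h1, h2⟩ := ih
    constructor
    · rw [gd, coords, symVec_add_smul, gradient_linear]
      simp only
      rw [h1, gradLinear_symVec hd lam h2, smul_neg, sub_neg_eq_add]
    · rw [gd, gradient_attn]
      simp only
      rw [h1]
      exact h2.step hd lam _ _

lemma gd_fst (hd : 2 * n ≤ d) (lam η : ℝ) (t₀ t : ℕ) :
    (gd d n lam η t₀ t).1 = symVec d n (coords d n lam η t₀ t) :=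
  (gd_fst_and_swapInv hd lam η t₀ t).1

lemma gd_swapInv (hd : 2 * n ≤ d) (lam η : ℝ) (t₀ t : ℕ) : SwapInv n (gd d n lam η t₀ t).2 :=
  (gd_fst_and_swapInv hd lam η t₀ t).2

lemma gd_snd_succ (hd : 2 * n ≤ d) (lam η : ℝ) (t₀ t : ℕ) :
    (gd d n lam η t₀ (t + 1)).2 = (gd d n lam η t₀ t).2 - (η * if t ≤ t₀ then lam else 1) •
      gradAttn n lam (symVec d n (coords d n lam η t₀ t)) (gd d n lam η t₀ t).2 := by
  rw [gd, gradient_attn]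
  simp only
  rw [gd_fst hd]

/-! ### Comparison of the true step with the drift. -/

lemma attnWeight_of_single {lam : ℝ} (W : Mat d) (X : Fin (0 + 1) → Bool) (l : Fin (0 + 1)) :
    attnWeight lam W X l = 1 := by
  have := sum_attnWeight lam W X
  have h : l = 0 := Fin.ext (by omega)
  rw [Fin.sum_univ_succ] at this
  simpa [h] using this

lemma score_of_single {lam : ℝ} (W : Mat d) (X : Fin (0 + 1) → Bool) (a : ℕ → ℝ) :
    score lam W X a = a 0 := by
  unfold score
  simp only [attnWeight_of_single, one_mul]
  simp

lemma label_of_single (X : Fin (0 + 1) → Bool) : label X = 1 := by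
  rw [label_eq]; simp

lemma wt_of_single {lam : ℝ} (W : Mat d) (X : Fin (0 + 1) → Bool) (l : ℕ) :
    wt lam W X l = if l = 0 then 1 else 0 := by
  unfold wt
  split_ifs with h1 h2 h2
  · exact attnWeight_of_single W X _
  · omega
  · omega
  · rfl

/-- The part of `stepDir` that comes from the sequences of length one. -/
lemma avg_single (lam : ℝ) (W : Mat d) (a : ℕ → ℝ) (l : ℕ) :
    (avg fun X : Fin (0 + 1) → Bool => label X * sg (label X * score lam W X a) * wt lam W X l)
      = if l = 0 then sg (a 0) else 0 := by
  simp only [label_of_single, score_of_single, wt_of_single, one_mul]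
  rw [avg_const]
  split_ifs <;> simp

lemma abs_avg_sub_le (hd : 2 * n ≤ d) {lam ω α : ℝ} (hl : 0 < lam) {W : Mat d}
    (hW : ‖W‖ ≤ ω * lam) (hω0 : 0 ≤ ω) (hω : ω ≤ 1 / 4) {a : ℕ → ℝ} (ha : ∀ l < n, |a l| ≤ α)
    {k : ℕ} (hk1 : 1 ≤ k) (hk : k < n) (l : ℕ) :
    |(avg fun X : Fin (k + 1) → Bool => label X * sg (label X * score lam W X a) * wt lam W X l)
      - (if l ≤ k then -(psi (avgMargin a k) / (k + 1)) else 0)| ≤ 4 * ω * (1 + α) := by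
  have hα : 0 ≤ α := (abs_nonneg _).trans (ha 0 (by omega))
  have h0 : (avg fun X : Fin (k + 1) → Bool => if l ≤ k then
      label X * sg (label X * avgMargin a k) * (1 / (k + 1)) else 0)
      = if l ≤ k then -(psi (avgMargin a k) / (k + 1)) else 0 := by
    split_ifs with h
    -- Both labels have frequency one half, so the average of `y * sg (y * m)` is `(sg m - sg (-m))
    -- / 2 = -psi m`.
    · rw [avg_label hk1 fun y => y * sg (y * avgMargin a k) * (1 / (k + 1))]
      rw [neg_one_mul (avgMargin a k), sg_neg]
      unfold psi
      ring_nf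
    · exact avg_const 0
  rw [← h0, ← avg_sub]
  refine abs_avg_le fun X => ?_
  split_ifs with h
  · have h1 := abs_score_sub_le hd hk hl hW hω X (fun i (hi : i < k + 1) => ha i (by omega))
    have h2 := abs_attnWeight_sub_le hd hk hl hW hω X ⟨l, by omega⟩
    have hw : wt lam W X l = attnWeight lam W X ⟨l, by omega⟩ := wt_coe lam W X ⟨l, by omega⟩
    set w := attnWeight lam W X ⟨l, by omega⟩ with hwd
    rw [hw]
    have hw0 : 0 < w := attnWeight_pos lam W X _
    have hw1 : w ≤ 1 := attnWeight_le_one lam W X _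
    have h3 : 4 * ω / ((k : ℝ) + 1) ≤ 4 * ω := div_le_self (by positivity) (by
      have : (0 : ℝ) ≤ k := by positivity
      linarith)
    have h4 : |sg (label X * score lam W X a) - sg (label X * avgMargin a k)| ≤ 4 * ω * α := by
      refine (abs_sg_sub_le _ _).trans ?_
      rw [← mul_sub, abs_mul, abs_label, one_mul]
      exact h1
    have e : label X * sg (label X * score lam W X a) * w
        - label X * sg (label X * avgMargin a k) * (1 / (k + 1))
        = label X * ((sg (label X * score lam W X a) - sg (label X * avgMargin a k)) * w
          + sg (label X * avgMargin a k) * (w - 1 / (k + 1))) := by ring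
    rw [e, abs_mul, abs_label, one_mul]
    refine (abs_add_le _ _).trans ?_
    rw [abs_mul, abs_mul, abs_of_pos hw0, abs_of_pos (sg_pos _)]
    have h5 := mul_le_mul h4 hw1 hw0.le (by positivity)
    have h6 := mul_le_mul (sg_le_one (label X * avgMargin a k)) (h2.trans h3) (abs_nonneg _)
      zero_le_one
    linarith
  · have : wt lam W X l = 0 := by unfold wt; rw [dif_neg (by omega)]
    rw [this]; simp; positivity

lemma abs_stepDir_sub_le (hd : 2 * n ≤ d) {lam ω α : ℝ} (hl : 0 < lam) {W : Mat d}
    (hW : ‖W‖ ≤ ω * lam) (hω : ω ≤ 1 / 4) (hn : 1 ≤ n) {a : ℕ → ℝ} (ha : ∀ l < n, |a l| ≤ α)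
    (l : ℕ) : |stepDir n lam W a l - drift n a l| ≤ 2 * n * ω * (1 + α) := by
  have hω0 : 0 ≤ ω := by
    by_contra! h
    have := (norm_nonneg W).trans hW
    nlinarith
  have hα : 0 ≤ α := (abs_nonneg _).trans (ha 0 (by omega))
  have e : stepDir n lam W a l - drift n a l = 1 / 2 * ∑ k ∈ Ico 1 n,
      ((avg fun X : Fin (k + 1) → Bool => label X * sg (label X * score lam W X a) * wt lam W X l)
      - (if l ≤ k then -(psi (avgMargin a k) / (k + 1)) else 0)) := by
    unfold stepDir drift
    rw [Finset.sum_sub_distrib, ← Finset.sum_range_add_sum_Ico _ hn, Finset.sum_range_one,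
      avg_single]
    have : ∑ k ∈ Ico 1 n, (if l ≤ k then psi (avgMargin a k) / (2 * ((k : ℝ) + 1)) else 0)
        = -(1 / 2) * ∑ k ∈ Ico 1 n, (if l ≤ k then -(psi (avgMargin a k) / ((k : ℝ) + 1)) else 0) := by
      rw [Finset.mul_sum]
      refine Finset.sum_congr rfl fun k _ => ?_
      split_ifs
      · field_simp
      · simp
    rw [this]
    split_ifs <;> ring_nf
  rw [e, abs_mul, abs_of_pos (by norm_num : (0 : ℝ) < 1 / 2)]
  have h1 : |∑ k ∈ Ico 1 n,
      ((avg fun X : Fin (k + 1) → Bool => label X * sg (label X * score lam W X a) * wt lam W X l)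
      - (if l ≤ k then -(psi (avgMargin a k) / ((k : ℝ) + 1)) else 0))| ≤ n * (4 * ω * (1 + α)) := by
    refine (Finset.abs_sum_le_sum_abs _ _).trans ?_
    refine (Finset.sum_le_sum fun k hk => abs_avg_sub_le hd hl hW hω0 hω ha
      (Finset.mem_Ico.1 hk).1 (Finset.mem_Ico.1 hk).2 l).trans ?_
    rw [Finset.sum_const, Nat.card_Ico, nsmul_eq_mul]
    refine mul_le_mul_of_nonneg_right ?_ (by positivity)
    exact_mod_cast Nat.sub_le n 1
  linarith

lemma sum_sq_stepDir_sub_le (hd : 2 * n ≤ d) {lam ω α : ℝ} (hl : 0 < lam) {W : Mat d}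
    (hW : ‖W‖ ≤ ω * lam) (hω : ω ≤ 1 / 4) (hn : 1 ≤ n) {a : ℕ → ℝ} (ha : ∀ l < n, |a l| ≤ α) :
    ∑ l ∈ range n, (stepDir n lam W a l - drift n a l) ^ 2
      ≤ (2 * n * Real.sqrt n * ω * (1 + α)) ^ 2 := by
  have h : ∀ l ∈ range n, (stepDir n lam W a l - drift n a l) ^ 2 ≤ (2 * n * ω * (1 + α)) ^ 2 :=
    fun l _ => by
      rw [← sq_abs]
      exact pow_le_pow_left₀ (abs_nonneg _) (abs_stepDir_sub_le hd hl hW hω hn ha l) 2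
  refine (Finset.sum_le_sum h).trans (le_of_eq ?_)
  rw [Finset.sum_const, card_range, nsmul_eq_mul]
  have : Real.sqrt n ^ 2 = n := Real.sq_sqrt (by positivity)
  calc (n : ℝ) * (2 * n * ω * (1 + α)) ^ 2 = Real.sqrt n ^ 2 * (2 * n * ω * (1 + α)) ^ 2 := by rw [this]
    _ = _ := by ring

lemma norm_attnOut_sq_le (hd : 2 * n ≤ d) {lam ω : ℝ} (hl : 0 < lam) {W : Mat d}
    (hW : ‖W‖ ≤ ω * lam) (hω : ω ≤ 1 / 4) {k : ℕ} (hk : k < n) (X : Fin (k + 1) → Bool) :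
    ‖attnOut lam W X‖ ^ 2 ≤ 2 / (k + 1) := by
  rw [← real_inner_self_eq_norm_sq, inner_attnOut]
  have h1 : ∀ l : Fin (k + 1), inner ℝ (attnOut lam W X) (embed d l (X l)) = attnWeight lam W X l := by
    intro l
    rw [real_inner_comm, inner_attnOut, Finset.sum_eq_single l]
    · rw [inner_embed hd (by omega) (by omega)]; simp
    · intro i _ hi
      rw [inner_embed hd (by omega) (by omega), if_neg, mul_zero]
      rintro ⟨h, -⟩
      exact hi (Fin.ext h.symm)
    · simp
  have hk0 : (0 : ℝ) < k + 1 := by positivity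
  have h2 : ∀ l, attnWeight lam W X l ≤ 2 / (k + 1) := by
    intro l
    have h3 := (abs_le.1 (abs_attnWeight_sub_le hd hk hl hW hω X l)).2
    have h4 : 4 * ω / ((k : ℝ) + 1) ≤ 1 / (k + 1) := by gcongr; linarith
    have h5 : (2 : ℝ) / (k + 1) = 1 / (k + 1) + 1 / (k + 1) := by ring
    linarith
  calc _ ≤ ∑ l, attnWeight lam W X l * (2 / ((k : ℝ) + 1)) := Finset.sum_le_sum fun l _ => by
        rw [h1]
        exact mul_le_mul_of_nonneg_left (h2 l) (attnWeight_pos lam W X l).le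
    _ = _ := by rw [← Finset.sum_mul, sum_attnWeight, one_mul]

lemma sum_inv_sqrt_le (n : ℕ) : ∑ k ∈ range n, 1 / Real.sqrt (k + 1) ≤ 2 * Real.sqrt n := by
  induction n with
  | zero => simp
  | succ n ih =>
    rw [Finset.sum_range_succ]
    have h0 : (0 : ℝ) ≤ n := by positivity
    have hs : 0 < Real.sqrt (n + 1) := Real.sqrt_pos.2 (by positivity)
    have h1 : Real.sqrt (n + 1) ^ 2 = n + 1 := Real.sq_sqrt (by positivity)
    have h2 : Real.sqrt n ^ 2 = n := Real.sq_sqrt h0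
    have h3 : Real.sqrt n ≤ Real.sqrt (n + 1) := Real.sqrt_le_sqrt (by linarith)
    have h4 := Real.sqrt_nonneg (n : ℝ)
    have h5 : 1 / Real.sqrt (n + 1) ≤ 2 * (Real.sqrt (n + 1) - Real.sqrt n) := by
      rw [div_le_iff₀ hs]
      nlinarith [sq_nonneg (Real.sqrt (n + 1) - Real.sqrt n)]
    push_cast
    linarith

/-- Almost uniform attention spreads the output over `k + 1` orthogonal tokens, so its norm is at
most `√(2 / (k + 1))`. Summed over lengths this is `O(√n)`, which gives order `n`; bounding each
output by `1` would give order `n ^ 2`. -/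
lemma sum_sq_stepDir_le (hd : 2 * n ≤ d) {lam ω : ℝ} (hl : 0 < lam) {W : Mat d}
    (hW : ‖W‖ ≤ ω * lam) (hω : ω ≤ 1 / 4) (hS : SwapInv n W) (a : ℕ → ℝ) :
    ∑ l ∈ range n, stepDir n lam W a l ^ 2 ≤ 4 * n := by
  have h1 : ‖gradLinear n lam (symVec d n a) W‖ ≤ 2 * Real.sqrt 2 * Real.sqrt n := by
    unfold gradLinear
    rw [norm_neg]
    refine (norm_avg_sum_le (B := fun k => Real.sqrt 2 * (1 / Real.sqrt (k + 1)))
      fun k hk X => ?_).trans ?_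
    · rw [norm_smul]
      have h2 : ‖attnOut lam W X‖ ≤ Real.sqrt 2 * (1 / Real.sqrt (k + 1)) := by
        rw [mul_one_div, ← Real.sqrt_div (by norm_num)]
        exact Real.le_sqrt_of_sq_le (norm_attnOut_sq_le hd hl hW hω hk X)
      calc _ ≤ 1 * (Real.sqrt 2 * (1 / Real.sqrt (k + 1))) :=
            mul_le_mul (abs_label_mul_sg_le X _) h2 (norm_nonneg _) zero_le_one
        _ = _ := one_mul _
    · rw [← Finset.mul_sum]
      have := mul_le_mul_of_nonneg_left (sum_inv_sqrt_le n) (Real.sqrt_nonneg 2)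
      linarith
  rw [gradLinear_symVec hd lam hS, norm_neg] at h1
  have h2 := pow_le_pow_left₀ (norm_nonneg _) h1 2
  rw [norm_symVec_sq hd] at h2
  have e : (2 * Real.sqrt 2 * Real.sqrt n) ^ 2 = 8 * n := by
    rw [mul_pow, mul_pow, Real.sq_sqrt (by norm_num), Real.sq_sqrt (by positivity)]; ring
  linarith

lemma norm_gd_snd_succ_sub_le (hd : 2 * n ≤ d) {lam η : ℝ} (hl : 0 < lam) (hη : 0 ≤ η) (t₀ t : ℕ)
    {α : ℝ} (ha : ∀ l < n, |coords d n lam η t₀ t l| ≤ α) :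
    ‖(gd d n lam η t₀ (t + 1)).2 - (gd d n lam η t₀ t).2‖
      ≤ (η * if t ≤ t₀ then lam else 1) * (n * (2 * α) / lam) := by
  rw [gd_snd_succ hd, sub_sub_cancel_left, norm_neg, norm_smul, Real.norm_of_nonneg]
  · exact mul_le_mul_of_nonneg_left (norm_gradAttn_le hd hl _ ha) (by split_ifs <;> positivity)
  · split_ifs <;> positivity

lemma abs_stepDir_sub_single_le (hd : 2 * n ≤ d) {lam ω α : ℝ} (hl : 0 < lam) {W : Mat d}
    (hW : ‖W‖ ≤ ω * lam) (hω : ω ≤ 1 / 4) (hn : 1 ≤ n) {a : ℕ → ℝ} (ha : ∀ l < n, |a l| ≤ α)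
    (l : ℕ) : |stepDir n lam W a l - if l = 0 then sg (a 0) / 2 else 0|
      ≤ 2 * n * ω * (1 + α) + n * α := by
  have hα : 0 ≤ α := (abs_nonneg _).trans (ha 0 (by omega))
  have h1 := abs_stepDir_sub_le hd hl hW hω hn ha l
  have h2 : |drift n a l - if l = 0 then sg (a 0) / 2 else 0| ≤ n * α := by
    unfold drift
    rw [sub_sub_cancel_left, abs_neg]
    refine (Finset.abs_sum_le_sum_abs _ _).trans ?_
    calc _ ≤ ∑ k ∈ Ico 1 n, α := Finset.sum_le_sum fun k hk => by
          have hk0 : (0 : ℝ) < k + 1 := by positivity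
          have hk1 : (1 : ℝ) ≤ k + 1 := by linarith [(by positivity : (0 : ℝ) ≤ k)]
          split_ifs
          · have hm : |avgMargin a k| ≤ α := by
              unfold avgMargin
              rw [abs_div, abs_of_pos hk0, div_le_iff₀ hk0]
              refine (Finset.abs_sum_le_sum_abs _ _).trans ?_
              have hkn := (Finset.mem_Ico.1 hk).2
              refine (Finset.sum_le_sum fun i hi => ha i ?_).trans (le_of_eq ?_)
              · have := mem_range.1 hi; omega
              · rw [Finset.sum_const, card_range, nsmul_eq_mul]; push_cast; ring
            rw [abs_div, abs_of_pos (by positivity : (0 : ℝ) < 2 * (k + 1))]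
            have h3 := (abs_psi_le _).trans hm
            refine (div_le_self (abs_nonneg _) (by linarith)).trans h3
          · simpa using hα
      _ ≤ n * α := by
        rw [Finset.sum_const, Nat.card_Ico, nsmul_eq_mul]
        refine mul_le_mul_of_nonneg_right ?_ hα
        exact_mod_cast Nat.sub_le n 1
  have := abs_sub_le (stepDir n lam W a l) (drift n a l) (if l = 0 then sg (a 0) / 2 else 0)
  linarith

/-! ### First phase: the attention layer learns the label. -/

/-- The state of gradient descent in the first phase, at rescaled time `s = η t`. -/
structure EarlyState (n : ℕ) (a : ℕ → ℝ) (W : Mat d) (s : ℝ) : Prop where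
  norm_le : ‖W‖ ≤ s
  first_ge : 19 / 100 * s ≤ a 0
  first_le : a 0 ≤ 31 / 100 * s
  rest_le : ∀ l, 1 ≤ l → l < n → |a l| ≤ 1 / 1000 * s

lemma EarlyState.abs_le {a : ℕ → ℝ} {W : Mat d} {s : ℝ} (h : EarlyState n a W s) (l : ℕ)
    (hl : l < n) : |a l| ≤ s := by
  have h0 := (norm_nonneg W).trans h.norm_le
  rcases Nat.eq_zero_or_pos l with e | e
  · subst e
    rw [_root_.abs_le]
    constructor <;> linarith [h.first_ge, h.first_le]
  · linarith [h.rest_le l e hl]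

/-- During this phase all margins are tiny and all logistic weights are close to `1 / 2`. The first
coordinate thus moves at speed close to `1 / 4`, the others hardly at all. The factor `lam` in the
step size cancels the `1 / lam` of `gradAttn`. -/
lemma earlyState (hd : 2 * n ≤ d) (hn : 1 ≤ n) {lam η : ℝ} (hlam : 10 ^ 6 * (n : ℝ) ^ 2 ≤ lam)
    (hη : 0 < η) {t₀ : ℕ} (ht₀ : η * t₀ * n ≤ 1 / 10 ^ 4) {t : ℕ} (ht : t ≤ t₀) :
    EarlyState n (coords d n lam η t₀ t) (gd d n lam η t₀ t).2 (η * t) := by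
  have hn1 : (1 : ℝ) ≤ n := by exact_mod_cast hn
  have hlam1 : 10 ^ 6 * (n : ℝ) ≤ lam := by nlinarith
  have hl : 0 < lam := by linarith
  induction t with
  | zero => refine ⟨?_, ?_, ?_, ?_⟩ <;> simp [gd, coords]
  | succ t ih =>
    have I := ih (by omega)
    set a := coords d n lam η t₀ t with ha
    set W := (gd d n lam η t₀ t).2 with hWdef
    have hs0 : 0 ≤ η * t := by positivity
    have htt : (t : ℝ) ≤ t₀ := by exact_mod_cast (by omega : t ≤ t₀)
    have hsn : η * t * n ≤ 1 / 10 ^ 4 := le_trans (by gcongr) ht₀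
    have hs1 : η * t ≤ 1 / 10 ^ 4 := le_trans (le_mul_of_one_le_right hs0 hn1) hsn
    have hW1 : ‖W‖ ≤ 1 / lam * lam := by
      rw [one_div_mul_cancel hl.ne']
      exact I.norm_le.trans (hs1.trans (by norm_num))
    have hω : 1 / lam ≤ 1 / 10 ^ 6 := one_div_le_one_div_of_le (by norm_num) (by linarith)
    have hstep : ∀ l, |stepDir n lam W a l - if l = 0 then sg (a 0) / 2 else 0| ≤ 1 / 1000 := by
      intro l
      refine (abs_stepDir_sub_single_le hd hl hW1 (hω.trans (by norm_num)) hn I.abs_le l).trans ?_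
      have h1 : n * (1 / lam) ≤ 1 / 10 ^ 6 := by
        rw [mul_one_div, div_le_div_iff₀ hl (by norm_num)]; linarith
      have h2 : 2 * n * (1 / lam) * (1 + η * t) ≤ 2 * (1 / 10 ^ 6) * 2 := by
        have : 0 ≤ n * (1 / lam) := by positivity
        nlinarith
      nlinarith
    refine ⟨?_, ?_, ?_, ?_⟩
    · have h1 := norm_gd_snd_succ_sub_le hd hl hη.le t₀ t I.abs_le
      rw [if_pos (by omega)] at h1
      have h2 : η * lam * (n * (2 * (η * t)) / lam) ≤ η := by
        have : η * lam * (n * (2 * (η * t)) / lam) = 2 * (η * (η * t * n)) := by field_simp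
        rw [this]
        nlinarith
      have h3 := norm_le_norm_add_norm_sub' (gd d n lam η t₀ (t + 1)).2 W
      have h4 := I.norm_le
      push_cast
      rw [← hWdef] at h1
      linarith
    · have h1 := _root_.abs_le.1 (hstep 0)
      rw [if_pos rfl] at h1
      have h2 := sg_sub_le (x := 0) (y := a 0) (by linarith [I.first_ge])
      rw [sg_zero] at h2
      have h3 : 19 / 100 ≤ stepDir n lam W a 0 := by linarith [I.first_le]
      have h4 := mul_le_mul_of_nonneg_left h3 hη.le
      have h5 := I.first_ge
      simp only [coords]
      push_cast
      linarith
    · have h1 := _root_.abs_le.1 (hstep 0)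
      rw [if_pos rfl] at h1
      have h2 := sg_antitone (x := 0) (y := a 0) (by linarith [I.first_ge])
      rw [sg_zero] at h2
      have h3 : stepDir n lam W a 0 ≤ 31 / 100 := by linarith
      have h4 := mul_le_mul_of_nonneg_left h3 hη.le
      have h5 := I.first_le
      simp only [coords]
      push_cast
      linarith
    · intro l hl1 hln
      have h1 := hstep l
      rw [if_neg (by omega), sub_zero] at h1
      simp only [coords]
      refine (abs_add_le _ _).trans ?_
      rw [abs_mul, abs_of_pos hη]
      have h2 := mul_le_mul_of_nonneg_left h1 hη.le
      have h3 := I.rest_le l hl1 hln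
      push_cast
      linarith

lemma sum_attnWeight_ite {k p : ℕ} (hp : p < k + 1) (lam : ℝ) (W : Mat d) (X : Fin (k + 1) → Bool)
    (f : ℕ → ℝ) (b : Bool) :
    ∑ l : Fin (k + 1), attnWeight lam W X l * f l * (if (l : ℕ) = p ∧ X l = b then 1 else 0)
      = attnWeight lam W X ⟨p, hp⟩ * f p * if X ⟨p, hp⟩ = b then 1 else 0 := by
  rw [Finset.sum_eq_single ⟨p, hp⟩]
  · simp
  · intro l _ h
    rw [if_neg, mul_zero]
    rintro ⟨h1, -⟩
    exact h (Fin.ext h1)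
  · simp

lemma avg_add {k : ℕ} (F G : (Fin (k + 1) → Bool) → ℝ) :
    avg (fun X => F X + G X) = avg F + avg G := by
  unfold avg; rw [Finset.sum_add_distrib]; ring

lemma avg_eq_of_add_flip {k : ℕ} (i : Fin (k + 1)) {F G : (Fin (k + 1) → Bool) → ℝ}
    (h : ∀ X, F X + F (flip i X) = G X) : avg F = 1 / 2 * avg G := by
  have h1 := avg_add F fun X => F (flip i X)
  rw [avg_flip] at h1
  simp only [h] at h1
  linarith

lemma last_ne_zero {k : ℕ} (hk : 1 ≤ k) : Fin.last k ≠ 0 := by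
  intro h; have := congrArg Fin.val h; simp at this; omega

lemma avg_first_last {k : ℕ} (hk : 1 ≤ k) (b c : Bool) :
    avg (fun X : Fin (k + 1) → Bool => (if X 0 = b then (1 : ℝ) else 0) *
      if X (Fin.last k) = c then 1 else 0) = 1 / 4 := by
  rw [avg_eq_of_add_flip 0 (G := fun X => if X (Fin.last k) = c then 1 else 0),
    avg_eq_of_add_flip (Fin.last k) (G := fun _ => 1), avg_const]
  · norm_num
  · intro X
    unfold flip
    rw [Function.update_self]
    cases X (Fin.last k) <;> cases c <;> simp
  · intro X
    unfold flip
    rw [Function.update_self, Function.update_of_ne (last_ne_zero hk)]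
    cases X 0 <;> cases b <;> simp

section entries

variable {lam s : ℝ} {a : ℕ → ℝ} {W : Mat d}

/-- The label of a sequence with first token `b` and last token `c`. -/
def pairLabel (b c : Bool) : ℝ := if b = c then 1 else -1

lemma abs_pairLabel (b c : Bool) : |pairLabel b c| = 1 := by
  unfold pairLabel; split_ifs <;> simp

lemma pairLabel_sq (b c : Bool) : pairLabel b c * pairLabel b c = 1 := by
  unfold pairLabel; split_ifs <;> simp

/-- One quarter of the sequences have first token `b` and last token `c`, and all of these carry the
label `pairLabel b c`. Since `a 0` dominates, the score is only about half of it or less, so `a 0`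
minus the score is bounded below by a multiple of `s` and all contributions have the same sign. -/
lemma entryGrad_first_ge (hd : 2 * n ≤ d) (hlam : 10 ^ 6 ≤ lam) (hs : s ≤ 1 / 10 ^ 4)
    (h : EarlyState n a W s) {k : ℕ} (hk1 : 1 ≤ k) (hk : k < n) (b c : Bool) :
    s / (200 * (k + 1)) ≤ pairLabel b c * entryGrad lam W a k 0 b c := by
  have hl : 0 < lam := lt_of_lt_of_le (by norm_num) hlam
  have hs0 := (norm_nonneg W).trans h.norm_le
  have hω : 1 / lam ≤ 1 / 10 ^ 6 := one_div_le_one_div_of_le (by norm_num) hlam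
  have hω4 : 1 / lam ≤ 1 / 4 := hω.trans (by norm_num)
  have hW1 : ‖W‖ ≤ 1 / lam * lam := by
    rw [one_div_mul_cancel hl.ne']
    exact h.norm_le.trans (hs.trans (by norm_num))
  have hk0 : (0 : ℝ) < k + 1 := by positivity
  have hk2 : (2 : ℝ) ≤ k + 1 := by
    have : (1 : ℝ) ≤ k := by exact_mod_cast hk1
    linarith
  unfold entryGrad
  rw [← avg_const_mul]
  have hpt : ∀ X : Fin (k + 1) → Bool,
      s / (50 * (k + 1)) * ((if X 0 = b then (1 : ℝ) else 0) * if X (Fin.last k) = c then 1 else 0)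
      ≤ pairLabel b c * (label X * sg (label X * score lam W X a) *
        ((∑ l : Fin (k + 1), attnWeight lam W X l * (a l - score lam W X a) *
          (if (l : ℕ) = 0 ∧ X l = b then 1 else 0)) * if X (Fin.last k) = c then 1 else 0)) := by
    intro X
    rw [sum_attnWeight_ite (by omega) lam W X fun l => a l - score lam W X a]
    set m := score lam W X a with hm
    have hX0 : X ⟨0, by omega⟩ = X 0 := rfl
    rw [hX0]
    by_cases hb : X 0 = b
    swap
    · simp [hb]
    by_cases hc : X (Fin.last k) = c
    swap
    · simp [hc]
    rw [if_pos hb, if_pos hc]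
    have hy : label X = pairLabel b c := by rw [label_eq, hb, hc]; rfl
    set y := pairLabel b c with hyd
    rw [hy]
    have hysq := pairLabel_sq b c
    rw [← hyd] at hysq
    set w := attnWeight lam W X ⟨0, by omega⟩ with hw
    have hw1 : 99 / (100 * ((k : ℝ) + 1)) ≤ w := by
      have h1 := (_root_.abs_le.1 (abs_attnWeight_sub_le hd hk hl hW1 hω4 X ⟨0, by omega⟩)).1
      have h2 : 4 * (1 / lam) / ((k : ℝ) + 1) ≤ (1 / 100) / (k + 1) := by gcongr; linarith
      have h3 : 99 / (100 * ((k : ℝ) + 1)) = 1 / (k + 1) - (1 / 100) / (k + 1) := by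
        field_simp; norm_num
      rw [h3]
      linarith
    have hmα : |m| ≤ s := abs_score_le lam W X fun i hi => h.abs_le i (by omega)
    have hsg : 49 / 100 ≤ sg (y * m) := by
      have h1 := abs_sg_sub_le 0 (y * m)
      rw [sg_zero, zero_sub, abs_neg, abs_mul, abs_pairLabel, one_mul] at h1
      linarith [(_root_.abs_le.1 h1).2]
    have hmle : m ≤ 52 / 100 * a 0 := by
      have h1 := (_root_.abs_le.1 (abs_score_sub_le hd hk hl hW1 hω4 X
        fun i (hi : i < k + 1) => h.abs_le i (by omega))).2
      have h2 : avgMargin a k ≤ a 0 / 2 + 1 / 1000 * s := by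
        unfold avgMargin
        rw [div_le_iff₀ hk0, Finset.sum_range_succ']
        have h3 : ∑ i ∈ range k, a (i + 1) ≤ k * (1 / 1000 * s) := by
          refine (Finset.sum_le_sum fun i hi => (le_abs_self _).trans
            (h.rest_le (i + 1) (by omega) (by have := mem_range.1 hi; omega))).trans ?_
          rw [Finset.sum_const, card_range, nsmul_eq_mul]
        have := h.first_ge
        nlinarith
      have h3 : 4 * (1 / lam) * s ≤ 4 * (1 / 10 ^ 6) * s := by gcongr
      have := h.first_ge
      linarith
    have ha0 := h.first_ge
    have hfin : s / (50 * (k + 1)) ≤ sg (y * m) * (w * (a 0 - m)) := by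
      have e1 : 91 / 1000 * s ≤ a 0 - m := by linarith
      have e2 : 99 / (100 * ((k : ℝ) + 1)) * (91 / 1000 * s) ≤ w * (a 0 - m) :=
        mul_le_mul hw1 e1 (by positivity) (le_trans (by positivity) hw1)
      have e3 := mul_le_mul hsg e2 (by positivity) (le_trans (by norm_num) hsg)
      refine le_trans ?_ e3
      have : s / (50 * ((k : ℝ) + 1)) = s / (k + 1) * (1 / 50) := by field_simp
      rw [this]
      have : 49 / 100 * (99 / (100 * ((k : ℝ) + 1)) * (91 / 1000 * s))
          = s / (k + 1) * (49 / 100 * (99 / 100) * (91 / 1000)) := by field_simp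
      rw [this]
      exact mul_le_mul_of_nonneg_left (by norm_num) (by positivity)
    calc _ = s / (50 * ((k : ℝ) + 1)) := by ring
      _ ≤ _ := hfin
      _ = (y * y) * (sg (y * m) * (w * (a 0 - m))) := by rw [hysq, one_mul]
      _ = _ := by ring
  refine le_trans (le_of_eq ?_) (avg_mono hpt)
  rw [avg_const_mul, avg_first_last hk1]
  field_simp
  ring

/-- Flipping the first token reverses the label and leaves the second and the last token alone. The
remaining factor is almost independent of the sequence, so paired contributions cancel up to its
variation. -/
lemma abs_entryGrad_second_le (hd : 2 * n ≤ d) (hlam : 10 ^ 6 ≤ lam) (hs : s ≤ 1 / 10 ^ 4)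
    (h : EarlyState n a W s) {k : ℕ} (hk1 : 1 ≤ k) (hk : k < n) (b c : Bool) :
    |entryGrad lam W a k 1 b c| ≤ s / (400 * (k + 1)) := by
  have hl : 0 < lam := lt_of_lt_of_le (by norm_num) hlam
  have hs0 := (norm_nonneg W).trans h.norm_le
  have hω : 1 / lam ≤ 1 / 10 ^ 6 := one_div_le_one_div_of_le (by norm_num) hlam
  have hω4 : 1 / lam ≤ 1 / 4 := hω.trans (by norm_num)
  have hW1 : ‖W‖ ≤ 1 / lam * lam := by
    rw [one_div_mul_cancel hl.ne']
    exact h.norm_le.trans (hs.trans (by norm_num))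
  have hk0 : (0 : ℝ) < k + 1 := by positivity
  have h1k : 1 < k + 1 := by omega
  set G : (Fin (k + 1) → Bool) → ℝ := fun X => sg (label X * score lam W X a) *
    (attnWeight lam W X ⟨1, h1k⟩ * (a 1 - score lam W X a)) with hG
  set ind : (Fin (k + 1) → Bool) → ℝ := fun X => (if X ⟨1, h1k⟩ = b then (1 : ℝ) else 0) *
    if X (Fin.last k) = c then 1 else 0 with hind
  have hind_flip : ∀ X, ind (flip 0 X) = ind X := by
    intro X
    simp only [hind, flip]
    rw [Function.update_of_ne (last_ne_zero hk1), Function.update_of_ne]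
    intro h; have := congrArg Fin.val h; simp at this
  have hind1 : ∀ X, |ind X| ≤ 1 := by
    intro X
    simp only [hind]
    split_ifs <;> simp
  set g : ℝ := 1 / 2 * (1 / (k + 1) * (a 1 - avgMargin a k)) with hg
  have hGg : ∀ X, |G X - g| ≤ s / (400 * (k + 1)) := by
    intro X
    simp only [hG, hg]
    set m := score lam W X a with hm
    set w := attnWeight lam W X ⟨1, h1k⟩ with hw
    have hmα : |m| ≤ s := abs_score_le lam W X fun i hi => h.abs_le i (by omega)
    have hmm := abs_score_sub_le hd hk hl hW1 hω4 X
      fun i (hi : i < k + 1) => h.abs_le i (by omega)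
    rw [← hm] at hmm
    have hww := abs_attnWeight_sub_le hd hk hl hW1 hω4 X ⟨1, h1k⟩
    rw [← hw] at hww
    have ha1 := h.abs_le 1 (by omega)
    have ham : |a 1 - m| ≤ 2 * s := (abs_sub _ _).trans (by linarith)
    have hsg : |sg (label X * m) - 1 / 2| ≤ s := by
      have h1 := abs_sg_sub_le (label X * m) 0
      rw [sg_zero, sub_zero, abs_mul, abs_label, one_mul] at h1
      exact h1.trans hmα
    have hw0 : 0 < w := attnWeight_pos lam W X _
    have hw2 : w ≤ 2 / (k + 1) := by
      have h3 := (_root_.abs_le.1 hww).2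
      have h4 : 4 * (1 / lam) / ((k : ℝ) + 1) ≤ 1 / (k + 1) := by gcongr; linarith
      have h5 : (2 : ℝ) / (k + 1) = 1 / (k + 1) + 1 / (k + 1) := by ring
      linarith
    have e : sg (label X * m) * (w * (a 1 - m)) - 1 / 2 * (1 / (k + 1) * (a 1 - avgMargin a k))
        = (sg (label X * m) - 1 / 2) * (w * (a 1 - m)) + 1 / 2 * ((w - 1 / (k + 1)) * (a 1 - m))
          + 1 / 2 * (1 / (k + 1) * (avgMargin a k - m)) := by ring
    rw [e]
    have b1 : |(sg (label X * m) - 1 / 2) * (w * (a 1 - m))| ≤ s * (2 / (k + 1) * (2 * s)) := by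
      rw [abs_mul, abs_mul, abs_of_pos hw0]
      exact mul_le_mul hsg (mul_le_mul hw2 ham (abs_nonneg _) (by positivity)) (by positivity) hs0
    have b2 : |1 / 2 * ((w - 1 / (k + 1)) * (a 1 - m))|
        ≤ 1 / 2 * (4 * (1 / lam) / (k + 1) * (2 * s)) := by
      rw [abs_mul, abs_mul, abs_of_pos (by norm_num : (0 : ℝ) < 1 / 2)]
      gcongr
    have b3 : |1 / 2 * (1 / ((k : ℝ) + 1) * (avgMargin a k - m))|
        ≤ 1 / 2 * (1 / (k + 1) * (4 * (1 / lam) * s)) := by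
      rw [abs_mul, abs_mul, abs_of_pos (by norm_num : (0 : ℝ) < 1 / 2),
        abs_of_pos (by positivity : 0 < 1 / ((k : ℝ) + 1)), abs_sub_comm]
      gcongr
    have b4 : s * (2 / ((k : ℝ) + 1) * (2 * s)) + 1 / 2 * (4 * (1 / lam) / (k + 1) * (2 * s))
        + 1 / 2 * (1 / (k + 1) * (4 * (1 / lam) * s)) = s / (k + 1) * (4 * s + 6 * (1 / lam)) := by
      field_simp
      ring
    have b5 : s / (k + 1) * (4 * s + 6 * (1 / lam)) ≤ s / ((k : ℝ) + 1) * (1 / 400) :=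
      mul_le_mul_of_nonneg_left (by linarith) (by positivity)
    have b6 : s / (400 * ((k : ℝ) + 1)) = s / (k + 1) * (1 / 400) := by field_simp
    rw [b6]
    refine (abs_add_three _ _ _).trans ?_
    linarith
  have hF : entryGrad lam W a k 1 b c = avg fun X => label X * (G X * ind X) := by
    unfold entryGrad
    congr 1
    funext X
    rw [sum_attnWeight_ite h1k lam W X fun l => a l - score lam W X a]
    simp only [hG, hind]
    ring
  rw [hF, avg_eq_of_add_flip 0 (G := fun X => label X * ind X * (G X - g - (G (flip 0 X) - g)))]
  · have : |avg fun X => label X * ind X * (G X - g - (G (flip 0 X) - g))|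
        ≤ 2 * (s / (400 * (k + 1))) := by
      refine abs_avg_le fun X => ?_
      rw [abs_mul, abs_mul, abs_label, one_mul]
      have h1 := abs_sub (G X - g) (G (flip 0 X) - g)
      have h2 := hGg X
      have h3 := hGg (flip 0 X)
      calc _ ≤ 1 * (2 * (s / (400 * (k + 1)))) :=
            mul_le_mul (hind1 X) (by linarith) (abs_nonneg _) zero_le_one
        _ = _ := one_mul _
    rw [abs_mul, abs_of_pos (by norm_num : (0 : ℝ) < 1 / 2)]
    linarith
  · intro X
    rw [label_flip_zero hk1, hind_flip]
    ring

end entries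

/-- In the first phase the attention layer learns to look at the first token rather than at the
second one exactly if it agrees with the last token. -/
lemma attn_gap (hd : 2 * n ≤ d) (hn : 1 ≤ n) {lam η : ℝ} (hlam : 10 ^ 6 * (n : ℝ) ^ 2 ≤ lam)
    (hη : 0 < η) {t₀ : ℕ} (ht₀ : η * t₀ * n ≤ 1 / 10 ^ 4) {k : ℕ} (hk1 : 1 ≤ k) (hk : k < n)
    (b b' c : Bool) {t : ℕ} (ht : t ≤ t₀) :
    0 ≤ pairLabel b c * (form (gd d n lam η t₀ t).2 (embed d 0 b) (embed d k c)
        - form (gd d n lam η t₀ t).2 (embed d 1 b') (embed d k c)) ∧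
      (2 ≤ t → 0 < pairLabel b c * (form (gd d n lam η t₀ t).2 (embed d 0 b) (embed d k c)
        - form (gd d n lam η t₀ t).2 (embed d 1 b') (embed d k c))) := by
  have hn1 : (1 : ℝ) ≤ n := by exact_mod_cast hn
  have hlam1 : 10 ^ 6 ≤ lam := by nlinarith
  have hl : 0 < lam := lt_of_lt_of_le (by norm_num) hlam1
  induction t with
  | zero => simp [gd, form]
  | succ t ih =>
    have I := earlyState hd hn hlam hη ht₀ (by omega : t ≤ t₀)
    have h0 := (ih (by omega)).1
    have hs0 : 0 ≤ η * t := by positivity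
    have htt : (t : ℝ) ≤ t₀ := by exact_mod_cast (by omega : t ≤ t₀)
    have hs1 : η * t ≤ 1 / 10 ^ 4 := by
      refine le_trans (le_mul_of_one_le_right hs0 hn1) (le_trans ?_ ht₀)
      gcongr
    have h1 := entryGrad_first_ge hd hlam1 hs1 I hk1 hk b c
    have h2 := abs_entryGrad_second_le hd hlam1 hs1 I hk1 hk b' c
    rw [gd_snd_succ hd, if_pos (by omega), form_sub_smul, form_sub_smul,
      form_gradAttn hd lam _ _ (by omega) hk, form_gradAttn hd lam _ _ (by omega) hk]
    set W := (gd d n lam η t₀ t).2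
    set a := coords d n lam η t₀ t
    set E0 := entryGrad lam W a k 0 b c
    set E1 := entryGrad lam W a k 1 b' c
    have h3 : |pairLabel b c * E1| ≤ η * t / (400 * (k + 1)) := by
      rw [abs_mul, abs_pairLabel, one_mul]; exact h2
    have h4 := (_root_.abs_le.1 h3).2
    have e : pairLabel b c * (form W (embed d 0 b) (embed d k c) - η * lam * -(1 / lam * E0)
        - (form W (embed d 1 b') (embed d k c) - η * lam * -(1 / lam * E1)))
        = pairLabel b c * (form W (embed d 0 b) (embed d k c) - form W (embed d 1 b') (embed d k c))
          + η * (pairLabel b c * E0 - pairLabel b c * E1) := by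
      field_simp
      ring
    rw [e]
    have h5 : η * t / (400 * (k + 1)) ≤ pairLabel b c * E0 - pairLabel b c * E1 := by
      have : η * t / (200 * ((k : ℝ) + 1)) = η * t / (400 * (k + 1)) + η * t / (400 * (k + 1)) := by
        field_simp; ring
      linarith
    constructor
    · have : 0 ≤ η * (pairLabel b c * E0 - pairLabel b c * E1) :=
        mul_nonneg hη.le (le_trans (by positivity) h5)
      linarith
    -- The update from time `0` vanishes because the linear layer is zero there; the second update
    -- is the first to open a strict gap.
    · intro h2t
      have ht1 : (0 : ℝ) < t := by
        have : 0 < t := by omega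
        exact_mod_cast this
      have : 0 < η * (pairLabel b c * E0 - pairLabel b c * E1) :=
        mul_pos hη (lt_of_lt_of_le (by positivity) h5)
      linarith

/-! ### The max-margin separator and its direction. -/

lemma margin_symVec (hd : 2 * n ≤ d) (lam : ℝ) (W : Mat d) (a : ℕ → ℝ) {k : ℕ} (hk : k < n)
    (X : Fin (k + 1) → Bool) :
    inner ℝ (symVec d n a) (label X • attnOut lam W X) = label X * score lam W X a := by
  rw [real_inner_smul_right, ← transformer_symVec hd lam a W hk]
  rfl

lemma exists_hasUnitMargin (hd : 2 * n ≤ d) {lam : ℝ} (hl : 0 < lam) {W : Mat d}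
    (hgap : ∀ k, 1 ≤ k → k < n → ∀ b b' c, 0 < pairLabel b c *
      (form W (embed d 0 b) (embed d k c) - form W (embed d 1 b') (embed d k c))) :
    ∃ u, HasUnitMargin n lam W u := by
  -- The score of this vector is the attention on the first position minus that on the second, and
  -- `hgap` gives it the sign of the label.
  set e : ℕ → ℝ := fun l => if l = 0 then 1 else if l = 1 then -1 else 0 with he
  have hpos : ∀ k < n, ∀ X : Fin (k + 1) → Bool, 0 < label X * score lam W X e := by
    intro k hk X
    rcases Nat.eq_zero_or_pos k with h0 | h0
    · subst h0
      rw [label_of_single, score_of_single]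
      simp [he]
    · have hs : score lam W X e = attnWeight lam W X 0 - attnWeight lam W X ⟨1, by omega⟩ := by
        unfold score
        rw [Finset.sum_eq_add (0 : Fin (k + 1)) ⟨1, by omega⟩]
        · simp [he]; ring
        · intro h; have := congrArg Fin.val h; simp at this
        · rintro l - ⟨h1, h2⟩
          have h3 : (l : ℕ) ≠ 0 := fun h => h1 (Fin.ext h)
          have h4 : (l : ℕ) ≠ 1 := fun h => h2 (Fin.ext h)
          simp [he, h3, h4]
        · simp
        · simp
      have hg := hgap k h0 hk (X 0) (X ⟨1, by omega⟩) (X (Fin.last k))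
      have hy : label X = pairLabel (X 0) (X (Fin.last k)) := label_eq X
      rw [← hy] at hg
      rw [hs]
      unfold attnWeight softmax
      set Z := ∑ j : Fin (k + 1), Real.exp (form W (embed d j (X j)) (embed d k (X (Fin.last k))) / lam)
      have hZ : 0 < Z := Finset.sum_pos (fun _ _ => Real.exp_pos _) ⟨0, mem_univ _⟩
      rw [← sub_div, ← mul_div_assoc]
      refine div_pos ?_ hZ
      simp only [Fin.val_zero] at hg ⊢
      rcases label_sq X with h | h <;> rw [h] at hg ⊢
      · have : form W (embed d 1 (X ⟨1, by omega⟩)) (embed d k (X (Fin.last k))) / lam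
            < form W (embed d 0 (X 0)) (embed d k (X (Fin.last k))) / lam :=
          div_lt_div_of_pos_right (by linarith) hl
        have := Real.exp_lt_exp.2 this
        linarith
      · have : form W (embed d 0 (X 0)) (embed d k (X (Fin.last k))) / lam
            < form W (embed d 1 (X ⟨1, by omega⟩)) (embed d k (X (Fin.last k))) / lam :=
          div_lt_div_of_pos_right (by linarith) hl
        have := Real.exp_lt_exp.2 this
        linarith
  -- The sum of the reciprocals of all margins dominates each one, so scaling by it makes every
  -- margin at least `1`.
  set r : ℝ := ∑ k ∈ range n, ∑ X : Fin (k + 1) → Bool, if k < n then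
    1 / (label X * score lam W X e) else 0 with hr
  refine ⟨r • symVec d n e, fun k hk X => ?_⟩
  rw [real_inner_smul_left, margin_symVec hd lam W e hk, ← div_le_iff₀ (hpos k hk X), hr]
  have hnn : ∀ j ∈ range n, ∀ Y : Fin (j + 1) → Bool,
      0 ≤ if j < n then 1 / (label Y * score lam W Y e) else 0 := by
    intro j hj Y
    rw [if_pos (mem_range.1 hj)]
    exact (one_div_pos.2 (hpos j (mem_range.1 hj) Y)).le
  refine le_trans ?_ (Finset.single_le_sum
    (f := fun k => ∑ X : Fin (k + 1) → Bool, if k < n then 1 / (label X * score lam W X e) else 0)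
    (fun j hj => Finset.sum_nonneg fun Y _ => hnn j hj Y) (mem_range.2 hk))
  refine le_trans (le_of_eq ?_) (Finset.single_le_sum
    (f := fun X : Fin (k + 1) → Bool => if k < n then 1 / (label X * score lam W X e) else 0)
    (fun Y _ => hnn k (mem_range.2 hk) Y) (mem_univ X))
  simp [hk]

lemma exists_isMaxMargin {lam : ℝ} {W : Mat d} (h : ∃ u, HasUnitMargin n lam W u) :
    ∃ u, IsMaxMargin n lam W u := by
  have hclosed : IsClosed {u : Vec d | HasUnitMargin n lam W u} := by
    have : {u : Vec d | HasUnitMargin n lam W u} = ⋂ (k : ℕ) (_ : k < n) (X : Fin (k + 1) → Bool),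
        {u : Vec d | 1 ≤ inner ℝ u (label X • attnOut lam W X)} := by
      ext u; simp [HasUnitMargin]
    rw [this]
    refine isClosed_iInter fun k => isClosed_iInter fun _ => isClosed_iInter fun X => ?_
    exact isClosed_le continuous_const (continuous_id.inner continuous_const)
  obtain ⟨u, hu, hd⟩ := hclosed.exists_infDist_eq_dist h 0
  refine ⟨u, hu, fun v hv => ?_⟩
  have := Metric.infDist_le_dist_of_mem (s := {u : Vec d | HasUnitMargin n lam W u}) (x := 0) hv
  rw [hd] at this
  simpa using this

/-- Averaging over the exchange of letters preserves the margins and does not increase the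
norm, so a max-margin separator may be taken symmetric. -/
lemma exists_isMaxMargin_symVec (hd : 2 * n ≤ d) {lam : ℝ} {W : Mat d} (hW : SwapInv n W)
    (h : ∃ u, HasUnitMargin n lam W u) : ∃ b : ℕ → ℝ, IsMaxMargin n lam W (symVec d n b) := by
  obtain ⟨u, hu, hmin⟩ := exists_isMaxMargin h
  set b : ℕ → ℝ := fun l => (inner ℝ u (embed d l false) + inner ℝ u (embed d l true)) / 2 with hb
  have hnorm : ‖symVec d n b‖ ≤ ‖u‖ := by
    have h1 : inner ℝ u (symVec d n b) = ‖symVec d n b‖ ^ 2 := by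
      rw [norm_symVec_sq hd]
      unfold symVec
      rw [inner_sum, Finset.mul_sum]
      refine Finset.sum_congr rfl fun l _ => ?_
      rw [real_inner_smul_right, inner_add_right]
      simp only [hb]; ring
    have h2 := real_inner_le_norm u (symVec d n b)
    rw [h1] at h2
    rcases (norm_nonneg (symVec d n b)).eq_or_lt with h3 | h3
    · rw [← h3]; exact norm_nonneg u
    · nlinarith
  refine ⟨b, fun k hk X => ?_, fun v hv => hnorm.trans (hmin v hv)⟩
  have h1 := hu k hk X
  have h2 := hu k hk (swap X)
  rw [margin_symVec hd lam W b hk]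
  rw [real_inner_smul_right, inner_attnOut] at h1 h2
  rw [label_swap, hW.attnWeight_swap lam hk] at h2
  have h3 : score lam W X b = ((∑ l, attnWeight lam W X l * inner ℝ u (embed d l (X l)))
      + ∑ l : Fin (k + 1), attnWeight lam W X l * inner ℝ u (embed d l (swap X l))) / 2 := by
    unfold score
    rw [← Finset.sum_add_distrib, Finset.sum_div]
    refine Finset.sum_congr rfl fun l _ => ?_
    simp only [hb, swap]
    cases X l <;> simp <;> ring
  rw [h3]
  linarith

lemma norm_symVec_sq_eq (hd : 2 * n ≤ d) (hn : 2 ≤ n) (a : ℕ → ℝ) :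
    ‖symVec d n a‖ ^ 2 = along a ^ 2 + perpSq n a := by
  rw [norm_symVec_sq hd, range_eq_two_add hn]
  unfold along perpSq
  ring

lemma abs_coord_le_norm (hd : 2 * n ≤ d) (a : ℕ → ℝ) {l : ℕ} (hl : l < n) :
    |a l| ≤ ‖symVec d n a‖ := by
  apply abs_le_of_sq_le_sq _ (norm_nonneg _)
  rw [norm_symVec_sq hd]
  have := Finset.single_le_sum (f := fun l => a l ^ 2) (fun _ _ => sq_nonneg _) (mem_range.2 hl)
  nlinarith [sq_nonneg (a l)]

/-- Under almost uniform attention a separator is long and almost parallel to the separating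
direction. -/
lemma separator_direction (hd : 2 * n ≤ d) (hn : 2 ≤ n) {lam ω : ℝ} (hl : 0 < lam) {W : Mat d}
    (hW : ‖W‖ ≤ ω * lam) (hω : 192 * n ^ 3 * ω ^ 2 ≤ 1 / 4) (hω' : ω ≤ 1 / 32) {b : ℕ → ℝ}
    (hb : HasUnitMargin n lam W (symVec d n b)) :
    1 ≤ 4 * ω * ‖symVec d n b‖ ∧ 0 < along b ∧
      perpSq n b ≤ 192 * n ^ 3 * ω ^ 2 * ‖symVec d n b‖ ^ 2 := by
  set β := ‖symVec d n b‖ with hβ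
  have hβ0 : 0 ≤ β := norm_nonneg _
  have hω0 : 0 ≤ ω := by
    by_contra! h
    have := (norm_nonneg W).trans hW
    nlinarith
  have hn2 : (2 : ℝ) ≤ n := by exact_mod_cast hn
  -- `X` and `flip 0 X` need margins of opposite signs, yet both scores are within `4 * ω * β` of
  -- the same average.
  have hm : ∀ k, 1 ≤ k → k < n → |avgMargin b k| + 1 ≤ 4 * ω * β := by
    intro k hk1 hk
    have key : ∀ X : Fin (k + 1) → Bool, label X = 1 → |avgMargin b k| + 1 ≤ 4 * ω * β := by
      intro X hX
      have h1 := hb k hk X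
      have h2 := hb k hk (flip 0 X)
      rw [margin_symVec hd lam W b hk] at h1 h2
      rw [label_flip_zero hk1] at h2
      rw [hX] at h1 h2
      have e1 := abs_le.1 (abs_score_sub_le hd hk hl hW (by linarith) X
        fun i (hi : i < k + 1) => abs_coord_le_norm hd b (by omega : i < n))
      have e2 := abs_le.1 (abs_score_sub_le hd hk hl hW (by linarith) (flip 0 X)
        fun i (hi : i < k + 1) => abs_coord_le_norm hd b (by omega : i < n))
      rcases abs_cases (avgMargin b k) with ⟨h, _⟩ | ⟨h, _⟩ <;> rw [h] <;> linarith
    exact key (fun _ => false) (by rw [label_eq]; simp)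
  have h1 : 1 ≤ 4 * ω * β := by linarith [hm 1 le_rfl (by omega), abs_nonneg (avgMargin b 1)]
  have hS : ∀ k, 1 ≤ k → k < n → |∑ i ∈ range (k + 1), b i| ≤ n * (4 * ω * β) := by
    intro k hk1 hk
    have hk0 : (0 : ℝ) < k + 1 := by positivity
    have h2 := hm k hk1 hk
    have e : ∑ i ∈ range (k + 1), b i = (k + 1) * avgMargin b k := by
      unfold avgMargin; field_simp
    rw [e, abs_mul, abs_of_pos hk0]
    refine mul_le_mul ?_ (by linarith) (abs_nonneg _) (by positivity)
    exact_mod_cast hk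
  have hD : |b 0 + b 1| ≤ 8 * ω * β := by
    have h2 := hm 1 le_rfl (by omega)
    have e : avgMargin b 1 = (b 0 + b 1) / 2 := by
      unfold avgMargin; norm_num [Finset.sum_range_succ]
    rw [e, abs_div, abs_of_pos (by norm_num : (0 : ℝ) < 2)] at h2
    linarith
  -- Each such coordinate is the difference of two consecutive partial sums.
  have hcoord : ∀ l ∈ Ico 2 n, b l ^ 2 ≤ (n * (8 * ω * β)) ^ 2 := by
    intro l hl
    obtain ⟨hl2, hln⟩ := Finset.mem_Ico.1 hl
    have h2 := hS l (by omega) hln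
    have h3 := hS (l - 1) (by omega) (by omega)
    rw [Nat.sub_add_cancel (by omega)] at h3
    rw [Finset.sum_range_succ] at h2
    rw [← sq_abs]
    refine pow_le_pow_left₀ (abs_nonneg _) ?_ 2
    have e : b l = (∑ i ∈ range l, b i + b l) - ∑ i ∈ range l, b i := by ring
    rw [e]
    refine (abs_sub _ _).trans ?_
    linarith
  have hq : perpSq n b ≤ 192 * n ^ 3 * ω ^ 2 * β ^ 2 := by
    have h2 := Finset.sum_le_sum hcoord
    rw [Finset.sum_const, Nat.card_Ico, nsmul_eq_mul] at h2
    have h3 : ((n - 2 : ℕ) : ℝ) * (n * (8 * ω * β)) ^ 2 ≤ n * (n * (8 * ω * β)) ^ 2 := by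
      refine mul_le_mul_of_nonneg_right ?_ (sq_nonneg _)
      exact_mod_cast Nat.sub_le n 2
    have h4 : (b 0 + b 1) ^ 2 ≤ (8 * ω * β) ^ 2 := by
      rw [← sq_abs]; exact pow_le_pow_left₀ (abs_nonneg _) hD 2
    have h5 : (1 : ℝ) ≤ n ^ 3 := one_le_pow₀ (by linarith)
    have h6 : (8 * ω * β) ^ 2 ≤ n ^ 3 * (8 * ω * β) ^ 2 := le_mul_of_one_le_left (sq_nonneg _) h5
    unfold perpSq
    nlinarith
  refine ⟨h1, ?_, hq⟩
  have hβpos : 0 < β := by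
    rcases hβ0.eq_or_lt with h | h
    · rw [← h] at h1; norm_num at h1
    · exact h
  have h0 := hb 0 (by omega) fun _ => true
  rw [margin_symVec hd lam W b (by omega), label_of_single, score_of_single] at h0
  -- A nonpositive `along b` would be at most `-β / 2`, which contradicts `b 0 ≥ 1` together with
  -- `|b 0 + b 1| ≤ β / 4`.
  by_contra! hneg
  have hsq := norm_symVec_sq_eq hd hn b
  rw [← hβ] at hsq
  have h2 : 192 * n ^ 3 * ω ^ 2 * β ^ 2 ≤ 1 / 4 * β ^ 2 :=
    mul_le_mul_of_nonneg_right hω (sq_nonneg _)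
  have h3 : β / 2 ≤ -along b := by
    apply le_of_sq_le_sq _ (by linarith)
    nlinarith
  have h4 := (abs_le.1 hD).2
  have h5 : 8 * ω * β ≤ β / 4 := by nlinarith
  have h6 : along b = b 0 - b 1 := rfl
  linarith

/-- Cauchy–Schwarz in the orthogonal complement of the separating direction, where `perpSq` is the
squared norm. -/
lemma abs_inner_sub_along_le (hd : 2 * n ≤ d) (hn : 2 ≤ n) (a b : ℕ → ℝ) :
    |inner ℝ (symVec d n a) (symVec d n b) - along a * along b|
      ≤ Real.sqrt (perpSq n a) * Real.sqrt (perpSq n b) := by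
  rw [← Real.sqrt_mul (perpSq_nonneg n a), inner_symVec_symVec hd, range_eq_two_add hn]
  apply Real.abs_le_sqrt
  have e : 2 * (a 0 * b 0 + a 1 * b 1 + ∑ l ∈ Ico 2 n, a l * b l) - along a * along b
      = (a 0 + a 1) * (b 0 + b 1) + 2 * ∑ l ∈ Ico 2 n, a l * b l := by unfold along; ring
  rw [e]
  have h := Finset.sum_mul_sq_le_sq_mul_sq (Ico 2 n) a b
  unfold perpSq
  set A := ∑ l ∈ Ico 2 n, a l ^ 2
  set B := ∑ l ∈ Ico 2 n, b l ^ 2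
  set M := ∑ l ∈ Ico 2 n, a l * b l
  have hA : 0 ≤ A := Finset.sum_nonneg fun _ _ => sq_nonneg _
  have hB : 0 ≤ B := Finset.sum_nonneg fun _ _ => sq_nonneg _
  set x := a 0 + a 1
  set y := b 0 + b 1
  have h2 : x * y * M ≤ (x ^ 2 * B + y ^ 2 * A) / 2 := by
    have h3 : |x * y * M| ≤ Real.sqrt (x ^ 2 * B) * Real.sqrt (y ^ 2 * A) := by
      rw [← Real.sqrt_mul (by positivity)]
      apply Real.abs_le_sqrt
      nlinarith [mul_le_mul_of_nonneg_left h (by positivity : 0 ≤ x ^ 2 * y ^ 2)]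
    have h4 := Real.sq_sqrt (by positivity : 0 ≤ x ^ 2 * B)
    have h5 := Real.sq_sqrt (by positivity : 0 ≤ y ^ 2 * A)
    nlinarith [sq_nonneg (Real.sqrt (x ^ 2 * B) - Real.sqrt (y ^ 2 * A)), le_abs_self (x * y * M)]
  nlinarith

/-- Here `p / α` is the cosine of the angle to the separating direction, and `√(1 - x) ≥ 1 - x` for
`0 ≤ x ≤ 1`. -/
lemma along_lower {p q α : ℝ} (hp : 0 ≤ p) (hα : 0 < α) (h : α ^ 2 = p ^ 2 + q ^ 2) :
    α * (1 - (q / α) ^ 2) ≤ p := by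
  apply le_of_sq_le_sq _ hp
  have h1 : q ^ 2 = α ^ 2 * (q / α) ^ 2 := by field_simp
  set x := (q / α) ^ 2
  have hx0 : 0 ≤ x := sq_nonneg _
  have hx1 : x ≤ 1 := by
    by_contra! hx
    nlinarith [mul_pos (pow_pos hα 2) (sub_pos.2 hx), sq_nonneg p]
  have : p ^ 2 = α ^ 2 * (1 - x) := by linarith
  rw [this, mul_pow]
  exact mul_le_mul_of_nonneg_left (by nlinarith) (sq_nonneg α)

/-- If `x` and `x'` are the sines of the angles of the two vectors to the separating direction, the
cosine between them is at least `1 - x ^ 2 - x' ^ 2 - x * x'`. The hypotheses make both sines small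
multiples of `1 / ‖symVec d n a‖`. -/
lemma alignment (hd : 2 * n ≤ d) (hn : 2 ≤ n) {a b : ℕ → ℝ} (ha : 0 < along a) (hb : 0 < along b)
    (hqa : perpSq n a ≤ 1 / 16)
    (hqb : perpSq n b * (100 * ‖symVec d n a‖ ^ 2) ≤ ‖symVec d n b‖ ^ 2)
    (hab : ‖symVec d n a‖ ≤ 3 * ‖symVec d n b‖) :
    1 - 1 / 2 * (1 / (6 * ‖symVec d n b‖) - 1 / ‖symVec d n a‖) ^ 2 ≤
      inner ℝ (‖symVec d n a‖⁻¹ • symVec d n a) (‖symVec d n b‖⁻¹ • symVec d n b) := by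
  have hsa := norm_symVec_sq_eq hd hn a
  have hsb := norm_symVec_sq_eq hd hn b
  have hin := (abs_le.1 (abs_inner_sub_along_le hd hn a b)).1
  rw [real_inner_smul_left, real_inner_smul_right]
  set α := ‖symVec d n a‖ with hα
  set β := ‖symVec d n b‖ with hβ
  have hqa0 := perpSq_nonneg n a
  have hqb0 := perpSq_nonneg n b
  have hα0 : 0 < α := by
    refine (norm_nonneg _).lt_of_ne fun h => ?_
    rw [← hα] at h; rw [← h] at hsa; nlinarith
  have hβ0 : 0 < β := by
    refine (norm_nonneg _).lt_of_ne fun h => ?_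
    rw [← hβ] at h; rw [← h] at hsb; nlinarith
  set q := Real.sqrt (perpSq n a) with hq
  set q' := Real.sqrt (perpSq n b) with hq'
  have hqq : q ^ 2 = perpSq n a := Real.sq_sqrt hqa0
  have hqq' : q' ^ 2 = perpSq n b := Real.sq_sqrt hqb0
  have hq0 : 0 ≤ q := Real.sqrt_nonneg _
  have hq0' : 0 ≤ q' := Real.sqrt_nonneg _
  rw [← hqq] at hsa hqa
  rw [← hqq'] at hsb hqb
  have l1 := along_lower ha.le hα0 hsa
  have l2 := along_lower hb.le hβ0 hsb
  set x := q / α with hx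
  set x' := q' / β with hx'
  have hx0 : 0 ≤ x := by positivity
  have hx0' : 0 ≤ x' := by positivity
  have hxa : x * α ≤ 1 / 4 := by
    have : x * α = q := by rw [hx]; field_simp
    rw [this]
    exact le_of_sq_le_sq (by linarith) (by norm_num)
  have hxa' : x' * α ≤ 1 / 10 := by
    apply le_of_sq_le_sq _ (by norm_num)
    have : q' = x' * β := by rw [hx']; field_simp
    rw [this] at hqb
    have h2 : (x' * α) ^ 2 * 100 * β ^ 2 ≤ 1 * β ^ 2 := by
      rw [one_mul]
      refine le_trans (le_of_eq ?_) hqb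
      ring
    have := le_of_mul_le_mul_right h2 (by positivity)
    linarith
  have hx1 : x ^ 2 ≤ 1 := by
    have h1 : α ^ 2 * x ^ 2 ≤ α ^ 2 * 1 := by
      have : q = α * x := by rw [hx]; field_simp
      rw [this] at hsa
      nlinarith [sq_nonneg (along a)]
    exact le_of_mul_le_mul_left h1 (by positivity)
  have hx1' : x' ^ 2 ≤ 1 := by
    have h1 : β ^ 2 * x' ^ 2 ≤ β ^ 2 * 1 := by
      have : q' = β * x' := by rw [hx']; field_simp
      rw [this] at hsb
      nlinarith [sq_nonneg (along b)]
    exact le_of_mul_le_mul_left h1 (by positivity)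
  set I : ℝ := inner ℝ (symVec d n a) (symVec d n b) with hI
  have hlow : α * β * (1 - x ^ 2 - x' ^ 2 - x * x') ≤ I := by
    have h1 : α * (1 - x ^ 2) * (β * (1 - x' ^ 2)) ≤ along a * along b :=
      mul_le_mul l1 l2 (mul_nonneg hβ0.le (by linarith)) ha.le
    have h2 : q * q' = α * β * (x * x') := by
      rw [hx, hx']; field_simp
    have h3 : 0 ≤ α * β * (x ^ 2 * x' ^ 2) := by positivity
    nlinarith
  have hfin : 1 - x ^ 2 - x' ^ 2 - x * x' ≤ α⁻¹ * (β⁻¹ * I) := by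
    have h4 : α⁻¹ * (β⁻¹ * I) = I / (α * β) := by field_simp
    rw [h4, le_div_iff₀ (by positivity)]
    linarith
  refine le_trans ?_ hfin
  have h5 : 1 / (6 * β) ≤ 1 / (2 * α) := one_div_le_one_div_of_le (by positivity) (by linarith)
  have h6 : 1 / (2 * α) = 1 / 2 * (1 / α) := by field_simp
  set z := 1 / α with hz
  have hz0 : 0 < z := by positivity
  have hxz : x ≤ 1 / 4 * z := by
    rw [hz, mul_one_div, le_div_iff₀ hα0]; exact hxa
  have hxz' : x' ≤ 1 / 10 * z := by
    rw [hz, mul_one_div, le_div_iff₀ hα0]; exact hxa'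
  have h7 : 1 / 2 * z ≤ z - 1 / (6 * β) := by linarith
  have h8 : (1 / 2 * z) ^ 2 ≤ (1 / (6 * β) - z) ^ 2 := by
    rw [← neg_sq (1 / (6 * β) - z), neg_sub]
    exact pow_le_pow_left₀ (by positivity) h7 2
  have h9 : x ^ 2 ≤ (1 / 4 * z) ^ 2 := pow_le_pow_left₀ hx0 hxz 2
  have h10 : x' ^ 2 ≤ (1 / 10 * z) ^ 2 := pow_le_pow_left₀ hx0' hxz' 2
  have h11 : x * x' ≤ 1 / 4 * z * (1 / 10 * z) := mul_le_mul hxz hxz' hx0' (by positivity)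
  -- The comparison is `1 / 16 + 1 / 100 + 1 / 40 ≤ 1 / 8`, in units of `z ^ 2`.
  linarith [sq_nonneg z]

/-! ### Scales in the temperature and control of the attention layer. -/

/-- With `r = lam ^ (1 / 12)` all powers in the budget become integral: `lam = r ^ 12`, the horizon
is governed by `r ^ 8`, and `n ≤ r ^ 6`. One spare power of `r` then beats every logarithm. -/
lemma exists_scale (C : ℝ) (hC : 1 ≤ C) : ∃ Λ : ℝ, 10 ^ 6 ≤ Λ ∧ ∀ lam, Λ ≤ lam →
    ∃ r : ℝ, r ^ 12 = lam ∧ r ^ 8 = lam ^ (2 / 3 : ℝ) ∧ C * (Real.log (31 * lam) + 11) ≤ r := by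
  refine ⟨max (10 ^ 6) ((66 * C) ^ (24 : ℝ)), le_max_left _ _, fun lam hlam => ?_⟩
  have h0 : (0 : ℝ) < lam := lt_of_lt_of_le (by norm_num) ((le_max_left _ _).trans hlam)
  have h1 : (66 * C) ^ (24 : ℝ) ≤ lam := (le_max_right _ _).trans hlam
  refine ⟨lam ^ (1 / 12 : ℝ), ?_, ?_, ?_⟩
  · rw [← Real.rpow_mul_natCast h0.le]; norm_num
  · rw [← Real.rpow_mul_natCast h0.le]; norm_num
  · set q := lam ^ (1 / 24 : ℝ) with hq
    have hqC : 66 * C ≤ q := by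
      have := Real.rpow_le_rpow (by positivity) h1 (by norm_num : (0 : ℝ) ≤ 1 / 24)
      rwa [← Real.rpow_mul (by positivity), show (24 : ℝ) * (1 / 24) = 1 by norm_num,
        Real.rpow_one] at this
    have hq2 : lam ^ (1 / 12 : ℝ) = q ^ 2 := by
      rw [hq, ← Real.rpow_mul_natCast h0.le]; norm_num
    have hlog : Real.log lam ≤ 24 * q := by
      have := Real.log_le_rpow_div h0.le (by norm_num : (0 : ℝ) < 1 / 24)
      rw [← hq] at this
      linarith
    have h31 : Real.log 31 ≤ 31 := (Real.log_le_sub_one_of_pos (by norm_num)).trans (by norm_num)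
    rw [Real.log_mul (by norm_num) h0.ne', hq2]
    have : Real.log 31 + Real.log lam + 11 ≤ 66 * q := by linarith
    nlinarith

/-- Since `log (η * t) ≥ 1`, the splitting `log t = log (η * t) + log (1 / η)` is at most `(1 + log
(1 / η)) * log (η * t)`. -/
lemma log_ratio_bound {η t R c : ℝ} (hη : 0 < η) (hη1 : η ≤ 1) (ht : Real.exp 1 ≤ η * t)
    (hc : 0 ≤ c) (h : c * Real.log (η * t) ≤ R) :
    c / (1 + Real.log (1 / η)) * Real.log t ≤ R := by
  have h1 : 1 ≤ Real.log (η * t) := by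
    have := Real.log_le_log (Real.exp_pos 1) ht
    rwa [Real.log_exp] at this
  have h0 : 0 < η * t := (Real.exp_pos 1).trans_le ht
  have ht0 : 0 < t := pos_of_mul_pos_right h0 hη.le
  have h2 : 0 ≤ Real.log (1 / η) := Real.log_nonneg (by rw [le_div_iff₀ hη]; linarith)
  have h3 : Real.log t = Real.log (η * t) + Real.log (1 / η) := by
    rw [← Real.log_mul h0.ne' (by positivity)]
    congr 1; field_simp
  have h4 : Real.log t ≤ (1 + Real.log (1 / η)) * Real.log (η * t) := by
    rw [h3]; nlinarith
  refine le_trans ?_ h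
  rw [div_mul_eq_mul_div, div_le_iff₀ (by linarith)]
  have := mul_le_mul_of_nonneg_left h4 hc
  linarith

/-- Drift of the attention layer after the first phase. -/
lemma norm_attn_sub_le (hd : 2 * n ≤ d) (hn : 1 ≤ n) {lam η X : ℝ}
    (hlam : 10 ^ 6 * (n : ℝ) ^ 2 ≤ lam) (hη : 0 < η) (hη1 : η ≤ 1) {t₀ : ℕ}
    (ht₀ : η * t₀ * n ≤ 1 / 10 ^ 4) (j : ℕ)
    (ha : ∀ s < t₀ + 1 + j, ∀ l < n, |coords d n lam η t₀ s l| ≤ X) :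
    ‖(gd d n lam η t₀ (t₀ + 1 + j)).2 - (gd d n lam η t₀ t₀).2‖
      ≤ 1 / 1000 + j * (η * (n * (2 * X) / lam)) := by
  have hn1 : (1 : ℝ) ≤ n := by exact_mod_cast hn
  have hl : 0 < lam := lt_of_lt_of_le (by positivity) hlam
  induction j with
  -- The step at time `t₀` itself still has the large size `η * lam`; it accounts for the `1 /
  -- 1000`.
  | zero =>
    have I := earlyState hd hn hlam hη ht₀ le_rfl
    have h1 := norm_gd_snd_succ_sub_le hd hl hη.le t₀ t₀ I.abs_le
    rw [if_pos le_rfl] at h1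
    have h2 : η * lam * (n * (2 * (η * t₀)) / lam) = 2 * (η * (η * t₀ * n)) := by field_simp
    rw [h2] at h1
    have h3 : η * (η * t₀ * n) ≤ 1 * (1 / 10 ^ 4) :=
      mul_le_mul hη1 ht₀ (by positivity) zero_le_one
    simp only [add_zero]
    push_cast
    linarith
  | succ j ih =>
    have h1 := ih fun s hs => ha s (by omega)
    have h2 := norm_gd_snd_succ_sub_le hd hl hη.le t₀ (t₀ + 1 + j) (ha (t₀ + 1 + j) (by omega))
    rw [if_neg (by omega), mul_one] at h2
    have h3 := norm_add_le ((gd d n lam η t₀ (t₀ + 1 + j + 1)).2 - (gd d n lam η t₀ (t₀ + 1 + j)).2)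
      ((gd d n lam η t₀ (t₀ + 1 + j)).2 - (gd d n lam η t₀ t₀).2)
    rw [sub_add_sub_cancel] at h3
    rw [← add_assoc]
    push_cast
    linarith

lemma attn_bounds (hd : 2 * n ≤ d) (hn : 1 ≤ n) {lam η X : ℝ}
    (hlam : 10 ^ 6 * (n : ℝ) ^ 2 ≤ lam) (hη : 0 < η) (hη1 : η ≤ 1) {t₀ : ℕ}
    (ht₀ : η * t₀ * n ≤ 1 / 10 ^ 4) {t : ℕ}
    (hbud : t * (η * (n * (2 * X) / lam)) ≤ 1 / 2)
    (ha : ∀ s ≤ t, ∀ l < n, |coords d n lam η t₀ s l| ≤ X) :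
    ‖(gd d n lam η t₀ t).2‖ ≤ 2 ∧
      (t₀ ≤ t → ‖(gd d n lam η t₀ t).2 - (gd d n lam η t₀ t₀).2‖ ≤ 1) := by
  have hn1 : (1 : ℝ) ≤ n := by exact_mod_cast hn
  have hl : 0 < lam := lt_of_lt_of_le (by positivity) hlam
  have hX : 0 ≤ X := (abs_nonneg _).trans (ha 0 (Nat.zero_le _) 0 hn)
  have hearly : ∀ s ≤ t₀, ‖(gd d n lam η t₀ s).2‖ ≤ 1 := by
    intro s hs
    refine (earlyState hd hn hlam hη ht₀ hs).norm_le.trans ?_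
    have h1 : (s : ℝ) ≤ t₀ := by exact_mod_cast hs
    have h2 : η * s ≤ η * t₀ * n := by
      have : η * s ≤ η * t₀ := by gcongr
      exact this.trans (le_mul_of_one_le_right (by positivity) hn1)
    linarith
  have hlate : t₀ ≤ t → ‖(gd d n lam η t₀ t).2 - (gd d n lam η t₀ t₀).2‖ ≤ 1 := by
    intro h
    rcases h.eq_or_lt with h | h
    · rw [h]; simp
    · obtain ⟨j, rfl⟩ := Nat.exists_eq_add_of_le (show t₀ + 1 ≤ t from h)
      refine (norm_attn_sub_le hd hn hlam hη hη1 ht₀ j fun s hs => ha s hs.le).trans ?_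
      have h1 : (j : ℝ) * (η * (n * (2 * X) / lam))
          ≤ ((t₀ + 1 + j : ℕ) : ℝ) * (η * (n * (2 * X) / lam)) := by
        refine mul_le_mul_of_nonneg_right ?_ (by positivity)
        exact_mod_cast Nat.le_add_left j (t₀ + 1)
      linarith
  refine ⟨?_, hlate⟩
  rcases le_total t t₀ with h | h
  · linarith [hearly t h]
  · have h1 := norm_le_norm_add_norm_sub' (gd d n lam η t₀ t).2 (gd d n lam η t₀ t₀).2
    linarith [hearly t₀ le_rfl, hlate h]

/-! ### The degenerate case of sequences of length one. -/

section single

/-- With sequences of length one only, the attention layer does not move. -/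
lemma gd_snd_of_single (hd : 2 * 1 ≤ d) (lam η : ℝ) (t₀ t : ℕ) : (gd d 1 lam η t₀ t).2 = 0 := by
  induction t with
  | zero => simp [gd]
  | succ t ih =>
    rw [gd_snd_succ hd, ih]
    have : gradAttn 1 lam (symVec d 1 (coords d 1 lam η t₀ t)) (0 : Mat d) = 0 := by
      unfold gradAttn
      rw [Finset.sum_range_one, Finset.sum_eq_zero]
      · simp
      · intro X _
        unfold gradScore
        rw [Finset.sum_eq_zero]
        · simp
        · intro l _
          rw [transformer_symVec hd lam _ _ (by norm_num), score_of_single,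
            inner_symVec_embed hd _ (by omega)]
          have : (l : ℕ) = 0 := by omega
          rw [this]; simp
    rw [this]; simp

lemma coords_single_succ (lam η : ℝ) (t₀ t : ℕ) : coords d 1 lam η t₀ (t + 1) 0
    = coords d 1 lam η t₀ t 0 + η * (sg (coords d 1 lam η t₀ t 0) / 2) := by
  have : stepDir 1 lam (gd d 1 lam η t₀ t).2 (coords d 1 lam η t₀ t) 0
      = sg (coords d 1 lam η t₀ t 0) / 2 := by
    unfold stepDir
    rw [Finset.sum_range_one, avg_single, if_pos rfl]
    ring
  rw [← this]
  rfl

lemma coords_single_ge (lam : ℝ) {η : ℝ} (hη : 0 ≤ η) (t₀ t : ℕ) :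
    0 ≤ coords d 1 lam η t₀ t 0 ∧ 1 + η * t / 4 ≤ Real.exp (coords d 1 lam η t₀ t 0) := by
  induction t with
  | zero => simp [coords]
  | succ t ih =>
    obtain ⟨h0, h1⟩ := ih
    rw [coords_single_succ]
    set x := coords d 1 lam η t₀ t 0
    have hs := sg_pos x
    constructor
    · positivity
    · rw [Real.exp_add]
      have h2 := Real.add_one_le_exp (η * (sg x / 2))
      -- For `x ≥ 0` this makes `exp x` grow by at least `η / 4` per step.
      have h3 : 1 / 2 ≤ Real.exp x * sg x := by
        have := Real.one_le_exp h0
        unfold sg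
        rw [mul_one_div, div_le_div_iff₀ (by norm_num) (by positivity)]
        linarith
      have h4 := mul_le_mul_of_nonneg_left h2 (Real.exp_pos x).le
      have h5 := mul_le_mul_of_nonneg_left h3 hη
      push_cast
      linarith

lemma isMaxMargin_single (hd : 2 * 1 ≤ d) (lam : ℝ) (W : Mat d) :
    IsMaxMargin 1 lam W (symVec d 1 fun _ => 1) := by
  constructor
  · intro k hk X
    obtain rfl : k = 0 := by omega
    rw [margin_symVec hd lam W _ hk, label_of_single, score_of_single]
    norm_num
  · intro v hv
    have h : ∀ b, 1 ≤ inner ℝ v (embed d 0 b) := by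
      intro b
      have := hv 0 one_pos fun _ => b
      rw [label_of_single, one_smul, inner_attnOut] at this
      simpa [attnWeight_of_single] using this
    have h1 : inner ℝ v (symVec d 1 fun _ => 1)
        = inner ℝ v (embed d 0 false) + inner ℝ v (embed d 0 true) := by
      unfold symVec
      rw [Finset.sum_range_one, one_smul, inner_add_right]
    have h2 := norm_symVec_sq hd fun _ => 1
    rw [Finset.sum_range_one] at h2
    have h3 := real_inner_le_norm v (symVec d 1 fun _ => 1)
    have h4 := h false
    have h5 := h true
    have h6 : 0 < ‖symVec d 1 fun _ => 1‖ := by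
      refine (norm_nonneg _).lt_of_ne fun h => ?_
      rw [← h] at h2; norm_num at h2
    nlinarith

lemma single_case (hd : 2 * 1 ≤ d) (lam : ℝ) {η : ℝ} (hη : 0 < η) (t₀ : ℕ) {t : ℕ}
    (ht : Real.exp 1 ≤ η * t) :
    1 / 2 * Real.log (η * t) ≤ ‖(gd d 1 lam η t₀ t).1‖ ∧
    1 - 1 / 2 * (1 / (6 * ‖symVec d 1 fun _ => 1‖) - 1 / ‖(gd d 1 lam η t₀ t).1‖) ^ 2 ≤
      inner ℝ (‖(gd d 1 lam η t₀ t).1‖⁻¹ • (gd d 1 lam η t₀ t).1)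
        (‖symVec d 1 fun _ => 1‖⁻¹ • symVec d 1 fun _ => 1) ∧
    ‖(gd d 1 lam η t₀ t).2 - (gd d 1 lam η t₀ t₀).2‖ ≤ 1 := by
  obtain ⟨h0, h1⟩ := coords_single_ge (d := d) lam hη.le t₀ t
  have hη0 : 0 < η * t := (Real.exp_pos 1).trans_le ht
  rw [gd_fst hd]
  set a := coords d 1 lam η t₀ t with ha
  have hpos : 0 < a 0 := by
    rcases h0.eq_or_lt with h | h
    · rw [← h, Real.exp_zero] at h1; linarith
    · exact h
  refine ⟨?_, ?_, ?_⟩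
  · refine le_trans ?_ ((le_abs_self _).trans (abs_coord_le_norm hd a one_pos))
    have h2 : η * t ≤ Real.exp (2 * a 0) := by
      have e : Real.exp (2 * a 0) = Real.exp (a 0) ^ 2 := by rw [← Real.exp_nat_mul]; norm_num
      rw [e]
      have := pow_le_pow_left₀ (by positivity) h1 2
      nlinarith [sq_nonneg (η * t / 4 - 1)]
    have := (Real.log_le_iff_le_exp hη0).2 h2
    linarith
  · have he : symVec d 1 a = a 0 • symVec d 1 fun _ => 1 := by
      unfold symVec; simp
    set e := symVec d 1 fun _ => (1 : ℝ) with hedef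
    have hn : ‖symVec d 1 a‖ = a 0 * ‖e‖ := by
      rw [he, norm_smul, Real.norm_of_nonneg hpos.le]
    have he0 : 0 < ‖e‖ := by
      refine (norm_nonneg _).lt_of_ne fun h => ?_
      have h2 := norm_symVec_sq hd fun _ => 1
      rw [Finset.sum_range_one, ← hedef, ← h] at h2; norm_num at h2
    have h3 : inner ℝ (‖symVec d 1 a‖⁻¹ • symVec d 1 a) (‖e‖⁻¹ • e) = (1 : ℝ) := by
      rw [hn, he, real_inner_smul_left, real_inner_smul_right, real_inner_smul_left,
        real_inner_self_eq_norm_sq]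
      field_simp
    rw [h3]
    linarith [sq_nonneg (1 / (6 * ‖e‖) - 1 / ‖symVec d 1 a‖)]
  · rw [gd_snd_of_single hd, gd_snd_of_single hd]; simp

end single

/-! ### Assembly of the estimates. -/

/-- The constants of `exists_flow_constants`. -/
def FlowConstants (K δ : ℝ) : Prop :=
  ∀ (n N : ℕ) (a h : ℕ → ℕ → ℝ) (η ε G X : ℝ), PerturbedFlow n a h η ε G X N →
      N * (200 * (η * ε + η ^ 2 * G)) ≤ δ → ∀ t ≤ N, K ≤ η * t →
        perpSq n (a t) ≤ 1 / 16 ∧ Real.log (η * t) ≤ along (a t)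

lemma mul_scale_le {q r X α β P : ℝ} (hr : 1 ≤ r) (hX : 10 ^ 4 * X ≤ r)
    (hα : α ^ 2 ≤ 5 * X ^ 2 ∧ 0 ≤ X) (hqr : q * r ^ 6 ≤ 1 ∧ 0 ≤ q)
    (hP : P ≤ 192 * q * β ^ 2) : P * (100 * α ^ 2) ≤ β ^ 2 := by
  obtain ⟨hα, hX0⟩ := hα
  obtain ⟨hqr, hq⟩ := hqr
  have h3 : (10 ^ 4 * X) ^ 2 ≤ r ^ 2 := pow_le_pow_left₀ (by positivity) hX 2
  have h4 : r ^ 2 ≤ r ^ 6 := pow_le_pow_right₀ hr (by norm_num)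
  rw [mul_pow] at h3
  have h5 : 192 * (100 * α ^ 2) ≤ r ^ 6 := by linarith [sq_nonneg X]
  calc P * (100 * α ^ 2) ≤ 192 * q * β ^ 2 * (100 * α ^ 2) := by gcongr
    _ = q * (192 * (100 * α ^ 2)) * β ^ 2 := by ring
    _ ≤ q * r ^ 6 * β ^ 2 := by gcongr
    _ ≤ 1 * β ^ 2 := by gcongr
    _ = β ^ 2 := one_mul _

lemma le_of_scale {r X α β : ℝ} (hr : 1 ≤ r) (hX : 10 ^ 4 * X ≤ r)
    (hα : α ^ 2 ≤ 5 * X ^ 2 ∧ 0 ≤ X) (hβ : 1 ≤ 4 * (1 / r ^ 12) * β) : α ≤ 3 * β := by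
  obtain ⟨hα, hX0⟩ := hα
  have h1 : α ≤ 3 * X := by
    apply le_of_sq_le_sq _ (by positivity)
    rw [mul_pow]
    linarith [sq_nonneg X]
  have hr0 : 0 < r ^ 12 := by positivity
  have h2 : r ^ 12 ≤ 4 * β := by
    have : 4 * (1 / r ^ 12) * β = 4 * β / r ^ 12 := by ring
    rw [this, le_div_iff₀ hr0] at hβ
    linarith
  have h3 : r ≤ r ^ 12 := le_self_pow₀ hr (by norm_num)
  linarith

-- The flow estimate applies once the a priori bound `X` on the coordinates is shown to keep the
-- attention layer bounded, hence almost uniform, up to the horizon. `attn_bounds` gives this inside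
-- the bootstrap.
set_option maxHeartbeats 1000000 in
lemma multi_case {K δ C r : ℝ} (hK : FlowConstants K δ) (hKe : Real.exp 1 ≤ K) (hδ : 0 < δ)
    (hδ1 : δ ≤ 1) (hC : 10 ^ 4 / δ ≤ C) (hd : 2 * n ≤ d) (hn : 2 ≤ n) {lam η : ℝ}
    (hlam : 10 ^ 6 * (n : ℝ) ^ 2 ≤ lam) (hr : r ^ 12 = lam)
    (hX : C * (Real.log (31 * lam) + 11) ≤ r) (hη : 0 < η) (hη1 : η ≤ 1)
    (hηr : η * r ^ 8 ≤ δ / 3200) {t₀ : ℕ} (h2t : 2 ≤ t₀) (ht₀ : η * t₀ * n ≤ 1 / 10 ^ 4) {N : ℕ}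
    (hN : η * N * n ≤ r ^ 8) :
    ∃ uEP, IsMaxMargin n lam (gd d n lam η t₀ t₀).2 uEP ∧ ∀ t ≤ N, t₀ ≤ t → K ≤ η * t →
      1 / 2 * Real.log (η * t) ≤ ‖(gd d n lam η t₀ t).1‖ ∧
      1 - 1 / 2 * (1 / (6 * ‖uEP‖) - 1 / ‖(gd d n lam η t₀ t).1‖) ^ 2 ≤
        inner ℝ (‖(gd d n lam η t₀ t).1‖⁻¹ • (gd d n lam η t₀ t).1) (‖uEP‖⁻¹ • uEP) ∧
      ‖(gd d n lam η t₀ t).2 - (gd d n lam η t₀ t₀).2‖ ≤ 1 := by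
  have hn1 : (1 : ℝ) ≤ n := by exact_mod_cast (by omega : 1 ≤ n)
  have hn0 : (0 : ℝ) < n := by linarith
  have hl : 0 < lam := lt_of_lt_of_le (by positivity) hlam
  have hl6 : 10 ^ 6 ≤ lam := by nlinarith
  set X := Real.log (31 * lam) + 10 with hXdef
  have hX10 : 10 ≤ X := by
    have : 0 ≤ Real.log (31 * lam) := Real.log_nonneg (by linarith)
    linarith
  have hXr : C * (1 + X) ≤ r := by rw [hXdef]; linarith
  have hC4 : 10 ^ 4 ≤ C := by
    refine le_trans ?_ hC
    rw [le_div_iff₀ hδ]; linarith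
  have hCδ : 10 ^ 4 ≤ C * δ := by rwa [div_le_iff₀ hδ] at hC
  have hrX : 10 ^ 4 * (1 + X) ≤ r := le_trans (by gcongr) hXr
  have hr4 : 10 ^ 5 ≤ r := by linarith
  have hX0 : 0 ≤ X := by linarith
  have hrX' : 10 ^ 4 * X ≤ r := by linarith
  have hr0 : 0 < r := by linarith
  have hnr : (n : ℝ) ≤ r ^ 6 := by
    apply le_of_sq_le_sq _ (by positivity)
    rw [← pow_mul, hr]
    nlinarith [sq_nonneg (n : ℝ)]
  have hsn : Real.sqrt n ≤ r ^ 3 := by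
    apply Real.sqrt_le_iff.2 ⟨by positivity, _⟩
    rw [← pow_mul]; exact hnr
  have hηN : η * N ≤ r ^ 8 := by
    refine le_trans (le_mul_of_one_le_right (by positivity) hn1) hN
  have hr1 : 1 ≤ r := by linarith
  have hbud : ∀ t ≤ N, (t : ℝ) * (η * (n * (2 * X) / lam)) ≤ 1 / 2 := by
    intro t ht
    have htN : (t : ℝ) ≤ N := by exact_mod_cast ht
    have e : (t : ℝ) * (η * (n * (2 * X) / lam)) = (η * t * n) * (2 * X) / lam := by ring
    rw [e, div_le_iff₀ hl, ← hr]
    have h1 : η * t * n ≤ r ^ 8 := le_trans (by gcongr) hN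
    have h2 : 2 * X ≤ 1 / 2 * r ^ 4 := by
      have : r ≤ r ^ 4 := le_self_pow₀ hr1 (by norm_num)
      linarith
    calc η * t * n * (2 * X) ≤ r ^ 8 * (1 / 2 * r ^ 4) :=
          mul_le_mul h1 h2 (by linarith) (by positivity)
      _ = 1 / 2 * r ^ 12 := by ring
  set a := coords d n lam η t₀ with ha
  set ε := 2 * n * Real.sqrt n * (2 / lam) * (1 + X) with hε
  have hε0 : 0 ≤ ε := by positivity
  -- The attention error is of order `r ^ 8 * √n * (1 + X) / r ^ 12`, where `√n ≤ r ^ 3` leaves `(1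
  -- + X) / r`; the discretization error is `800 * (η * N * n) * η`, at most `800 * δ / 3200`.
  have hδbud : N * (200 * (η * ε + η ^ 2 * (4 * n))) ≤ δ := by
    have e : N * (200 * (η * ε + η ^ 2 * (4 * n)))
        = 800 * ((η * N * n) * (Real.sqrt n * (1 + X)) / lam) + 800 * ((η * N * n) * η) := by
      rw [hε]; ring
    rw [e]
    have h1 : (η * N * n) * (Real.sqrt n * (1 + X)) / lam ≤ δ / 10 ^ 4 := by
      rw [div_le_iff₀ hl, ← hr]
      have h2 : 1 + X ≤ δ / 10 ^ 4 * r := by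
        rw [div_mul_eq_mul_div, le_div_iff₀ (by norm_num)]
        have := mul_le_mul_of_nonneg_left hXr hδ.le
        nlinarith
      calc η * N * n * (Real.sqrt n * (1 + X)) ≤ r ^ 8 * (r ^ 3 * (δ / 10 ^ 4 * r)) :=
            mul_le_mul hN (mul_le_mul hsn h2 (by linarith) (by positivity)) (by positivity)
              (by positivity)
        _ = δ / 10 ^ 4 * r ^ 12 := by ring
    have h3 : (η * N * n) * η ≤ δ / 3200 := by
      refine le_trans (mul_le_mul_of_nonneg_right hN hη.le) ?_
      linarith
    linarith
  have F : PerturbedFlow n a (fun t => stepDir n lam (gd d n lam η t₀ t).2 (a t)) η ε (4 * n) X N := by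
    refine ⟨hn, hη, hη1, hε0, by positivity, rfl, fun t => rfl, ?_, hδbud.trans hδ1, ?_⟩
    · intro t ht hb
      have hW := (attn_bounds hd (by omega) hlam hη hη1 ht₀ (hbud t ht.le) hb).1
      have hW' : ‖(gd d n lam η t₀ t).2‖ ≤ 2 / lam * lam := by
        rw [div_mul_cancel₀ _ hl.ne']; exact hW
      have hω : 2 / lam ≤ 1 / 4 := by
        rw [div_le_div_iff₀ hl (by norm_num)]; linarith
      exact ⟨sum_sq_stepDir_sub_le hd hl hW' hω (by omega) (hb t le_rfl),
        sum_sq_stepDir_le hd hl hW' hω (gd_swapInv hd lam η t₀ t) _⟩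
    · rw [hXdef]
      have h1 : Real.log (1 + 30 * (η * N)) ≤ Real.log (31 * lam) := by
        refine Real.log_le_log (by positivity) ?_
        have h2 : r ^ 8 ≤ r ^ 12 := pow_le_pow_right₀ hr1 (by norm_num)
        have h3 : 1 ≤ r ^ 12 := one_le_pow₀ hr1
        rw [← hr]; linarith
      linarith
  have E0 := earlyState hd (by omega : 1 ≤ n) hlam hη ht₀ le_rfl
  have hW0 : ‖(gd d n lam η t₀ t₀).2‖ ≤ 1 / lam * lam := by
    rw [one_div_mul_cancel hl.ne']
    refine E0.norm_le.trans ?_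
    have := le_mul_of_one_le_right (by positivity : 0 ≤ η * t₀) hn1
    linarith
  obtain ⟨b, hb⟩ := exists_isMaxMargin_symVec hd (gd_swapInv hd lam η t₀ t₀)
    (exists_hasUnitMargin hd hl fun k hk1 hk c c' c'' =>
      (attn_gap hd (by omega) hlam hη ht₀ hk1 hk c c' c'' le_rfl).2 h2t)
  -- From `n ≤ r ^ 6`, `n ^ 3 * r ^ 6 ≤ r ^ 24 = lam ^ 2`; the relative transverse part of the
  -- separator is thus far below the inverse square of the norm of the iterate.
  have hω3 : (n : ℝ) ^ 3 * (1 / lam) ^ 2 * r ^ 6 ≤ 1 := by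
    have h1 : (n : ℝ) ^ 3 ≤ (r ^ 6) ^ 3 := pow_le_pow_left₀ hn0.le hnr 3
    have e : (n : ℝ) ^ 3 * (1 / lam) ^ 2 * r ^ 6 = n ^ 3 * r ^ 6 / lam ^ 2 := by ring
    rw [e, div_le_one (by positivity), ← hr]
    calc (n : ℝ) ^ 3 * r ^ 6 ≤ (r ^ 6) ^ 3 * r ^ 6 := by gcongr
      _ = (r ^ 12) ^ 2 := by ring
  have hω0 : 0 ≤ (n : ℝ) ^ 3 * (1 / lam) ^ 2 := by positivity
  have hr6 : 10 ^ 5 * r ≤ r ^ 6 := by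
    have : r ^ 2 ≤ r ^ 6 := pow_le_pow_right₀ hr1 (by norm_num)
    nlinarith
  have hω4 : 192 * (n : ℝ) ^ 3 * (1 / lam) ^ 2 ≤ 1 / 4 := by nlinarith
  obtain ⟨hb1, hb2, hb3⟩ := separator_direction hd hn hl hW0 hω4
    (by rw [div_le_div_iff₀ hl (by norm_num)]; linarith) hb.1
  refine ⟨symVec d n b, hb, fun t ht htt hKt => ?_⟩
  obtain ⟨hq, hP⟩ := hK n N a _ η ε _ X F hδbud t ht hKt
  have hlog : 1 ≤ Real.log (η * t) := by
    have := Real.log_le_log (Real.exp_pos 1) (hKe.trans hKt)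
    rwa [Real.log_exp] at this
  have hcoord : ∀ s ≤ t, ∀ l < n, |a s l| ≤ X := fun s hs l hl => by
    linarith [F.coord_le (hs.trans ht) (F.inv (hs.trans ht)) hl]
  have hsq := norm_symVec_sq_eq hd hn (a t)
  have hq0 := perpSq_nonneg n (a t)
  rw [gd_fst hd, ← ha]
  have hPle : along (a t) ≤ ‖symVec d n (a t)‖ := by
    apply le_of_sq_le_sq _ (norm_nonneg _)
    linarith
  have hαX : ‖symVec d n (a t)‖ ^ 2 ≤ 5 * X ^ 2 := by
    have h0 := abs_le.1 (hcoord t le_rfl 0 (by omega))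
    have h1 := abs_le.1 (hcoord t le_rfl 1 (by omega))
    have h2 : along (a t) ≤ 2 * X := by unfold along; linarith
    have h3 : along (a t) ^ 2 ≤ (2 * X) ^ 2 := pow_le_pow_left₀ (by linarith) h2 2
    rw [hsq]; nlinarith
  refine ⟨by linarith, ?_, ?_⟩
  · refine alignment hd hn (by linarith) hb2 hq ?_ ?_
    · exact mul_scale_le hr1 hrX' ⟨hαX, hX0⟩ ⟨hω3, hω0⟩ (by rwa [mul_assoc 192] at hb3)
    · exact le_of_scale hr1 hrX' ⟨hαX, hX0⟩ (by rwa [hr])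
  · exact (attn_bounds hd (by omega) hlam hη hη1 ht₀ (hbud t ht) hcoord).2 htt

end

end EvenPairs

theorem theorem2 :
    ∃ Cl cη c₀ K c C : ℝ, 0 < Cl ∧ 0 < cη ∧ 0 < c₀ ∧ 0 < K ∧ 0 < c ∧ 0 < C ∧
      ∀ (Lmax d : ℕ) (lam η : ℝ) (t₀ : ℕ),
        1 ≤ Lmax → 2 * Lmax ≤ d →
        Cl * (Lmax : ℝ) ^ 2 ≤ lam →
        0 < η → η ≤ cη * min (1 / (Lmax : ℝ)) (1 / lam ^ (2 / 3 : ℝ)) →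
        2 ≤ t₀ → (t₀ : ℝ) ≤ c₀ / (η * Lmax) →
        ∃ uEP : EvenPairs.Vec d,
          EvenPairs.IsMaxMargin Lmax lam (EvenPairs.gd d Lmax lam η t₀ t₀).2 uEP ∧
          ∃ t₂ : ℕ,
            t₀ < t₂ ∧ Real.exp 1 / η ≤ (t₂ : ℝ) ∧ (t₂ : ℝ) ≤ K / η ∧
            (t₂ : ℝ) ≤ EvenPairs.horizon Lmax lam η ∧
            ∀ t : ℕ, t₂ ≤ t → (t : ℝ) ≤ EvenPairs.horizon Lmax lam η →
              c * Real.log (η * t) ≤ ‖(EvenPairs.gd d Lmax lam η t₀ t).1‖ ∧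
              c / (1 + Real.log (1 / η)) * Real.log t ≤ ‖(EvenPairs.gd d Lmax lam η t₀ t).1‖ ∧
              1 - 1 / 2 * (1 / (6 * ‖uEP‖) - 1 / ‖(EvenPairs.gd d Lmax lam η t₀ t).1‖) ^ 2 ≤
                inner ℝ
                  (‖(EvenPairs.gd d Lmax lam η t₀ t).1‖⁻¹ • (EvenPairs.gd d Lmax lam η t₀ t).1)
                  (‖uEP‖⁻¹ • uEP) ∧
              ‖(EvenPairs.gd d Lmax lam η t₀ t).2 - (EvenPairs.gd d Lmax lam η t₀ t₀).2‖ ≤ C :=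
  by
  obtain ⟨K, δ₀, hKe, hδ₀, hK₀⟩ := EvenPairs.exists_flow_constants
  obtain ⟨δ, hδ, hδ1, hK⟩ : ∃ δ : ℝ, 0 < δ ∧ δ ≤ 1 ∧ EvenPairs.FlowConstants K δ :=
    ⟨min δ₀ 1, lt_min hδ₀ one_pos, min_le_right _ _, fun n N a h η ε G X F hb =>
      hK₀ n N a h η ε G X F (hb.trans (min_le_left _ _))⟩
  have he : 1 ≤ Real.exp 1 := Real.one_le_exp zero_le_one
  have hK1 : 1 ≤ K := he.trans hKe
  -- The first entry makes the perturbation smaller than `δ`; the second ensures that time `(K + 1)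
  -- / η` lies before the horizon.
  set C : ℝ := max (10 ^ 4 / δ) (2 * (K + 1)) with hC
  have hC1 : 10 ^ 4 / δ ≤ C := le_max_left _ _
  have hC2 : 2 * (K + 1) ≤ C := le_max_right _ _
  obtain ⟨Λ, hΛ, hscale⟩ := EvenPairs.exists_scale C (by linarith)
  have hΛ0 : 0 < Λ := lt_of_lt_of_le (by norm_num) hΛ
  -- `K + 1` replaces `K` because the starting time is `⌈K / η⌉₊` and `η ≤ 1`.
  refine ⟨Λ, δ / 3200, 1 / 10 ^ 4, K + 1, 1 / 2, 1, hΛ0, by positivity, by norm_num,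
    by linarith, by norm_num, one_pos, ?_⟩
  intro n d lam η t₀ hn hd hlam hη hηle h2t ht₀
  have hn1 : (1 : ℝ) ≤ n := by exact_mod_cast hn
  have hn0 : (0 : ℝ) < n := by linarith
  have hlam6 : 10 ^ 6 * (n : ℝ) ^ 2 ≤ lam := le_trans (by gcongr) hlam
  obtain ⟨r, hr12, hr8, hr⟩ := hscale lam
    ((le_mul_of_one_le_right hΛ0.le (one_le_pow₀ hn1)).trans hlam)
  have hlog : 0 ≤ Real.log (31 * lam) := by
    refine Real.log_nonneg ?_
    have := one_le_pow₀ hn1 (n := 2)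
    linarith
  have hCr : C ≤ r := (le_mul_of_one_le_right (by linarith) (by linarith)).trans hr
  have hr1 : 1 ≤ r := by linarith
  have hr0 : 0 < r := by linarith
  have hη1 : η ≤ 1 := by
    refine hηle.trans ((mul_le_mul (by linarith) (min_le_left _ _) (le_min (by positivity) ?_)
      zero_le_one).trans ?_)
    · rw [← hr8]; positivity
    · rw [one_mul, div_le_one hn0]; exact hn1
  have hηr : η * r ^ 8 ≤ δ / 3200 := by
    have h := hηle.trans (mul_le_mul_of_nonneg_left (min_le_right _ _) (by positivity))
    rw [← hr8, mul_one_div, le_div_iff₀ (by positivity)] at h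
    exact h
  have hηt₀ : η * t₀ * n ≤ 1 / 10 ^ 4 := by
    rw [le_div_iff₀ (by positivity)] at ht₀
    linarith
  have hnr : (n : ℝ) ≤ r ^ 6 := by
    refine le_of_sq_le_sq ?_ (by positivity)
    rw [← pow_mul, hr12]
    linarith [sq_nonneg (n : ℝ)]
  have hp1 : (1 : ℝ) ≤ 2 ^ (2 / 3 : ℝ) := Real.one_le_rpow (by norm_num) (by norm_num)
  have hp2 : (2 : ℝ) ^ (2 / 3 : ℝ) ≤ 2 := by
    simpa using Real.rpow_le_rpow_of_exponent_le (by norm_num : (1 : ℝ) ≤ 2)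
      (by norm_num : (2 / 3 : ℝ) ≤ 1)
  set p : ℝ := 2 ^ (2 / 3 : ℝ) with hp
  have hor : EvenPairs.horizon n lam η = r ^ 8 / (p * η * n) := by
    unfold EvenPairs.horizon; rw [hr8]
  have hor0 : 0 ≤ EvenPairs.horizon n lam η := by rw [hor]; positivity
  have hN : η * (⌊EvenPairs.horizon n lam η⌋₊ : ℝ) * n ≤ r ^ 8 := by
    have h1 := Nat.floor_le hor0
    rw [hor, le_div_iff₀ (by positivity), ← hor] at h1
    refine le_trans ?_ h1
    have := mul_le_mul_of_nonneg_left hp1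
      (by positivity : 0 ≤ η * (⌊EvenPairs.horizon n lam η⌋₊ : ℝ) * n)
    linarith
  have hceil : (⌈K / η⌉₊ : ℝ) ≤ (K + 1) / η := by
    refine (Nat.ceil_lt_add_one (by positivity)).le.trans ?_
    rw [div_add_one hη.ne']
    gcongr
  have hKη : K / η ≤ ⌈K / η⌉₊ := Nat.le_ceil _
  have hη' : ∀ t : ℕ, ⌈K / η⌉₊ ≤ t → K ≤ η * t := by
    intro t ht
    have := Nat.ceil_le.1 ht
    rw [div_le_iff₀ hη] at this
    linarith
  have ht₂ : t₀ < ⌈K / η⌉₊ := by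
    rw [Nat.lt_ceil, lt_div_iff₀ hη]
    have := le_mul_of_one_le_right (by positivity : 0 ≤ η * t₀) hn1
    linarith
  have hlate : (⌈K / η⌉₊ : ℝ) ≤ EvenPairs.horizon n lam η := by
    refine hceil.trans ?_
    rw [hor, div_le_div_iff₀ hη (by positivity)]
    have h1 : (K + 1) * p * n ≤ r * r ^ 6 := by
      refine mul_le_mul ?_ hnr hn0.le hr0.le
      have := mul_le_mul_of_nonneg_left hp2 (by linarith : 0 ≤ K + 1)
      linarith
    have h2 : r * r ^ 6 ≤ r ^ 8 := by
      rw [← pow_succ']; exact pow_le_pow_right₀ hr1 (by norm_num)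
    have := mul_le_mul_of_nonneg_right (h1.trans h2) hη.le
    linarith
  obtain ⟨uEP, hu, hmain⟩ : ∃ uEP, EvenPairs.IsMaxMargin n lam (EvenPairs.gd d n lam η t₀ t₀).2 uEP ∧
      ∀ t ≤ ⌊EvenPairs.horizon n lam η⌋₊, t₀ ≤ t → K ≤ η * t →
        1 / 2 * Real.log (η * t) ≤ ‖(EvenPairs.gd d n lam η t₀ t).1‖ ∧
        1 - 1 / 2 * (1 / (6 * ‖uEP‖) - 1 / ‖(EvenPairs.gd d n lam η t₀ t).1‖) ^ 2 ≤
          inner ℝ (‖(EvenPairs.gd d n lam η t₀ t).1‖⁻¹ • (EvenPairs.gd d n lam η t₀ t).1)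
            (‖uEP‖⁻¹ • uEP) ∧
        ‖(EvenPairs.gd d n lam η t₀ t).2 - (EvenPairs.gd d n lam η t₀ t₀).2‖ ≤ 1 := by
    -- The separating direction needs two positions, so length one is treated apart.
    rcases hn.eq_or_lt with rfl | hn2
    · exact ⟨_, EvenPairs.isMaxMargin_single hd lam _, fun t _ _ ht =>
        EvenPairs.single_case hd lam hη t₀ (hKe.trans ht)⟩
    · exact EvenPairs.multi_case hK hKe hδ hδ1 hC1 hd hn2 hlam6 hr12 hr hη hη1 hηr h2t hηt₀ hN
  refine ⟨uEP, hu, ⌈K / η⌉₊, ht₂, le_trans (by gcongr) hKη, hceil, hlate, fun t ht htT => ?_⟩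
  obtain ⟨h1, h2, h3⟩ := hmain t (Nat.le_floor htT) (ht₂.le.trans ht) (hη' t ht)
  exact ⟨h1, EvenPairs.log_ratio_bound hη hη1 (hKe.trans (hη' t ht)) (by norm_num) h1, h2, h3⟩
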